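/- Let $0<p<1$ be a constant, and let $G(n,p)$ be the random graph on the vertex set $\{1,\dots,n\}$ in which every pair of vertices is joined by an edge independently with probability $p$. A dominating set of a graph $G=(V,E)$ is a set $D\subseteq V$ such that every vertex of $V\setminus D$ is adjacent to a vertex of $D$; the domination number $\gamma(G)$ is the least size of a dominating set. Algorithms are deterministic multi-stack Turing machines (finitely many stacks, finite alphabets, finitely many labels and internal states), graphs are given by $n$ in unary followed by the adjacency matrix, a parameter $k$ is given in unary before the graph, and a running time is a number of machine steps; expectations are over the random input $G(n,p)$. Suppose that there are a non-decreasing computable function $f:\mathbb N\to\mathbb N$, a constant $c\in\mathbb N$ and an algorithm that decides correctly, for every graph $G$ on $n\ge 1$ vertices and every $k\ge 1$, whether $G$ has a dominating set of size $k$, and whose expected running time on $(G(n,p),k)$ is $O(f(k)\,n^{c})$, i.e. at most $C f(k)n^{c}$ for all $n\ge n_0$ and all $k\ge 1$, with constants $C,n_0$ independent of $n$ and $k$. Then there are a function $r:\mathbb N\to\mathbb R$ with $r(n)=o(\log_2 n)$ and an algorithm that on every graph $G$ on $n\ge1$ vertices outputs a dominating set $D$ of $G$ with $|D|\le r(n)\,\gamma(G)$,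 and whose expected running time on $G(n,p)$ is at most $C'n^{d}$ for all $n\ge 1$, for some constants $C',d$. -/

import Mathlib

open scoped ENNReal SimpleGraph

namespace RandomDomSet

/-- `D` is a dominating set of `G`: every vertex outside `D` is adjacent to a vertex of `D`. -/
def IsDominating {V : Type*} (G : SimpleGraph V) (D : Finset V) : Prop :=
  ∀ v, v ∉ D → ∃ u ∈ D, G.Adj u v

/-- The domination number: the least cardinality of a dominating set. -/
noncomputable def dominationNumber {n : ℕ} (G : SimpleGraph (Fin n)) : ℕ :=
  sInf {m | ∃ D : Finset (Fin n), D.card = m ∧ IsDominating G D}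

/-- A deterministic algorithm: a multi-stack Turing machine whose input and output stacks carry
bits.  Finiteness of the index set of the stacks, of the labels and of the internal states is part
of `Turing.FinTM2`; finiteness of the alphabet of every stack is added here. -/
structure Algorithm extends Turing.TM2ComputableAux Bool Bool where
  finite_alphabet : ∀ k, Finite (tm.Γ k)

namespace Algorithm

/-- The initial configuration on input `x`. -/
def start (M : Algorithm) (x : List Bool) : M.tm.Cfg :=
  Turing.initList M.tm (x.map M.inputAlphabet.symm)

/-- On input `x` the machine halts with output `y` on its output stack (all other stacks being
empty and the internal state being the initial one, Mathlib's convention for halting). -/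
def Outputs (M : Algorithm) (x y : List Bool) : Prop :=
  Nonempty (Turing.TM2Outputs M.tm (x.map M.inputAlphabet.symm)
    (some (y.map M.outputAlphabet.symm)))

/-- The number of steps that the machine makes on input `x` before it halts (`⊤` if it does not
halt). -/
noncomputable def runTime (M : Algorithm) (x : List Bool) : ℕ∞ :=
  ⨅ (t : ℕ) (_ : ∃ c : M.tm.Cfg, (flip bind M.tm.step)^[t] (some (M.start x)) = some c ∧
    c.l = none), (t : ℕ∞)

end Algorithm

open Classical in
/-- A graph on `Fin n` as a bit string: `n` in unary, then the adjacency matrix, row by row. -/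
noncomputable def encodeGraph {n : ℕ} (G : SimpleGraph (Fin n)) : List Bool :=
  List.replicate n true ++ false ::
    (List.ofFn fun i => List.ofFn fun j => decide (G.Adj i j)).flatten

/-- The pair `(G, k)` as a bit string: `k` in unary, then the graph. -/
noncomputable def encodeInstance {n : ℕ} (G : SimpleGraph (Fin n)) (k : ℕ) : List Bool :=
  List.replicate k true ++ false :: encodeGraph G

/-- A set of vertices as a bit string: its characteristic vector. -/
def encodeSet {n : ℕ} (D : Finset (Fin n)) : List Bool :=
  List.ofFn fun i => decide (i ∈ D)

/-- The expected number of steps of `M` on the random graph `G(n, p)`, the input string being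
computed from the graph by `input`. -/
noncomputable def expectedTime (M : Algorithm) (p : unitInterval) (n : ℕ)
    (input : SimpleGraph (Fin n) → List Bool) : ℝ≥0∞ :=
  ∫⁻ G, (M.runTime (input G) : ℝ≥0∞) ∂(SimpleGraph.binomialRandom (Fin n) p)

open Classical in
/-- `M` answers correctly, for every nonempty graph `G` and every `k ≥ 1`, whether `G` has a
dominating set of size `k`. -/
def DecidesDomSet (M : Algorithm) : Prop :=
  ∀ n ≥ 1, ∀ k ≥ 1, ∀ G : SimpleGraph (Fin n),
    M.Outputs (encodeInstance G k)
      [decide (∃ D : Finset (Fin n), D.card = k ∧ IsDominating G D)]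

/-- The parameterized dominating set problem on `G(n, p)` can be solved in expected time
`O(f(k) n ^ c)`. -/
def DomSetSolvable (p : unitInterval) (f : ℕ → ℕ) (c : ℕ) : Prop :=
  ∃ M : Algorithm, DecidesDomSet M ∧
    ∃ C n₀ : ℕ, ∀ n ≥ 1, n ≥ n₀ → ∀ k ≥ 1,
      expectedTime M p n (fun G => encodeInstance G k) ≤ (C * f k * n ^ c : ℕ)

/-- On every nonempty graph `G` with `n` vertices, `M` outputs a dominating set of `G` whose size
is at most `r n` times the domination number of `G`. -/
def ApproximatesMinDomSet (M : Algorithm) (r : ℕ → ℝ) : Prop :=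
  ∀ n ≥ 1, ∀ G : SimpleGraph (Fin n), ∃ D : Finset (Fin n),
    M.Outputs (encodeGraph G) (encodeSet D) ∧ IsDominating G D ∧
      (D.card : ℝ) ≤ r n * dominationNumber G

/-- The expected running time of `M` on `G(n, p)` is bounded by a polynomial in `n`. -/
def ExpectedPolyTime (M : Algorithm) (p : unitInterval) : Prop :=
  ∃ C d : ℕ, ∀ n ≥ 1, expectedTime M p n encodeGraph ≤ (C * n ^ d : ℕ)

end RandomDomSet

/-!
The approximation algorithm works as follows on a graph `G` with `n` vertices. Let `L` be a large
multiple of `log n`, and let `K` be a function of `n` that tends to infinity so slowly that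
`f K < n` and `K` is a small multiple of `log n`.

1. Ask the given algorithm for all `k ≤ K` whether there is a dominating set of size `k`. All
   answers are negative if and only if the domination number exceeds `K`.
2. If so, look for a block of `L` consecutive vertices that leaves at most `L` vertices undominated.
   The block and these vertices form a dominating set of size at most `2 * L`, which is
   `2 * L / (K + 1) = o(log n)` times the domination number.
3. If some answer is positive or no block is suitable, search for an optimal dominating set among
   the tuples of `k` vertices, for `k = 1, 2, …`.

The queries take expected time at most `K * C * f K * n ^ c ≤ C * n ^ (c + 2)`. The search takes time
polynomial in `n ^ γ`, where `γ` is the domination number. It is reached in two cases. Either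
`γ ≤ K`; by a union bound over all tuples and the independence of the events that the remaining
vertices are dominated (`measure_dominationNumber_le`) this has probability at most
`n ^ K * (1 - (1 - p) ^ K) ^ (n - K)`, which beats `n ^ (c' * K)` (`exists_queryBound`). Or all blocks
are bad; then `L` vertices are undominated by each block, and a union bound over their choices
(`measure_noGoodBlock`) gives a probability that beats even `n ^ (c' * n)` if `L` is large enough
(`exists_blockLength`). The degree `c'` of the search has to be independent of `L` here, so the
machine treats `L` as a value computed at the start (`exists_algorithm`).

Since the algorithms are Turing machines, the steps above have to be programmed. Structured stack
programs (`Prog`) that can call the given machine are compiled to machines with several stacks, and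
bounded arithmetic expressions (`Ex`) are compiled to such programs, with polynomial running time;
all tests that the algorithm makes are definable by such expressions (`Def`, `DefP`). The slowly
growing function `K` has to be computable in polynomial time although `f` is an arbitrary computable
function: the graph of `f` is the projection of a bounded arithmetic relation (`exists_isGraph`, by
Gödel's beta function), and `K n` is the largest number for which witnesses below `n` show that
`f 1, …, f (K n)` are less than `n` (`exists_def_slow`).
-/

namespace RandomDomSet

open Turing

/-! ### Structured stack programs and their compilation -/

/-- The stacks that the constructed machine has in addition to those of the machine it calls:
`inp` holds the input (later the adjacency matrix), `env` the values of the variables,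
`out` the output, and `mat`, `tmp`, `aux` are scratch stacks. -/
inductive Own
  | inp | mat | env | tmp | aux | out
  deriving DecidableEq

instance : Fintype Own :=
  ⟨{.inp, .mat, .env, .tmp, .aux, .out}, fun k => by cases k <;> decide⟩

/-- The index type of the stacks of a machine that can call `M`. -/
abbrev Stk (M : Algorithm) : Type := Own ⊕ M.tm.K

/-- The alphabets of a machine that can call `M`. -/
abbrev Alph (M : Algorithm) (k : Stk M) : Type :=
  match k with
  | Sum.inl _ => Bool
  | Sum.inr k => M.tm.Γ k

/-- The internal states of a machine that can call `M`: a flag for the result of the last test, and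
the internal state of `M`. -/
abbrev Reg (M : Algorithm) : Type := Bool × M.tm.σ

/-- Contents of all stacks. -/
abbrev Store (M : Algorithm) : Type := ∀ k, List (Alph M k)

/-- Structured programs: tests look at the top of a stack, `call` runs `M` on its own stacks. -/
inductive Prog (M : Algorithm) : Type
  | push (k : Stk M) (a : Alph M k)
  | pop (k : Stk M)
  | skip
  | seq (p q : Prog M)
  | ite (k : Stk M) (c : Option (Alph M k) → Bool) (p q : Prog M)
  | loop (k : Stk M) (c : Option (Alph M k) → Bool) (p : Prog M)
  | call

namespace Prog

variable {M : Algorithm}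

/-- The labels of the compiled program. -/
def Lab : Prog M → Type
  | push _ _ => Unit
  | pop _ => Unit
  | skip => Unit
  | seq p q => p.Lab ⊕ q.Lab
  | ite _ _ p q => Option (p.Lab ⊕ q.Lab)
  | loop _ _ p => Option p.Lab
  | call => M.tm.Λ

/-- The label at which the compiled program starts. -/
def entry : (p : Prog M) → p.Lab
  | push _ _ => ()
  | pop _ => ()
  | skip => ()
  | seq p _ => Sum.inl p.entry
  | ite _ _ _ _ => none
  | loop _ _ _ => none
  | call => M.tm.main

instance finite_lab (p : Prog M) : Finite p.Lab := by
  induction p with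
  | push | pop | skip => exact inferInstanceAs (Finite Unit)
  | seq p q hp hq => exact inferInstanceAs (Finite (p.Lab ⊕ q.Lab))
  | ite _ _ p q hp hq => exact inferInstanceAs (Finite (Option (p.Lab ⊕ q.Lab)))
  | loop _ _ p hp => exact inferInstanceAs (Finite (Option p.Lab))
  | call => exact @Finite.of_fintype _ M.tm.ΛFin

/-- A statement of `M` as a statement of the larger machine; halting becomes a jump to `exit`. -/
def lift {L : Type} (inj : M.tm.Λ → L) (exit : L) :
    TM2.Stmt M.tm.Γ M.tm.Λ M.tm.σ → TM2.Stmt (Alph M) L (Reg M)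
  | .push k f q => .push (Sum.inr k) (fun s => f s.2) (lift inj exit q)
  | .peek k f q => .peek (Sum.inr k) (fun s a => (s.1, f s.2 a)) (lift inj exit q)
  | .pop k f q => .pop (Sum.inr k) (fun s a => (s.1, f s.2 a)) (lift inj exit q)
  | .load f q => .load (fun s => (s.1, f s.2)) (lift inj exit q)
  | .branch f q₁ q₂ => .branch (fun s => f s.2) (lift inj exit q₁) (lift inj exit q₂)
  | .goto f => .goto (fun s => inj (f s.2))
  | .halt => .goto (fun _ => exit)

/-- Test the top of stack `k` and jump accordingly, leaving the flag at its default value. -/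
def test {L : Type} (k : Stk M) (c : Option (Alph M k) → Bool) (l₁ l₂ : L) :
    TM2.Stmt (Alph M) L (Reg M) :=
  .peek k (fun s a => (c a, s.2)) <| .branch (fun s => s.1)
    (.load (fun s => (false, s.2)) <| .goto fun _ => l₁)
    (.load (fun s => (false, s.2)) <| .goto fun _ => l₂)

/-- The statement at each label of the compiled program, when the labels are embedded into `L` by
`inj` and the program is left by a jump to `exit`. -/
def code : (p : Prog M) → {L : Type} → (p.Lab → L) → L → p.Lab → TM2.Stmt (Alph M) L (Reg M)
  | push k a, _, _, exit, _ => .push k (fun _ => a) <| .goto fun _ => exit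
  | pop k, _, _, exit, _ => .pop k (fun s _ => s) <| .goto fun _ => exit
  | skip, _, _, exit, _ => .goto fun _ => exit
  | seq p q, _, inj, _, Sum.inl l => p.code (inj ∘ Sum.inl) (inj (Sum.inr q.entry)) l
  | seq _ q, _, inj, exit, Sum.inr l => q.code (inj ∘ Sum.inr) exit l
  | ite k c p q, _, inj, _, none =>
      test k c (inj (some (Sum.inl p.entry))) (inj (some (Sum.inr q.entry)))
  | ite _ _ p _, _, inj, exit, some (Sum.inl l) => p.code (inj ∘ some ∘ Sum.inl) exit l
  | ite _ _ _ q, _, inj, exit, some (Sum.inr l) => q.code (inj ∘ some ∘ Sum.inr) exit l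
  | loop k c p, _, inj, exit, none => test k c (inj (some p.entry)) exit
  | loop _ _ p, _, inj, _, some l => p.code (inj ∘ some) (inj none) l
  | call, _, inj, exit, l => lift inj exit (M.tm.m l)

end Prog

/-- `c'` is reached from `c` in at most `t` steps of the machine with program `m`. -/
def Steps {K : Type} [DecidableEq K] {Γ : K → Type} {L σ : Type} (m : L → TM2.Stmt Γ L σ)
    (t : ℕ) (c c' : TM2.Cfg Γ L σ) : Prop :=
  ∃ t' ≤ t, (flip bind (TM2.step m))^[t'] (some c) = some c'

section Steps

variable {K : Type} [DecidableEq K] {Γ : K → Type} {L σ : Type} {m : L → TM2.Stmt Γ L σ}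

theorem Steps.trans {t₁ t₂ : ℕ} {c₁ c₂ c₃ : TM2.Cfg Γ L σ} (h₁ : Steps m t₁ c₁ c₂)
    (h₂ : Steps m t₂ c₂ c₃) : Steps m (t₁ + t₂) c₁ c₃ := by
  obtain ⟨a, ha, h₁⟩ := h₁
  obtain ⟨b, hb, h₂⟩ := h₂
  exact ⟨b + a, by omega, by rw [Function.iterate_add_apply, h₁, h₂]⟩

theorem Steps.mono {t₁ t₂ : ℕ} {c c' : TM2.Cfg Γ L σ} (h : Steps m t₁ c c') (ht : t₁ ≤ t₂) :
    Steps m t₂ c c' :=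
  let ⟨a, ha, h⟩ := h
  ⟨a, ha.trans ht, h⟩

theorem Steps.one {l : L} {v : σ} {S : ∀ k, List (Γ k)} {c : TM2.Cfg Γ L σ}
    (h : TM2.stepAux (m l) v S = c) : Steps m 1 ⟨some l, v, S⟩ c :=
  ⟨1, le_rfl, by simp [flip, h]⟩

end Steps

section Runs

variable {M : Algorithm}

/-- Started with stack contents `S`, the program `p` terminates after at most `t` steps with stack
contents `S'`; the internal state is the initial one before and after. -/
def Runs (p : Prog M) (t : ℕ) (S S' : Store M) : Prop :=
  ∀ (L : Type) (inj : p.Lab → L) (exit : L) (m : L → TM2.Stmt (Alph M) L (Reg M)),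
    (∀ l, m (inj l) = p.code inj exit l) →
    Steps m t ⟨some (inj p.entry), (false, M.tm.initialState), S⟩
      ⟨some exit, (false, M.tm.initialState), S'⟩

namespace Runs

variable {p q : Prog M} {S S' S'' : Store M} {t t₁ t₂ : ℕ}

theorem mono (h : Runs p t₁ S S') (ht : t₁ ≤ t₂) : Runs p t₂ S S' :=
  fun L inj exit m hm => (h L inj exit m hm).mono ht

theorem push (k : Stk M) (a : Alph M k) (S : Store M) :
    Runs (.push k a) 1 S (Function.update S k (a :: S k)) :=
  fun L inj exit m hm => Steps.one (by rw [hm]; simp [Prog.code])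

theorem pop (k : Stk M) (S : Store M) :
    Runs (.pop k) 1 S (Function.update S k (S k).tail) :=
  fun L inj exit m hm => Steps.one (by rw [hm]; simp [Prog.code])

theorem skip (S : Store M) : Runs .skip 1 S S :=
  fun L inj exit m hm => Steps.one (by rw [hm]; simp [Prog.code])

theorem seq (h₁ : Runs p t₁ S S') (h₂ : Runs q t₂ S' S'') :
    Runs (.seq p q) (t₁ + t₂) S S'' := fun L inj exit m hm =>
  (h₁ L (inj ∘ Sum.inl) (inj (Sum.inr q.entry)) m fun l => hm (Sum.inl l)).trans
    (h₂ L (inj ∘ Sum.inr) exit m fun l => hm (Sum.inr l))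

theorem ite_true {k : Stk M} {c : Option (Alph M k) → Bool} (hc : c (S k).head? = true)
    (h : Runs p t S S') : Runs (.ite k c p q) (1 + t) S S' := fun L inj exit m hm =>
  (Steps.one (by
    rw [hm]
    simp only [Prog.entry, Prog.code, Prog.test, TM2.stepAux, hc, cond_true]
    rfl)).trans
    (h L (inj ∘ some ∘ Sum.inl) exit m fun l => hm (some (Sum.inl l)))

theorem ite_false {k : Stk M} {c : Option (Alph M k) → Bool} (hc : c (S k).head? = false)
    (h : Runs q t S S') : Runs (.ite k c p q) (1 + t) S S' := fun L inj exit m hm =>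
  (Steps.one (by
    rw [hm]
    simp only [Prog.entry, Prog.code, Prog.test, TM2.stepAux, hc, cond_false]
    rfl)).trans
    (h L (inj ∘ some ∘ Sum.inr) exit m fun l => hm (some (Sum.inr l)))

theorem loop_stop {k : Stk M} {c : Option (Alph M k) → Bool} (hc : c (S k).head? = false) :
    Runs (.loop k c p) 1 S S := fun L inj exit m hm =>
  Steps.one (by
    rw [hm]
    simp only [Prog.entry, Prog.code, Prog.test, TM2.stepAux, hc, cond_false])

theorem loop_step {k : Stk M} {c : Option (Alph M k) → Bool} (hc : c (S k).head? = true)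
    (h₁ : Runs p t₁ S S') (h₂ : Runs (.loop k c p) t₂ S' S'') :
    Runs (.loop k c p) (1 + t₁ + t₂) S S'' := fun L inj exit m hm =>
  ((Steps.one (by
    rw [hm]
    simp only [Prog.entry, Prog.code, Prog.test, TM2.stepAux, hc, cond_true]
    rfl)).trans
    (h₁ L (inj ∘ some) (inj none) m fun l => hm (some l))).trans (h₂ L inj exit m hm)

end Runs

/-- Stack contents composed of contents `o` of the own stacks and `s` of the stacks of `M`. -/
def store (o : Own → List Bool) (s : ∀ k, List (M.tm.Γ k)) : Store M
  | Sum.inl k => o k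
  | Sum.inr k => s k

@[simp] theorem store_inl (o : Own → List Bool) (s : ∀ k, List (M.tm.Γ k)) (k : Own) :
    store o s (Sum.inl k) = o k := rfl

@[simp] theorem store_inr (o : Own → List Bool) (s : ∀ k, List (M.tm.Γ k)) (k : M.tm.K) :
    store o s (Sum.inr k) = s k := rfl

theorem update_store_inl (o : Own → List Bool) (s : ∀ k, List (M.tm.Γ k)) (k : Own)
    (x : List Bool) :
    Function.update (store o s) (Sum.inl k) x = store (Function.update o k x) s := by
  funext j
  rcases j with j | j
  · rcases eq_or_ne j k with rfl | h
    · simp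
    · rw [Function.update_of_ne (by simpa using h)]
      simp [Function.update_of_ne h]
  · rw [Function.update_of_ne (by simp)]
    rfl

theorem update_store_inr (o : Own → List Bool) (s : ∀ k, List (M.tm.Γ k)) (k : M.tm.K)
    (x : List (M.tm.Γ k)) :
    Function.update (store o s) (Sum.inr k) x = store o (Function.update s k x) := by
  funext j
  rcases j with j | j
  · rw [Function.update_of_ne (by simp)]
    rfl
  · rcases eq_or_ne j k with rfl | h
    · simp
    · rw [Function.update_of_ne (by simpa using h)]
      simp [Function.update_of_ne h]

/-- The configuration of the larger machine that corresponds to a configuration of `M`. -/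
def liftCfg {L : Type} (inj : M.tm.Λ → L) (exit : L) (o : Own → List Bool)
    (c : TM2.Cfg M.tm.Γ M.tm.Λ M.tm.σ) : TM2.Cfg (Alph M) L (Reg M) :=
  ⟨some (c.l.elim exit inj), (false, c.var), store o c.stk⟩

/-- A step of `M` on its own stacks is simulated by one step of the larger machine. -/
theorem stepAux_lift {L : Type} (inj : M.tm.Λ → L) (exit : L) (o : Own → List Bool)
    (q : TM2.Stmt M.tm.Γ M.tm.Λ M.tm.σ) (v : M.tm.σ) (S : ∀ k, List (M.tm.Γ k)) :
    TM2.stepAux (Prog.lift inj exit q) (false, v) (store o S) =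
      liftCfg inj exit o (TM2.stepAux q v S) := by
  induction q generalizing v S with
  | push k f q ih => simp only [Prog.lift, TM2.stepAux, store_inr, update_store_inr, ih]
  | peek k f q ih => simp only [Prog.lift, TM2.stepAux, store_inr, ih]
  | pop k f q ih => simp only [Prog.lift, TM2.stepAux, store_inr, update_store_inr, ih]
  | load f q ih => simp only [Prog.lift, TM2.stepAux, ih]
  | branch f q₁ q₂ ih₁ ih₂ =>
    simp only [Prog.lift, TM2.stepAux]
    cases f v
    · simp [ih₂]
    · simp [ih₁]
  | goto f => simp [Prog.lift, liftCfg]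
  | halt => simp [Prog.lift, liftCfg]

theorem iterate_bind_none {α : Type*} (f : α → Option α) (t : ℕ) :
    (flip bind f)^[t] none = none := by
  induction t with
  | zero => rfl
  | succ t ih => rw [Function.iterate_succ_apply]; exact ih

theorem iterate_lift {L : Type} (inj : M.tm.Λ → L) (exit : L) (o : Own → List Bool)
    (m : L → TM2.Stmt (Alph M) L (Reg M))
    (hm : ∀ l, m (inj l) = Prog.lift inj exit (M.tm.m l)) (t : ℕ)
    (c c' : TM2.Cfg M.tm.Γ M.tm.Λ M.tm.σ)
    (h : (flip bind (TM2.step M.tm.m))^[t] (some c) = some c') :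
    (flip bind (TM2.step m))^[t] (some (liftCfg inj exit o c)) =
      some (liftCfg inj exit o c') := by
  induction t generalizing c with
  | zero =>
    simp only [Function.iterate_zero, id_eq, Option.some.injEq] at h
    simp [h]
  | succ t ih =>
    rw [Function.iterate_succ_apply] at h ⊢
    obtain ⟨l, v, S⟩ := c
    cases l with
    | none =>
      have : flip bind (TM2.step M.tm.m) (some ⟨none, v, S⟩) = none := rfl
      rw [this, iterate_bind_none] at h
      cases h
    | some l =>
      have h1 : flip bind (TM2.step M.tm.m) (some ⟨some l, v, S⟩) =
          some (TM2.stepAux (M.tm.m l) v S) := rfl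
      rw [h1] at h
      have h2 : flip bind (TM2.step m) (some (liftCfg inj exit o ⟨some l, v, S⟩)) =
          some (liftCfg inj exit o (TM2.stepAux (M.tm.m l) v S)) := by
        rw [← stepAux_lift, ← hm]
        rfl
      rw [h2]
      exact ih _ h

/-- The stacks of `M` with `x` on the input stack. -/
def inStk (M : Algorithm) (x : List Bool) : ∀ k, List (M.tm.Γ k) := (M.start x).stk

/-- The stacks of `M` with `y` on the output stack. -/
def outStk (M : Algorithm) (y : List Bool) : ∀ k, List (M.tm.Γ k) :=
  (haltList M.tm (y.map M.outputAlphabet.symm)).stk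

/-- A halting computation is the only one: the running time is the number of steps of any
computation that ends in a halting configuration. -/
theorem runTime_eq {M : Algorithm} {x : List Bool} {t : ℕ} {c : M.tm.Cfg}
    (h : (flip bind M.tm.step)^[t] (some (M.start x)) = some c) (hc : c.l = none) :
    M.runTime x = t := by
  have key : ∀ (t : ℕ) (c : M.tm.Cfg), (flip bind M.tm.step)^[t] (some (M.start x)) = some c →
      c.l = none → ∀ s, t < s → (flip bind M.tm.step)^[s] (some (M.start x)) = none := by
    intro t c h hc s hs
    obtain ⟨d, rfl⟩ := Nat.exists_eq_add_of_lt hs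
    rw [show t + d + 1 = d + (1 + t) by ring, Function.iterate_add_apply,
      Function.iterate_add_apply, h]
    obtain ⟨l, v, S⟩ := c
    obtain rfl : l = none := hc
    exact iterate_bind_none _ _
  refine le_antisymm (iInf₂_le t ⟨c, h, hc⟩) (le_iInf₂ fun s ⟨c', h', hc'⟩ => ?_)
  rw [Nat.cast_le]
  by_contra! hlt
  rw [key s c' h' hc' t hlt] at h
  cases h

/-- Calling `M` costs exactly its running time, because halting is replaced by a jump. -/
theorem Runs.call {x y : List Bool} (h : M.Outputs x y) {t : ℕ} (ht : M.runTime x ≤ t)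
    (o : Own → List Bool) :
    Runs .call t (store o (inStk M x)) (store o (outStk M y)) := by
  intro L inj exit m hm
  obtain ⟨⟨s, hs⟩⟩ := h
  have h1 : M.runTime x = s := runTime_eq hs rfl
  refine ⟨s, by rw [h1] at ht; exact_mod_cast ht, ?_⟩
  exact iterate_lift inj exit o m hm s _ _ hs

theorem runTime_ne_top {x y : List Bool} (h : M.Outputs x y) : M.runTime x ≠ ⊤ := by
  obtain ⟨⟨s, hs⟩⟩ := h
  rw [runTime_eq (M := M) hs rfl]
  simp

theorem inStk_nil_eq : inStk M [] = outStk M [] := by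
  funext k
  simp only [inStk, outStk, Algorithm.start, initList, haltList, List.map_nil]
  split_ifs with h1 h2 h2
  · subst h1; simp; grind
  · subst h1; simp
  · subst h2; simp
  · rfl

theorem update_inStk (x : List Bool) (b : Bool) :
    Function.update (inStk M x) M.tm.k₀ (M.inputAlphabet.symm b :: inStk M x M.tm.k₀) =
      inStk M (b :: x) := by
  funext k
  rcases eq_or_ne k M.tm.k₀ with rfl | h
  · simp [inStk, Algorithm.start, initList]
  · simp [inStk, Algorithm.start, initList, h]

theorem outStk_apply (y : List Bool) :
    outStk M y M.tm.k₁ = y.map M.outputAlphabet.symm := by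
  simp [outStk, haltList]

theorem update_outStk (y : List Bool) (b : Bool) :
    Function.update (outStk M (b :: y)) M.tm.k₁ (outStk M (b :: y) M.tm.k₁).tail =
      outStk M y := by
  funext k
  rcases eq_or_ne k M.tm.k₁ with rfl | h
  · simp [outStk, haltList]
  · simp [outStk, haltList, h]

end Runs

/-! ### Basic programs on the stack of variables -/

/-- Contents of the own stacks. -/
def own (inp mat env tmp aux out : List Bool) : Own → List Bool
  | .inp => inp
  | .mat => mat
  | .env => env
  | .tmp => tmp
  | .aux => aux
  | .out => out

section own

variable (a b e t u w x : List Bool)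

@[simp] theorem own_inp : own a b e t u w .inp = a := rfl
@[simp] theorem own_mat : own a b e t u w .mat = b := rfl
@[simp] theorem own_env : own a b e t u w .env = e := rfl
@[simp] theorem own_tmp : own a b e t u w .tmp = t := rfl
@[simp] theorem own_aux : own a b e t u w .aux = u := rfl
@[simp] theorem own_out : own a b e t u w .out = w := rfl

@[simp] theorem update_own_inp :
    Function.update (own a b e t u w) .inp x = own x b e t u w := by
  funext k; cases k <;> simp [Function.update]
@[simp] theorem update_own_mat :
    Function.update (own a b e t u w) .mat x = own a x e t u w := by
  funext k; cases k <;> simp [Function.update]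
@[simp] theorem update_own_env :
    Function.update (own a b e t u w) .env x = own a b x t u w := by
  funext k; cases k <;> simp [Function.update]
@[simp] theorem update_own_tmp :
    Function.update (own a b e t u w) .tmp x = own a b e x u w := by
  funext k; cases k <;> simp [Function.update]
@[simp] theorem update_own_aux :
    Function.update (own a b e t u w) .aux x = own a b e t x w := by
  funext k; cases k <;> simp [Function.update]
@[simp] theorem update_own_out :
    Function.update (own a b e t u w) .out x = own a b e t u x := by
  funext k; cases k <;> simp [Function.update]

end own

namespace Prog

variable {M : Algorithm}

/-- Push the bit `b` on an own stack. -/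
def pushO (k : Own) (b : Bool) : Prog M := .push (Sum.inl k) b

/-- Pop an own stack. -/
def popO (k : Own) : Prog M := .pop (Sum.inl k)

/-- Case distinction on the top of an own stack. -/
def iteO (k : Own) (c : Option Bool → Bool) (p q : Prog M) : Prog M := .ite (Sum.inl k) c p q

/-- Repeat `p` as long as the top of an own stack satisfies `c`. -/
def loopO (k : Own) (c : Option Bool → Bool) (p : Prog M) : Prog M := .loop (Sum.inl k) c p

/-- The test whether the top of a stack is `true`. -/
def top : Option Bool → Bool := fun b => b == some true

@[simp] theorem top_none : top none = false := rfl
@[simp] theorem top_some (b : Bool) : top (some b) = b := by cases b <;> rfl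

/-- Move a block of `true`s from stack `k` to stack `j`. -/
def mv (k j : Own) : Prog M := loopO k top (.seq (popO k) (pushO j true))

/-- Move a block of `true`s from stack `k` to the stacks `i` and `j`. -/
def mv₂ (k i j : Own) : Prog M :=
  loopO k top (.seq (popO k) (.seq (pushO i true) (pushO j true)))

end Prog

open Prog

namespace Runs

variable {M : Algorithm} {s : ∀ k, List (M.tm.Γ k)} {p q : Prog M} {o o' o'' : Own → List Bool}
  {t t₁ t₂ : ℕ}

theorem pushO (k : Own) (b : Bool) (o : Own → List Bool) :
    Runs (.pushO k b) 1 (store o s) (store (Function.update o k (b :: o k)) s) := by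
  have := Runs.push (M := M) (Sum.inl k) b (store o s)
  rwa [update_store_inl] at this

theorem popO (k : Own) (o : Own → List Bool) :
    Runs (.popO k) 1 (store o s) (store (Function.update o k (o k).tail) s) := by
  have := Runs.pop (M := M) (Sum.inl k) (store o s)
  rwa [update_store_inl] at this

theorem loopO_stop {k : Own} {c : Option Bool → Bool} (hc : c (o k).head? = false) :
    Runs (.loopO k c p) 1 (store o s) (store o s) :=
  Runs.loop_stop (S := store o s) (k := Sum.inl k) hc

theorem loopO_step {k : Own} {c : Option Bool → Bool} (hc : c (o k).head? = true)
    {S S' : Store M} (h₁ : Runs p t₁ (store o s) S) (h₂ : Runs (.loopO k c p) t₂ S S') :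
    Runs (.loopO k c p) (1 + t₁ + t₂) (store o s) S' :=
  Runs.loop_step (S := store o s) (k := Sum.inl k) hc h₁ h₂

theorem iteO_true {k : Own} {c : Option Bool → Bool} (hc : c (o k).head? = true)
    {S : Store M} (h : Runs p t (store o s) S) :
    Runs (.iteO k c p q) (1 + t) (store o s) S :=
  Runs.ite_true (S := store o s) (k := Sum.inl k) hc h

theorem iteO_false {k : Own} {c : Option Bool → Bool} (hc : c (o k).head? = false)
    {S : Store M} (h : Runs q t (store o s) S) :
    Runs (.iteO k c p q) (1 + t) (store o s) S :=
  Runs.ite_false (S := store o s) (k := Sum.inl k) hc h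

theorem congr {S₁ S₂ : Store M} (h : Runs p t S₁ S₂) (ho : S₂ = store o s) (ht : t ≤ t₁) :
    Runs p t₁ S₁ (store o s) := ho ▸ h.mono ht

theorem mv {k j : Own} (hkj : k ≠ j) (n : ℕ) {r : List Bool} (hr : top r.head? = false)
    (h : o k = List.replicate n true ++ r) :
    Runs (.mv k j) (3 * n + 1) (store o s)
      (store (Function.update (Function.update o k r) j (List.replicate n true ++ o j)) s) := by
  induction n generalizing o with
  | zero =>
    have h' : o k = r := by simpa using h
    refine (loopO_stop (o := o) (by rw [h']; exact hr)).congr ?_ (by omega)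
    rw [← h']; simp
  | succ n ih =>
    have h1 := ih (o := Function.update (Function.update o k (o k).tail) j (true :: o j)) (by
      rw [Function.update_of_ne hkj, Function.update_self, h]; rfl)
    have h2 := (popO (s := s) k o).seq (pushO j true _)
    rw [Function.update_of_ne hkj.symm] at h2
    refine (loopO_step (by rw [h]; rfl) h2 h1).congr ?_ (by omega)
    congr 1
    funext x
    rcases eq_or_ne x j with rfl | hx
    · simp [List.replicate_succ']
    · rcases eq_or_ne x k with rfl | hx'
      · simp [hx]
      · simp [hx, hx']

theorem mv₂ {k i j : Own} (hki : k ≠ i) (hkj : k ≠ j) (hij : i ≠ j) (n : ℕ) {r : List Bool}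
    (hr : top r.head? = false) (h : o k = List.replicate n true ++ r) :
    Runs (.mv₂ k i j) (4 * n + 1) (store o s)
      (store (Function.update (Function.update (Function.update o k r)
        i (List.replicate n true ++ o i)) j (List.replicate n true ++ o j)) s) := by
  induction n generalizing o with
  | zero =>
    have h' : o k = r := by simpa using h
    refine (loopO_stop (o := o) (by rw [h']; exact hr)).congr ?_ (by omega)
    rw [← h']; simp
  | succ n ih =>
    have h1 := ih (o := Function.update (Function.update (Function.update o k (o k).tail)
      i (true :: o i)) j (true :: o j)) (by
      rw [Function.update_of_ne hkj, Function.update_of_ne hki, Function.update_self, h]; rfl)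
    have h2 := (popO (s := s) k o).seq ((pushO i true _).seq (pushO j true _))
    rw [Function.update_of_ne hki.symm, Function.update_of_ne hij.symm,
      Function.update_of_ne hkj.symm] at h2
    refine (loopO_step (by rw [h]; rfl) h2 h1).congr ?_ (by omega)
    congr 1
    funext x
    rcases eq_or_ne x j with rfl | hx
    · simp [List.replicate_succ']
    · rcases eq_or_ne x i with rfl | hx'
      · simp [List.replicate_succ', hx]
      · rcases eq_or_ne x k with rfl | hx''
        · simp [hx, hx']
        · simp [hx, hx', hx'']

end Runs

/-- A list of numbers as a bit string: each number in unary, followed by a `false`. -/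
def enc : List ℕ → List Bool
  | [] => []
  | n :: l => List.replicate n true ++ false :: enc l

@[simp] theorem enc_nil : enc [] = [] := rfl

theorem enc_cons (n : ℕ) (l : List ℕ) :
    enc (n :: l) = List.replicate n true ++ false :: enc l := rfl

theorem top_head_enc_cons (n : ℕ) (l : List ℕ) :
    top (enc (n :: l)).head? = decide (n ≠ 0) := by
  cases n <;> simp [enc_cons, List.replicate_succ]

/-- The stacks while variables are being manipulated: the bit string `a` (the adjacency matrix) is
kept on the stack `inp`, the values of the variables are `l`, and `w` has been output. -/
def vars (M : Algorithm) (a : List Bool) (l : List ℕ) (w : List Bool) : Store M :=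
  store (own a [] (enc l) [] [] w) (inStk M [])

namespace Prog

variable {M : Algorithm}

/-- Copy the variable at depth `i` to the stack `mat`. -/
def copyAt : ℕ → Prog M
  | 0 => .seq (mv₂ .env .aux .mat) (mv .aux .env)
  | i + 1 => .seq (.seq (mv .env .tmp) (.seq (popO .env) (pushO .tmp false)))
      (.seq (copyAt i) (.seq (popO .tmp) (.seq (pushO .env false) (mv .tmp .env))))

/-- Push a copy of the variable at depth `i` on the stack of variables. -/
def pick (i : ℕ) : Prog M := .seq (copyAt i) (.seq (pushO .env false) (mv .mat .env))

/-- Replace the upper two variables by their sum. -/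
def addO : Prog M := .seq (mv .env .tmp) (.seq (popO .env) (mv .tmp .env))

/-- Replace the upper two variables by their truncated difference. -/
def subO : Prog M := .seq (.seq (mv .env .tmp) (popO .env))
  (loopO .tmp top (.seq (popO .tmp) (iteO .env top (popO .env) .skip)))

/-- Add the top variable to the one at depth two, and delete it. -/
def addUnder : Prog M := .seq (mv .env .tmp) (.seq (popO .env) (.seq (mv .env .aux)
  (.seq (popO .env) (.seq (mv .tmp .env) (.seq (pushO .env false) (mv .aux .env))))))

/-- Subtract the top variable from the one at depth two, and delete it. -/
def subUnder : Prog M := .seq (.seq (mv .env .tmp) (.seq (popO .env) (.seq (mv .env .aux)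
  (popO .env)))) (.seq (loopO .tmp top (.seq (popO .tmp) (iteO .env top (popO .env) .skip)))
    (.seq (pushO .env false) (mv .aux .env)))

/-- Move one symbol from stack `k` to stack `j`. -/
def shift (k j : Own) : Prog M :=
  .iteO k Option.isSome (.iteO k top (.seq (popO k) (pushO j true))
    (.seq (popO k) (pushO j false))) .skip

/-- Move all symbols from `mat` to `inp`. -/
def restore : Prog M := loopO .mat Option.isSome (shift .mat .inp)

/-- Replace the top variable `i` by the `i`-th symbol on the stack `inp`. -/
def readBit : Prog M :=
  .seq (loopO .env top (.seq (popO .env) (shift .inp .mat))) <|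
  .seq (iteO .inp top (pushO .env true) .skip) restore

end Prog

namespace Runs

variable {M : Algorithm} {s : ∀ k, List (M.tm.Γ k)} {a e t u w : List Bool} {l : List ℕ} {B : ℕ}

theorem copyAt (i : ℕ) (l : List ℕ) (t : List Bool) (ht : top t.head? = false) {x : ℕ}
    (hx : l[i]? = some x) (hB : ∀ y ∈ l, y ≤ B) :
    Runs (.copyAt i) ((i + 1) * (7 * B + 8)) (store (own a [] (enc l) t [] w) s)
      (store (own a (List.replicate x true) (enc l) t [] w) s) := by
  induction i generalizing l t with
  | zero =>
    obtain ⟨y, l, rfl⟩ : ∃ y l', l = y :: l' := by cases l <;> simp_all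
    obtain rfl : y = x := by simpa using hx
    have hy : y ≤ B := hB y (by simp)
    have h1 := Runs.mv₂ (M := M) (s := s) (k := .env) (i := .aux) (j := .mat)
      (o := own a [] (enc (y :: l)) t [] w) (by decide) (by decide) (by decide) y
      (r := false :: enc l) rfl rfl
    simp only [update_own_env, update_own_aux, update_own_mat, own_aux, own_mat,
      List.append_nil] at h1
    refine (h1.seq (Runs.mv (by decide) y (r := []) rfl (by simp))).congr ?_ (by omega)
    simp [enc_cons]
  | succ i ih =>
    obtain ⟨y, l, rfl⟩ : ∃ y l', l = y :: l' := by cases l <;> simp_all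
    have hy : y ≤ B := hB y (by simp)
    have h1 := Runs.mv (M := M) (s := s) (k := .env) (j := .tmp)
      (o := own a [] (enc (y :: l)) t [] w) (by decide) y (r := false :: enc l) rfl rfl
    have h2 := h1.seq ((popO .env _).seq (pushO .tmp false _))
    simp only [update_own_env, update_own_tmp, own_env, own_tmp, List.tail_cons] at h2
    have h3 := ih l (false :: (List.replicate y true ++ t)) rfl (by simpa using hx)
      fun z hz => hB z (by simp [hz])
    have h4 := (popO (M := M) (s := s) .tmp (own a (List.replicate x true) (enc l)
      (false :: (List.replicate y true ++ t)) [] w)).seq ((pushO .env false _).seq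
        (Runs.mv (k := .tmp) (j := .env) (by decide) y (r := t) ht (by simp)))
    refine (h2.seq (h3.seq h4)).congr ?_ ?_
    · simp [enc_cons]
    · ring_nf; nlinarith

theorem pick (i : ℕ) {x : ℕ} (hx : l[i]? = some x) (hB : ∀ y ∈ l, y ≤ B) :
    Runs (.pick i) ((i + 2) * (7 * B + 8)) (vars M a l w) (vars M a (x :: l) w) := by
  have hxB : x ≤ B := hB x (List.mem_of_getElem? hx)
  refine ((copyAt i l [] rfl hx hB).seq ((pushO .env false _).seq
    (Runs.mv (k := .mat) (j := .env) (by decide) x (r := []) rfl (by simp)))).congr ?_ ?_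
  · simp [enc_cons]
  · ring_nf; nlinarith

theorem addO (x y : ℕ) :
    Runs .addO (6 * x + 3) (vars M a (x :: y :: l) w) (vars M a ((x + y) :: l) w) := by
  refine ((Runs.mv (k := .env) (j := .tmp) (by decide) x (r := false :: enc (y :: l)) rfl rfl).seq
    ((popO _ _).seq (Runs.mv (k := .tmp) (j := .env) (by decide) x (r := []) rfl
      (by simp)))).congr ?_ (by omega)
  simp [enc_cons, ← List.append_assoc]

/-- Truncated subtraction of a number on the stack `tmp` from the top variable. -/
theorem sub_loop (x y : ℕ) (u : List Bool) :
    Runs (M := M) (Prog.loopO .tmp top (.seq (Prog.popO .tmp)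
      (Prog.iteO .env top (Prog.popO .env) .skip))) (4 * x + 1)
      (store (own a [] (enc (y :: l)) (List.replicate x true) u w) s)
      (store (own a [] (enc ((y - x) :: l)) [] u w) s) := by
  induction x generalizing y with
  | zero => exact loopO_stop rfl
  | succ x ih =>
    have h3 := popO (M := M) (s := s) .tmp (own a [] (enc (y :: l))
      (List.replicate (x + 1) true) u w)
    simp only [update_own_tmp, own_tmp, List.replicate_succ, List.tail_cons] at h3
    cases y with
    | zero =>
      refine (loopO_step rfl (h3.seq (iteO_false rfl (Runs.skip _))) (ih 0)).congr ?_ (by omega)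
      simp
    | succ y =>
      have h4 := popO (M := M) (s := s) .env (own a [] (enc ((y + 1) :: l))
        (List.replicate x true) u w)
      rw [own_env, update_own_env] at h4
      refine (loopO_step rfl (h3.seq (iteO_true rfl h4)) (ih y)).congr ?_ (by omega)
      simp

theorem subO (x y : ℕ) :
    Runs .subO (7 * x + 3) (vars M a (x :: y :: l) w) (vars M a ((y - x) :: l) w) := by
  have h1 := (Runs.mv (M := M) (s := inStk M []) (o := own a [] (enc (x :: y :: l)) [] [] w)
    (k := .env) (j := .tmp) (by decide) x
    (r := false :: enc (y :: l)) rfl rfl).seq (popO .env _)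
  simp only [update_own_env, update_own_tmp, own_env, own_tmp, List.tail_cons,
    List.append_nil] at h1
  exact (h1.seq (sub_loop x y [])).mono (by omega)

theorem subUnder (x i y : ℕ) :
    Runs .subUnder (7 * x + 6 * i + 7) (vars M a (x :: i :: y :: l) w)
      (vars M a (i :: (y - x) :: l) w) := by
  have h1 := (Runs.mv (M := M) (s := inStk M []) (o := own a [] (enc (x :: i :: y :: l)) [] [] w)
    (k := .env) (j := .tmp) (by decide) x (r := false :: enc (i :: y :: l)) rfl rfl).seq
      ((popO .env _).seq ((Runs.mv (k := .env) (j := .aux) (by decide) i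
        (r := false :: enc (y :: l)) rfl (by simp [enc_cons])).seq (popO .env _)))
  simp only [update_own_env, update_own_tmp, update_own_aux, own_env, own_tmp, own_aux,
    List.tail_cons, List.append_nil] at h1
  refine (h1.seq ((sub_loop x y (List.replicate i true)).seq ((pushO .env false _).seq
    (Runs.mv (k := .aux) (j := .env) (by decide) i (r := []) rfl (by simp))))).congr ?_ (by omega)
  simp [enc_cons]

theorem addUnder (x i y : ℕ) :
    Runs .addUnder (6 * x + 6 * i + 7) (vars M a (x :: i :: y :: l) w)
      (vars M a (i :: (x + y) :: l) w) := by
  refine ((Runs.mv (k := .env) (j := .tmp) (by decide) x (r := false :: enc (i :: y :: l))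
    rfl rfl).seq ((popO _ _).seq ((Runs.mv (k := .env) (j := .aux) (by decide) i
      (r := false :: enc (y :: l)) rfl (by simp [enc_cons])).seq ((popO _ _).seq
        ((Runs.mv (k := .tmp) (j := .env) (by decide) x (r := []) rfl (by simp)).seq
          ((pushO .env false _).seq (Runs.mv (k := .aux) (j := .env) (by decide) i (r := []) rfl
            (by simp)))))))).congr ?_ (by omega)
  simp [enc_cons, ← List.append_assoc]

theorem shift {k j : Own} (hkj : k ≠ j) (o : Own → List Bool) (b : Bool) (r : List Bool)
    (h : o k = b :: r) :
    Runs (.shift k j) 4 (store o s)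
      (store (Function.update (Function.update o k r) j (b :: o j)) s) := by
  have h1 : Runs _ _ _ _ := (popO (s := s) k o).seq (pushO j b _)
  rw [Function.update_of_ne hkj.symm, h, List.tail_cons] at h1
  cases b with
  | true => exact iteO_true (by rw [h]; rfl) (iteO_true (by rw [h]; rfl) h1)
  | false => exact iteO_true (by rw [h]; rfl) (iteO_false (by rw [h]; rfl) h1)

theorem shift_nil {k j : Own} (o : Own → List Bool) (h : o k = []) :
    Runs (.shift k j) 2 (store o s) (store o s) :=
  iteO_false (by rw [h]; rfl) (Runs.skip _)

theorem restore (a b : List Bool) :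
    Runs .restore (5 * b.length + 1) (store (own a b e t u w) s)
      (store (own (b.reverse ++ a) [] e t u w) s) := by
  induction b generalizing a with
  | nil => exact loopO_stop rfl
  | cons x b ih =>
    refine (loopO_step rfl (shift (by decide) _ x b rfl) ?_ (S' :=
      (store (own ((x :: b).reverse ++ a) [] e t u w) s)) (t₂ := 5 * b.length + 1)).congr rfl ?_
    · simpa [Prog.restore] using ih (x :: a)
    · simp; omega

theorem readBit (x : ℕ) :
    Runs .readBit (11 * x + 4) (vars M a (x :: l) w)
      (vars M a ((a.getD x false).toNat :: l) w) := by
  have h1 : ∀ x a b, Runs (M := M) (Prog.loopO .env top (.seq (Prog.popO .env) (Prog.shift .inp .mat)))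
      (6 * x + 1) (store (own a b (enc (x :: l)) [] [] w) (inStk M []))
      (store (own (a.drop x) ((a.take x).reverse ++ b) (enc (0 :: l)) [] [] w) (inStk M [])) := by
    intro x
    induction x with
    | zero => exact fun a b => (loopO_stop rfl).congr (by simp) (by simp)
    | succ x ih =>
      intro a b
      have h3 := popO (M := M) (s := inStk M []) .env (own a b (enc ((x + 1) :: l)) [] [] w)
      rw [own_env, update_own_env] at h3
      cases a with
      | nil =>
        refine (loopO_step rfl (h3.seq (shift_nil _ rfl)) (ih [] b)).congr ?_ (by omega)
        simp
      | cons y a =>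
        have h4 := shift (M := M) (s := inStk M []) (k := .inp) (j := .mat) (by decide)
          (own (y :: a) b (enc (x :: l)) [] [] w) y a rfl
        simp only [update_own_inp, update_own_mat, own_mat] at h4
        refine (loopO_step rfl (h3.seq h4) (ih a (y :: b))).congr ?_ (by omega)
        simp
  have h2 : Runs (M := M) (Prog.iteO .inp top (Prog.pushO .env true) .skip) 2
      (store (own (a.drop x) ((a.take x).reverse ++ []) (enc (0 :: l)) [] [] w) (inStk M []))
      (store (own (a.drop x) ((a.take x).reverse ++ [])
        (enc ((a.getD x false).toNat :: l)) [] [] w) (inStk M [])) := by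
    rcases h : a[x]? with _ | b
    · exact (iteO_false (by simp [h]) (Runs.skip _)).congr (by simp [h]) le_rfl
    · cases b
      · exact (iteO_false (by simp [h]) (Runs.skip _)).congr (by simp [h]) le_rfl
      · exact (iteO_true (by simp [h]) (pushO _ _ _)).congr (by simp [h, enc_cons]) le_rfl
  refine ((h1 x a []).seq (h2.seq (restore _ _))).congr ?_ ?_
  · simp
  · simp; omega

end Runs

/-! ### Polynomially bounded functions -/

/-- A function on the natural numbers bounded by a polynomial, in the form `(B + 2) ^ c`. -/
def PolyBdd (g : ℕ → ℕ) : Prop := ∃ c, ∀ B, g B ≤ (B + 2) ^ c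

namespace PolyBdd

variable {g h : ℕ → ℕ}

theorem const (k : ℕ) : PolyBdd fun _ => k :=
  ⟨k, fun B => Nat.lt_two_pow_self.le.trans (Nat.pow_le_pow_left (by omega) k)⟩

theorem id : PolyBdd fun B => B := ⟨1, fun B => by simp⟩

theorem add (hg : PolyBdd g) (hh : PolyBdd h) : PolyBdd fun B => g B + h B := by
  obtain ⟨c, hc⟩ := hg
  obtain ⟨d, hd⟩ := hh
  refine ⟨c + d + 1, fun B => ?_⟩
  have h1 : (B + 2) ^ c ≤ (B + 2) ^ (c + d) := Nat.pow_le_pow_right (by omega) (by omega)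
  have h2 : (B + 2) ^ d ≤ (B + 2) ^ (c + d) := Nat.pow_le_pow_right (by omega) (by omega)
  have := hc B
  have := hd B
  rw [pow_succ]
  nlinarith

theorem mul (hg : PolyBdd g) (hh : PolyBdd h) : PolyBdd fun B => g B * h B := by
  obtain ⟨c, hc⟩ := hg
  obtain ⟨d, hd⟩ := hh
  refine ⟨c + d, fun B => ?_⟩
  rw [pow_add]
  exact Nat.mul_le_mul (hc B) (hd B)

theorem comp (hg : PolyBdd g) (hh : PolyBdd h) : PolyBdd fun B => g (h B) := by
  obtain ⟨c, hc⟩ := hg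
  obtain ⟨d, hd⟩ := hh
  refine ⟨(d + 2) * c, fun B => (hc _).trans ?_⟩
  rw [pow_mul]
  refine Nat.pow_le_pow_left ?_ c
  have h1 := hd B
  have h2 : 1 ≤ (B + 2) ^ d := Nat.one_le_pow _ _ (by omega)
  have h3 : 2 ^ 2 ≤ (B + 2) ^ 2 := Nat.pow_le_pow_left (by omega) 2
  rw [pow_add]
  nlinarith

end PolyBdd

/-! ### Bounded arithmetic expressions -/

/-- Expressions of bounded arithmetic over a bit string, with `m` free variables: addition,
truncated subtraction, access to the bit string, bounded summation, which binds variable `0` in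
its second argument, and the iteration `b` times of `x ↦ x - e x` on `a`, which binds variable `0`
in `e`. No value exceeds a polynomial in the values of the variables. -/
inductive Ex : ℕ → Type
  | var {m : ℕ} (i : Fin m) : Ex m
  | zero {m : ℕ} : Ex m
  | succ {m : ℕ} (a : Ex m) : Ex m
  | add {m : ℕ} (a b : Ex m) : Ex m
  | sub {m : ℕ} (a b : Ex m) : Ex m
  | bit {m : ℕ} (a : Ex m) : Ex m
  | sum {m : ℕ} (a : Ex m) (b : Ex (m + 1)) : Ex m
  | iter {m : ℕ} (a b : Ex m) (e : Ex (m + 1)) : Ex m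

namespace Ex

/-- The value of an expression. -/
def eval (A : List Bool) : {m : ℕ} → Ex m → (Fin m → ℕ) → ℕ
  | _, var i, v => v i
  | _, zero, _ => 0
  | _, succ a, v => a.eval A v + 1
  | _, add a b, v => a.eval A v + b.eval A v
  | _, sub a b, v => a.eval A v - b.eval A v
  | _, bit a, v => (A.getD (a.eval A v) false).toNat
  | _, sum a b, v => ∑ i ∈ Finset.range (a.eval A v), b.eval A (Fin.cons i v)
  | _, iter a b e, v => (fun x => x - e.eval A (Fin.cons x v))^[b.eval A v] (a.eval A v)

theorem iterate_sub_le (h : ℕ → ℕ) (n x : ℕ) : (fun x => x - h x)^[n] x ≤ x := by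
  induction n with
  | zero => exact le_rfl
  | succ n ih =>
    rw [Function.iterate_succ_apply']
    exact (Nat.sub_le _ _).trans ih

/-- The values of an expression grow polynomially. -/
theorem exists_eval_le {m : ℕ} (e : Ex m) :
    ∃ g, PolyBdd g ∧ ∀ A B v, (∀ i, v i ≤ B) → e.eval A v ≤ g B := by
  induction e with
  | var i => exact ⟨_, PolyBdd.id, fun A B v h => h i⟩
  | zero => exact ⟨_, PolyBdd.const 0, fun A B v h => le_rfl⟩
  | succ a ha =>
    obtain ⟨g, hg, h⟩ := ha
    exact ⟨_, hg.add (PolyBdd.const 1), fun A B v hv => Nat.add_le_add_right (h A B v hv) 1⟩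
  | add a b ha hb =>
    obtain ⟨g, hg, h⟩ := ha
    obtain ⟨g', hg', h'⟩ := hb
    exact ⟨_, hg.add hg', fun A B v hv => Nat.add_le_add (h A B v hv) (h' A B v hv)⟩
  | sub a b ha hb =>
    obtain ⟨g, hg, h⟩ := ha
    exact ⟨g, hg, fun A B v hv => (Nat.sub_le _ _).trans (h A B v hv)⟩
  | bit a ha => exact ⟨_, PolyBdd.const 1, fun A B v hv => Bool.toNat_le _⟩
  | sum a b ha hb =>
    obtain ⟨g, hg, h⟩ := ha
    obtain ⟨g', hg', h'⟩ := hb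
    refine ⟨_, hg.mul (hg'.comp (PolyBdd.id.add hg)), fun A B v hv => ?_⟩
    have h1 : ∀ i ∈ Finset.range (a.eval A v), b.eval A (Fin.cons i v) ≤ g' (B + g B) := by
      intro i hi
      have hi' : i < g B := (Finset.mem_range.1 hi).trans_le (h A B v hv)
      refine h' A _ _ fun j => ?_
      refine Fin.cases ?_ (fun j => ?_) j
      · simp; omega
      · simpa using (hv j).trans (by omega)
    refine (Finset.sum_le_card_nsmul _ _ _ h1).trans ?_
    simpa using Nat.mul_le_mul_right _ (h A B v hv)
  | iter a b e ha hb he =>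
    obtain ⟨g, hg, h⟩ := ha
    exact ⟨g, hg, fun A B v hv => (iterate_sub_le _ _ _).trans (h A B v hv)⟩

/-- Compilation of an expression; `r i` is the depth of the `i`-th variable on the stack of
variables, on which the value is pushed. -/
def compile (M : Algorithm) : {m : ℕ} → Ex m → (Fin m → ℕ) → Prog M
  | _, var i, r => Prog.pick (r i)
  | _, zero, _ => Prog.pushO .env false
  | _, succ a, r => .seq (a.compile M r) (Prog.pushO .env true)
  | _, add a b, r => .seq (a.compile M r) (.seq (b.compile M fun i => r i + 1) Prog.addO)
  | _, sub a b, r => .seq (a.compile M r) (.seq (b.compile M fun i => r i + 1) Prog.subO)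
  | _, bit a, r => .seq (a.compile M r) Prog.readBit
  | _, sum a b, r => .seq (Prog.pushO .env false) <| .seq (a.compile M fun i => r i + 1) <|
      .seq (Prog.loopO .env Prog.top <| .seq (Prog.popO .env) <|
        .seq (b.compile M (Fin.cons 0 fun i => r i + 2)) Prog.addUnder) <| Prog.popO .env
  | _, iter a b e, r => .seq (a.compile M r) <| .seq (b.compile M fun i => r i + 1) <|
      .seq (Prog.loopO .env Prog.top <| .seq (Prog.popO .env) <|
        .seq (e.compile M (Fin.cons 1 fun i => r i + 2)) Prog.subUnder) <| Prog.popO .env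

end Ex

namespace Runs

variable {M : Algorithm} {a w : List Bool} {l : List ℕ} {t : ℕ} {p : Prog M}

theorem pushZero : Runs (.pushO .env false) 1 (vars M a l w) (vars M a (0 :: l) w) :=
  (pushO _ _ _).congr (by simp [enc_cons]) le_rfl

theorem incr (x : ℕ) :
    Runs (.pushO .env true) 1 (vars M a (x :: l) w) (vars M a ((x + 1) :: l) w) :=
  (pushO _ _ _).congr (by simp [enc_cons, List.replicate_succ]) le_rfl

theorem decr (x : ℕ) :
    Runs (.popO .env) 1 (vars M a ((x + 1) :: l) w) (vars M a (x :: l) w) :=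
  (popO _ _).congr (by simp [enc_cons, List.replicate_succ]) le_rfl

theorem dropZero : Runs (.popO .env) 1 (vars M a (0 :: l) w) (vars M a l w) :=
  (popO _ _).congr (by simp [enc_cons]) le_rfl

theorem cast {S S' S'' : Store M} {t' : ℕ} (h : Runs p t S S') (hS : S' = S'') (ht : t ≤ t') :
    Runs p t' S S'' := hS ▸ h.mono ht

end Runs

/-- The compiled expression pushes the value of the expression in polynomial time. -/
theorem Ex.exists_runs {M : Algorithm} {m : ℕ} (e : Ex m) (r : Fin m → ℕ) :
    ∃ g, PolyBdd g ∧ ∀ A B v l w, (∀ x ∈ l, x ≤ B) → (∀ i, l[r i]? = some (v i)) →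
      Runs (e.compile M r) (g B) (vars M A l w) (vars M A (e.eval A v :: l) w) := by
  have hvB : ∀ {k : ℕ} {r v : Fin k → ℕ} {l : List ℕ} {B : ℕ}, (∀ x ∈ l, x ≤ B) →
      (∀ i, l[r i]? = some (v i)) → ∀ i, v i ≤ B :=
    fun hl hv i => hl _ (List.mem_of_getElem? (hv i))
  induction e with
  | var i =>
    exact ⟨_, (PolyBdd.const (r i + 2)).mul (((PolyBdd.const 7).mul PolyBdd.id).add
      (PolyBdd.const 8)), fun A B v l w hl hv => Runs.pick (r i) (hv i) hl⟩
  | zero => exact ⟨_, PolyBdd.const 1, fun A B v l w hl hv => Runs.pushZero⟩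
  | succ a ha =>
    obtain ⟨g, hg, h⟩ := ha r
    exact ⟨_, hg.add (PolyBdd.const 1), fun A B v l w hl hv => (h A B v l w hl hv).seq
      (Runs.incr _)⟩
  | bit a ha =>
    obtain ⟨g, hg, h⟩ := ha r
    obtain ⟨f, hf, h'⟩ := a.exists_eval_le
    refine ⟨_, hg.add (((PolyBdd.const 11).mul hf).add (PolyBdd.const 4)),
      fun A B v l w hl hv => ((h A B v l w hl hv).seq (Runs.readBit _)).mono ?_⟩
    have := h' A B v (hvB hl hv)
    omega
  | add a b ha hb =>
    obtain ⟨g₁, hg₁, h₁⟩ := ha r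
    obtain ⟨f₁, hf₁, h₁'⟩ := a.exists_eval_le
    obtain ⟨g₂, hg₂, h₂⟩ := hb fun i => r i + 1
    obtain ⟨f₂, hf₂, h₂'⟩ := b.exists_eval_le
    refine ⟨_, hg₁.add ((hg₂.comp (PolyBdd.id.add hf₁)).add
      (((PolyBdd.const 6).mul hf₂).add (PolyBdd.const 3))), fun A B v l w hl hv => ?_⟩
    have e₁ := h₁' A B v (hvB hl hv)
    have e₂ := h₂' A B v (hvB hl hv)
    refine ((h₁ A B v l w hl hv).seq ((h₂ A (B + f₁ B) v (a.eval A v :: l) w ?_ ?_).seq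
      (Runs.addO _ _))).cast ?_ ?_
    · intro x hx
      rcases List.mem_cons.1 hx with rfl | hx
      · omega
      · have := hl x hx; omega
    · simpa using hv
    · rw [Ex.eval, add_comm]
    · omega
  | sub a b ha hb =>
    obtain ⟨g₁, hg₁, h₁⟩ := ha r
    obtain ⟨f₁, hf₁, h₁'⟩ := a.exists_eval_le
    obtain ⟨g₂, hg₂, h₂⟩ := hb fun i => r i + 1
    obtain ⟨f₂, hf₂, h₂'⟩ := b.exists_eval_le
    refine ⟨_, hg₁.add ((hg₂.comp (PolyBdd.id.add hf₁)).add
      (((PolyBdd.const 7).mul hf₂).add (PolyBdd.const 3))), fun A B v l w hl hv => ?_⟩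
    have e₁ := h₁' A B v (hvB hl hv)
    have e₂ := h₂' A B v (hvB hl hv)
    refine ((h₁ A B v l w hl hv).seq ((h₂ A (B + f₁ B) v (a.eval A v :: l) w ?_ ?_).seq
      (Runs.subO _ _))).cast rfl ?_
    · intro x hx
      rcases List.mem_cons.1 hx with rfl | hx
      · omega
      · have := hl x hx; omega
    · simpa using hv
    · omega
  | sum a b ha hb =>
    obtain ⟨g₁, hg₁, h₁⟩ := ha fun i => r i + 1
    obtain ⟨f₁, hf₁, h₁'⟩ := a.exists_eval_le
    obtain ⟨g₂, hg₂, h₂⟩ := hb (Fin.cons 0 fun i => r i + 2)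
    obtain ⟨f₂, hf₂, h₂'⟩ := b.exists_eval_le
    -- `W` bounds the summands, `D` the variables during the loop, `T` the time of one round
    have hW : PolyBdd fun B => f₂ (B + f₁ B) := hf₂.comp (PolyBdd.id.add hf₁)
    have hD : PolyBdd fun B => B + f₁ B + f₁ B * f₂ (B + f₁ B) :=
      (PolyBdd.id.add hf₁).add (hf₁.mul hW)
    have hT : PolyBdd fun B => 9 + g₂ (B + f₁ B + f₁ B * f₂ (B + f₁ B)) + 6 * f₂ (B + f₁ B) +
        6 * f₁ B :=
      (((PolyBdd.const 9).add (hg₂.comp hD)).add ((PolyBdd.const 6).mul hW)).add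
        ((PolyBdd.const 6).mul hf₁)
    refine ⟨_, (PolyBdd.const 3).add (hg₁.add (hf₁.mul hT)), fun A B v l w hl hv => ?_⟩
    have e₁ := h₁' A B v (hvB hl hv)
    have e₂ : ∀ i < f₁ B, b.eval A (Fin.cons i v) ≤ f₂ (B + f₁ B) := by
      intro i hi
      refine h₂' A _ _ fun j => ?_
      refine Fin.cases ?_ (fun j => ?_) j
      · simp; omega
      · simpa using (hvB hl hv j).trans (by omega)
    have loop : ∀ n s, n ≤ f₁ B → s + n * f₂ (B + f₁ B) ≤ f₁ B * f₂ (B + f₁ B) →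
        Runs (M := M) (Prog.loopO .env Prog.top <| .seq (Prog.popO .env) <|
          .seq (b.compile M (Fin.cons 0 fun i => r i + 2)) Prog.addUnder)
          (n * (9 + g₂ (B + f₁ B + f₁ B * f₂ (B + f₁ B)) + 6 * f₂ (B + f₁ B) + 6 * f₁ B) + 1)
          (vars M A (n :: s :: l) w)
          (vars M A (0 :: (s + ∑ i ∈ Finset.range n, b.eval A (Fin.cons i v)) :: l) w) := by
      intro n
      induction n with
      | zero => exact fun s _ _ => (Runs.loopO_stop rfl).cast (by simp [vars]) (by simp)
      | succ n ih =>
        intro s hn hs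
        have e₃ := e₂ n (by omega)
        have h3 := h₂ A (B + f₁ B + f₁ B * f₂ (B + f₁ B)) (Fin.cons n v) (n :: s :: l) w
          (fun x hx => by
            simp only [List.mem_cons] at hx
            rcases hx with rfl | rfl | hx
            · omega
            · omega
            · have := hl x hx; omega)
          (fun j => by refine Fin.cases ?_ (fun j => ?_) j <;> simp [hv])
        have h4 := ih (b.eval A (Fin.cons n v) + s) (by omega) (by
          rw [add_mul, one_mul] at hs; omega)
        refine (Runs.loopO_step ?_ ((Runs.decr n).seq (h3.seq (Runs.addUnder _ _ _))) h4).cast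
          ?_ ?_
        · rw [own_env, top_head_enc_cons]; rfl
        · rw [Finset.sum_range_succ]; congr 3; ring
        · rw [add_mul, one_mul]; omega
    have h5 := h₁ A B v (0 :: l) w
      (fun x hx => by
        rcases List.mem_cons.1 hx with rfl | hx
        · omega
        · exact hl x hx)
      (by simpa using hv)
    refine (Runs.pushZero.seq (h5.seq ((loop _ 0 e₁ ?_).seq Runs.dropZero))).cast ?_ ?_
    · rw [zero_add]; exact Nat.mul_le_mul_right _ e₁
    · rw [zero_add]; rfl
    · have := Nat.mul_le_mul_right (9 + g₂ (B + f₁ B + f₁ B * f₂ (B + f₁ B)) +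
        6 * f₂ (B + f₁ B) + 6 * f₁ B) e₁
      omega
  | iter a b e ha hb he =>
    obtain ⟨g₁, hg₁, h₁⟩ := ha r
    obtain ⟨f₁, hf₁, h₁'⟩ := a.exists_eval_le
    obtain ⟨g₂, hg₂, h₂⟩ := hb fun i => r i + 1
    obtain ⟨f₂, hf₂, h₂'⟩ := b.exists_eval_le
    obtain ⟨g₃, hg₃, h₃⟩ := he (Fin.cons 1 fun i => r i + 2)
    obtain ⟨f₃, hf₃, h₃'⟩ := e.exists_eval_le
    -- `D` bounds the variables during the loop, `T` the time of one round
    have hD : PolyBdd fun B => B + f₁ B + f₂ B := (PolyBdd.id.add hf₁).add hf₂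
    have hT : PolyBdd fun B => 9 + g₃ (B + f₁ B + f₂ B) + 7 * f₃ (B + f₁ B + f₂ B) + 6 * f₂ B :=
      (((PolyBdd.const 9).add (hg₃.comp hD)).add ((PolyBdd.const 7).mul (hf₃.comp hD))).add
        ((PolyBdd.const 6).mul hf₂)
    refine ⟨_, (PolyBdd.const 2).add (hg₁.add ((hg₂.comp (PolyBdd.id.add hf₁)).add
      (hf₂.mul hT))), fun A B v l w hl hv => ?_⟩
    have e₁ := h₁' A B v (hvB hl hv)
    have e₂ := h₂' A B v (hvB hl hv)
    have loop : ∀ n x, n ≤ f₂ B → x ≤ f₁ B →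
        Runs (M := M) (Prog.loopO .env Prog.top <| .seq (Prog.popO .env) <|
          .seq (e.compile M (Fin.cons 1 fun i => r i + 2)) Prog.subUnder)
          (n * (9 + g₃ (B + f₁ B + f₂ B) + 7 * f₃ (B + f₁ B + f₂ B) + 6 * f₂ B) + 1)
          (vars M A (n :: x :: l) w)
          (vars M A (0 :: (fun x => x - e.eval A (Fin.cons x v))^[n] x :: l) w) := by
      intro n
      induction n with
      | zero => exact fun s _ _ => (Runs.loopO_stop rfl).cast (by simp [vars]) (by simp)
      | succ n ih =>
        intro x hn hx
        have e₃ : e.eval A (Fin.cons x v) ≤ f₃ (B + f₁ B + f₂ B) := by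
          refine h₃' A _ _ fun j => ?_
          refine Fin.cases ?_ (fun j => ?_) j
          · simp; omega
          · simpa using (hvB hl hv j).trans (by omega)
        have h3 := h₃ A (B + f₁ B + f₂ B) (Fin.cons x v) (n :: x :: l) w
          (fun y hy => by
            simp only [List.mem_cons] at hy
            rcases hy with rfl | rfl | hy
            · omega
            · omega
            · have := hl y hy; omega)
          (fun j => by refine Fin.cases ?_ (fun j => ?_) j <;> simp [hv])
        have h4 := ih (x - e.eval A (Fin.cons x v)) (by omega) (by omega)
        refine (Runs.loopO_step ?_ ((Runs.decr n).seq (h3.seq (Runs.subUnder _ _ _))) h4).cast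
          ?_ ?_
        · rw [own_env, top_head_enc_cons]; rfl
        · rw [Function.iterate_succ_apply]
        · rw [add_mul, one_mul]; omega
    have h5 := h₂ A (B + f₁ B) v (a.eval A v :: l) w
      (fun x hx => by
        rcases List.mem_cons.1 hx with rfl | hx
        · omega
        · have := hl x hx; omega)
      (by simpa using hv)
    refine ((h₁ A B v l w hl hv).seq (h5.seq ((loop _ _ e₂ e₁).seq Runs.dropZero))).cast rfl ?_
    have := Nat.mul_le_mul_right (9 + g₃ (B + f₁ B + f₂ B) + 7 * f₃ (B + f₁ B + f₂ B) +
      6 * f₂ B) e₂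
    omega

/-! ### Definable functions -/

/-- A function of a bit string and `m` numbers is definable if it is the value of an expression. -/
def Def (m : ℕ) (g : List Bool → (Fin m → ℕ) → ℕ) : Prop :=
  ∃ e : Ex m, ∀ A v, e.eval A v = g A v

namespace Def

variable {m k : ℕ} {f g h : List Bool → (Fin m → ℕ) → ℕ}

theorem congr (hf : Def m f) (h : ∀ A v, f A v = g A v) : Def m g :=
  let ⟨e, he⟩ := hf
  ⟨e, fun A v => (he A v).trans (h A v)⟩

theorem var (i : Fin m) : Def m fun _ v => v i := ⟨.var i, fun _ _ => rfl⟩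

theorem const (c : ℕ) : Def m fun _ _ => c := by
  induction c with
  | zero => exact ⟨.zero, fun _ _ => rfl⟩
  | succ c ih =>
    obtain ⟨e, he⟩ := ih
    exact ⟨.succ e, fun A v => by rw [Ex.eval, he]⟩

theorem add (hf : Def m f) (hg : Def m g) : Def m fun A v => f A v + g A v :=
  let ⟨a, ha⟩ := hf
  let ⟨b, hb⟩ := hg
  ⟨.add a b, fun A v => by rw [Ex.eval, ha, hb]⟩

theorem sub (hf : Def m f) (hg : Def m g) : Def m fun A v => f A v - g A v :=
  let ⟨a, ha⟩ := hf
  let ⟨b, hb⟩ := hg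
  ⟨.sub a b, fun A v => by rw [Ex.eval, ha, hb]⟩

theorem bit (hf : Def m f) : Def m fun A v => (A.getD (f A v) false).toNat :=
  let ⟨a, ha⟩ := hf
  ⟨.bit a, fun A v => by rw [Ex.eval, ha]⟩

theorem sum {b : List Bool → (Fin m → ℕ) → ℕ → ℕ} (hf : Def m f)
    (hb : Def (m + 1) fun A v => b A (fun i => v i.succ) (v 0)) :
    Def m fun A v => ∑ i ∈ Finset.range (f A v), b A v i :=
  let ⟨a, ha⟩ := hf
  let ⟨e, he⟩ := hb
  ⟨.sum a e, fun A v => by rw [Ex.eval, ha]; exact Finset.sum_congr rfl fun i _ => he A _⟩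

theorem iter {b : List Bool → (Fin m → ℕ) → ℕ → ℕ} (hf : Def m f) (hg : Def m g)
    (hb : Def (m + 1) fun A v => b A (fun i => v i.succ) (v 0)) :
    Def m fun A v => (fun x => x - b A v x)^[g A v] (f A v) :=
  let ⟨a, ha⟩ := hf
  let ⟨c, hc⟩ := hg
  let ⟨e, he⟩ := hb
  ⟨.iter a c e, fun A v => by
    rw [Ex.eval, ha, hc]
    refine congrArg (fun h => Nat.iterate h _ _) (funext fun x => ?_)
    rw [he]
    rfl⟩

theorem _root_.RandomDomSet.Ex.exists_rename (e : Ex m) (r : Fin m → Fin k) :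
    ∃ e' : Ex k, ∀ A v, e'.eval A v = e.eval A fun i => v (r i) := by
  induction e generalizing k with
  | var i => exact ⟨.var (r i), fun A v => rfl⟩
  | zero => exact ⟨.zero, fun A v => rfl⟩
  | succ a ha =>
    obtain ⟨a', ha⟩ := ha r
    exact ⟨.succ a', fun A v => by simp only [Ex.eval, ha]⟩
  | add a b ha hb =>
    obtain ⟨a', ha⟩ := ha r
    obtain ⟨b', hb⟩ := hb r
    exact ⟨.add a' b', fun A v => by simp only [Ex.eval, ha, hb]⟩
  | sub a b ha hb =>
    obtain ⟨a', ha⟩ := ha r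
    obtain ⟨b', hb⟩ := hb r
    exact ⟨.sub a' b', fun A v => by simp only [Ex.eval, ha, hb]⟩
  | bit a ha =>
    obtain ⟨a', ha⟩ := ha r
    exact ⟨.bit a', fun A v => by simp only [Ex.eval, ha]⟩
  | sum a b ha hb =>
    obtain ⟨a', ha⟩ := ha r
    obtain ⟨b', hb⟩ := hb (Fin.cons 0 fun i => (r i).succ)
    refine ⟨.sum a' b', fun A v => ?_⟩
    simp only [Ex.eval, ha, hb]
    refine Finset.sum_congr rfl fun i _ => congrArg _ (funext fun j => ?_)
    refine Fin.cases ?_ (fun j => ?_) j <;> simp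
  | iter a b e ha hb he =>
    obtain ⟨a', ha⟩ := ha r
    obtain ⟨b', hb⟩ := hb r
    obtain ⟨e', he⟩ := he (Fin.cons 0 fun i => (r i).succ)
    refine ⟨.iter a' b' e', fun A v => ?_⟩
    simp only [Ex.eval, ha, hb, he]
    congr 1
    refine funext fun x => congrArg (fun v => x - e.eval A v) (funext fun j => ?_)
    refine Fin.cases ?_ (fun j => ?_) j <;> simp

theorem rename (hf : Def m f) (r : Fin m → Fin k) : Def k fun A v => f A fun i => v (r i) :=
  let ⟨e, he⟩ := hf
  let ⟨e', h'⟩ := e.exists_rename r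
  ⟨e', fun A v => (h' A v).trans (he A _)⟩

theorem weaken (hf : Def m f) : Def (m + 1) fun A v => f A fun i => v i.succ :=
  hf.rename Fin.succ

theorem mul (hf : Def m f) (hg : Def m g) : Def m fun A v => f A v * g A v :=
  (hf.sum (b := fun A v _ => g A v) hg.weaken).congr fun A v => by simp

/-- Substitution of definable functions for the variables. -/
theorem comp {f : List Bool → (Fin k → ℕ) → ℕ} (hf : Def k f)
    {g : Fin k → List Bool → (Fin m → ℕ) → ℕ} (hg : ∀ i, Def m (g i)) :
    Def m fun A v => f A fun i => g i A v := by
  obtain ⟨e, he⟩ := hf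
  suffices Def m fun A v => e.eval A fun i => g i A v from this.congr fun A v => he A _
  clear he f
  induction e generalizing m with
  | var i => exact hg i
  | zero => exact const 0
  | succ a ha => exact (ha hg).add (const 1)
  | add a b ha hb => exact (ha hg).add (hb hg)
  | sub a b ha hb => exact (ha hg).sub (hb hg)
  | bit a ha => exact (ha hg).bit
  | sum a b ha hb =>
    refine (ha hg).sum ?_
    have := hb (g := Fin.cons (fun _ v => v 0) fun i A v => g i A fun j => v j.succ) fun i => by
      refine Fin.cases ?_ (fun i => ?_) i
      · exact var 0
      · exact (hg i).weaken
    refine this.congr fun A v => congrArg _ (funext fun j => ?_)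
    refine Fin.cases ?_ (fun j => ?_) j <;> simp
  | iter a b e ha hb he =>
    refine (ha hg).iter (hb hg) ?_
    have := he (g := Fin.cons (fun _ v => v 0) fun i A v => g i A fun j => v j.succ) fun i => by
      refine Fin.cases ?_ (fun i => ?_) i
      · exact var 0
      · exact (hg i).weaken
    refine this.congr fun A v => congrArg _ (funext fun j => ?_)
    refine Fin.cases ?_ (fun j => ?_) j <;> simp

end Def

open Classical in
/-- The truth value of a proposition as a number. -/
noncomputable def ind (P : Prop) : ℕ := if P then 1 else 0

theorem ind_of_true {P : Prop} (h : P) : ind P = 1 := if_pos h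

theorem ind_of_false {P : Prop} (h : ¬P) : ind P = 0 := if_neg h

theorem ind_le_one (P : Prop) : ind P ≤ 1 := by
  unfold ind; split_ifs <;> simp

theorem ind_ne_zero {P : Prop} : ind P ≠ 0 ↔ P := by
  unfold ind; split_ifs <;> simpa

/-- A relation is definable if its truth value is. -/
def DefP (m : ℕ) (P : List Bool → (Fin m → ℕ) → Prop) : Prop := Def m fun A v => ind (P A v)

namespace DefP

variable {m : ℕ} {f g h : List Bool → (Fin m → ℕ) → ℕ} {P Q : List Bool → (Fin m → ℕ) → Prop}

theorem congr (hP : DefP m P) (h : ∀ A v, P A v ↔ Q A v) : DefP m Q :=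
  Def.congr hP fun A v => by rw [h]

theorem pos (hf : Def m f) : DefP m fun A v => 0 < f A v :=
  ((Def.const 1).sub ((Def.const 1).sub hf)).congr fun A v => by
    rcases Nat.eq_zero_or_pos (f A v) with h | h
    · rw [ind_of_false (by omega)]; omega
    · rw [ind_of_true h]; omega

theorem lt (hf : Def m f) (hg : Def m g) : DefP m fun A v => f A v < g A v :=
  (pos (hg.sub hf)).congr fun A v => by omega

theorem not (hP : DefP m P) : DefP m fun A v => ¬P A v :=
  ((Def.const 1).sub hP).congr fun A v => by
    by_cases h : P A v
    · rw [ind_of_true h, ind_of_false (by simpa)]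
    · rw [ind_of_false h, ind_of_true h]

theorem and (hP : DefP m P) (hQ : DefP m Q) : DefP m fun A v => P A v ∧ Q A v :=
  (Def.mul hP hQ).congr fun A v => by
    by_cases h : P A v <;> by_cases h' : Q A v <;> simp [ind, h, h']

theorem or (hP : DefP m P) (hQ : DefP m Q) : DefP m fun A v => P A v ∨ Q A v :=
  (not (and (not hP) (not hQ))).congr fun A v => by tauto

theorem imp (hP : DefP m P) (hQ : DefP m Q) : DefP m fun A v => P A v → Q A v :=
  (or (not hP) hQ).congr fun A v => by tauto

theorem le (hf : Def m f) (hg : Def m g) : DefP m fun A v => f A v ≤ g A v :=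
  (lt hg hf).not.congr fun A v => by omega

theorem eq (hf : Def m f) (hg : Def m g) : DefP m fun A v => f A v = g A v :=
  (and (le hf hg) (le hg hf)).congr fun A v => by omega

theorem exists_lt {P : List Bool → (Fin m → ℕ) → ℕ → Prop} (hf : Def m f)
    (hP : DefP (m + 1) fun A v => P A (fun i => v i.succ) (v 0)) :
    DefP m fun A v => ∃ i < f A v, P A v i :=
  (pos (hf.sum (b := fun A v i => ind (P A v i)) hP)).congr fun A v => by
    simp [Nat.pos_iff_ne_zero, ind_ne_zero]

theorem forall_lt {P : List Bool → (Fin m → ℕ) → ℕ → Prop} (hf : Def m f)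
    (hP : DefP (m + 1) fun A v => P A (fun i => v i.succ) (v 0)) :
    DefP m fun A v => ∀ i < f A v, P A v i :=
  (exists_lt (P := fun A v i => ¬P A v i) hf hP.not).not.congr fun A v => by simp

end DefP

namespace Def

variable {m : ℕ} {f g h : List Bool → (Fin m → ℕ) → ℕ}

theorem ite {P : List Bool → (Fin m → ℕ) → Prop} [∀ A v, Decidable (P A v)] (hP : DefP m P)
    (hf : Def m f) (hg : Def m g) : Def m fun A v => if P A v then f A v else g A v :=
  ((Def.mul hP hf).add (Def.mul hP.not hg)).congr fun A v => by
    by_cases h : P A v <;> simp [ind, h]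

theorem div (hf : Def m f) (hg : Def m g) : Def m fun A v => f A v / g A v := by
  refine (hf.sum (b := fun A v i => ind (0 < g A v ∧ (i + 1) * g A v ≤ f A v))
    ((DefP.pos hg.weaken).and (DefP.le (((var 0).add (const 1)).mul hg.weaken)
      hf.weaken))).congr fun A v => ?_
  classical
  rw [show ∑ i ∈ Finset.range (f A v), ind (0 < g A v ∧ (i + 1) * g A v ≤ f A v) =
    ((Finset.range (f A v)).filter fun i => 0 < g A v ∧ (i + 1) * g A v ≤ f A v).card by
      rw [Finset.card_filter]; exact Finset.sum_congr rfl fun i _ => by simp [ind]]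
  rcases Nat.eq_zero_or_pos (g A v) with h | h
  · simp [h]
  · have : (Finset.range (f A v)).filter (fun i => 0 < g A v ∧ (i + 1) * g A v ≤ f A v) =
        Finset.range (f A v / g A v) := by
      ext i
      simp only [Finset.mem_filter, Finset.mem_range, h, true_and,
        ← Nat.le_div_iff_mul_le h]
      have := Nat.div_le_self (f A v) (g A v)
      omega
    rw [this, Finset.card_range]

theorem mod (hf : Def m f) (hg : Def m g) : Def m fun A v => f A v % g A v :=
  (hf.sub ((hf.div hg).mul hg)).congr fun A v => by
    rw [Nat.mod_eq_sub, mul_comm]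

/-- The quotient by a power is obtained by iterated division: the power itself may be too large to be
the value of an expression. -/
theorem div_pow {i : List Bool → (Fin m → ℕ) → ℕ} (hf : Def m f) (hg : Def m g)
    (hi : Def m i) : Def m fun A v => f A v / g A v ^ i A v := by
  refine (hf.iter (b := fun A v x => x - x / g A v) hi
    ((var 0).sub ((var 0).div hg.weaken))).congr fun A v => ?_
  generalize i A v = k
  induction k with
  | zero => simp
  | succ k ih =>
    rw [Function.iterate_succ_apply', ih, Nat.sub_sub_self (Nat.div_le_self _ _),
      Nat.div_div_eq_div_mul, pow_succ]

theorem min (hf : Def m f) (hg : Def m g) : Def m fun A v => min (f A v) (g A v) :=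
  (hf.sub (hf.sub hg)).congr fun A v => by omega

theorem pair (hf : Def m f) (hg : Def m g) : Def m fun A v => Nat.pair (f A v) (g A v) :=
  ite (DefP.lt hf hg) ((hg.mul hg).add hf) (((hf.mul hf).add hf).add hg)

theorem unpair_fst (hf : Def m f) : Def m fun A v => (f A v).unpair.1 := by
  refine ((hf.add (const 1)).sum
    (b := fun A v y => y * ind (∃ z < f A v + 1, Nat.pair y z = f A v)) ?_).congr fun A v => ?_
  · refine (var 0).mul (DefP.exists_lt (hf.weaken.add (const 1)) ?_)
    exact DefP.eq (pair (var 1) (var 0)) hf.weaken.weaken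
  · rw [Finset.sum_eq_single (f A v).unpair.1]
    · rw [ind_of_true, mul_one]
      exact ⟨_, Nat.lt_succ_of_le (Nat.unpair_right_le _), Nat.pair_unpair _⟩
    · intro y _ hy
      rw [ind_of_false, mul_zero]
      rintro ⟨z, _, hz⟩
      exact hy (by rw [← hz, Nat.unpair_pair])
    · intro h
      exact absurd (Finset.mem_range.2 (Nat.lt_succ_of_le (Nat.unpair_left_le _))) h

theorem unpair_snd (hf : Def m f) : Def m fun A v => (f A v).unpair.2 := by
  refine ((hf.add (const 1)).sum
    (b := fun A v y => y * ind (∃ z < f A v + 1, Nat.pair z y = f A v)) ?_).congr fun A v => ?_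
  · refine (var 0).mul (DefP.exists_lt (hf.weaken.add (const 1)) ?_)
    exact DefP.eq (pair (var 0) (var 1)) hf.weaken.weaken
  · rw [Finset.sum_eq_single (f A v).unpair.2]
    · rw [ind_of_true, mul_one]
      exact ⟨_, Nat.lt_succ_of_le (Nat.unpair_left_le _), Nat.pair_unpair _⟩
    · intro y _ hy
      rw [ind_of_false, mul_zero]
      rintro ⟨z, _, hz⟩
      exact hy (by rw [← hz, Nat.unpair_pair])
    · intro h
      exact absurd (Finset.mem_range.2 (Nat.lt_succ_of_le (Nat.unpair_right_le _))) h

theorem beta (hf : Def m f) (hg : Def m g) : Def m fun A v => Nat.beta (f A v) (g A v) :=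
  hf.unpair_fst.mod (((hg.add (const 1)).mul hf.unpair_snd).add (const 1))

end Def

/-! ### Graphs of computable functions -/

/-- A ternary relation on the natural numbers is definable. -/
def DefRel (R : ℕ → ℕ → ℕ → Prop) : Prop := DefP 3 fun _ v => R (v 0) (v 1) (v 2)

theorem DefRel.app {R : ℕ → ℕ → ℕ → Prop} (hR : DefRel R) {m : ℕ}
    {a b c : List Bool → (Fin m → ℕ) → ℕ} (ha : Def m a) (hb : Def m b) (hc : Def m c) :
    DefP m fun A v => R (a A v) (b A v) (c A v) := by
  have := Def.comp (g := ![a, b, c]) hR fun i => by fin_cases i <;> assumption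
  exact this.congr fun A v => by simp

/-- The relation `R w x y` is definable, monotone in the bound `w`, and `∃ w, R w x y` is the graph
of `f`. -/
structure IsGraph (f : ℕ → Part ℕ) (R : ℕ → ℕ → ℕ → Prop) : Prop where
  defRel : DefRel R
  mono : ∀ w w' x y, w ≤ w' → R w x y → R w' x y
  graph : ∀ x y, y ∈ f x ↔ ∃ w, R w x y

theorem exists_forall_lt_of_mono {P : ℕ → ℕ → Prop} (hP : ∀ i w w', w ≤ w' → P i w → P i w')
    (n : ℕ) (h : ∀ i < n, ∃ w, P i w) : ∃ w, ∀ i < n, P i w := by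
  induction n with
  | zero => exact ⟨0, by simp⟩
  | succ n ih =>
    obtain ⟨w, hw⟩ := ih fun i hi => h i (by omega)
    obtain ⟨w', hw'⟩ := h n (by omega)
    refine ⟨max w w', fun i hi => ?_⟩
    rcases Nat.lt_succ_iff_lt_or_eq.1 hi with hi | rfl
    · exact hP _ _ _ (le_max_left _ _) (hw i hi)
    · exact hP _ _ _ (le_max_right _ _) hw'

/-- A value of a function defined by primitive recursion is witnessed by the sequence of the
preceding values. -/
theorem mem_rec_iff {f : Part ℕ} {g : ℕ → ℕ → Part ℕ} (n y : ℕ) :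
    y ∈ (Nat.rec f (fun i r => r.bind (g i)) n : Part ℕ) ↔
      ∃ c : ℕ → ℕ, c 0 ∈ f ∧ (∀ i < n, c (i + 1) ∈ g i (c i)) ∧ c n = y := by
  induction n generalizing y with
  | zero => exact ⟨fun h => ⟨fun _ => y, h, by simp, rfl⟩, fun ⟨c, h, _, hy⟩ => hy ▸ h⟩
  | succ n ih =>
    simp only [Part.mem_bind_iff, ih]
    constructor
    · rintro ⟨z, ⟨c, h0, h1, rfl⟩, hy⟩
      refine ⟨fun i => if i = n + 1 then y else c i, by simpa using h0, fun i hi => ?_, by simp⟩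
      rcases Nat.lt_succ_iff_lt_or_eq.1 hi with hi | rfl
      · have h2 : i ≠ n + 1 := by omega
        have h3 : i ≠ n := by omega
        simpa [h2, h3] using h1 i hi
      · simpa using hy
    · rintro ⟨c, h0, h1, rfl⟩
      exact ⟨c n, ⟨c, h0, fun i hi => h1 i (by omega), rfl⟩, h1 n (by omega)⟩

/-- Gödel's beta function codes finite sequences. -/
theorem exists_beta (c : ℕ → ℕ) (n : ℕ) : ∃ s, ∀ i ≤ n, Nat.beta s i = c i := by
  refine ⟨Nat.unbeta (List.ofFn fun i : Fin (n + 1) => c i), fun i hi => ?_⟩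
  have := Nat.beta_unbeta_coe (List.ofFn fun i : Fin (n + 1) => c i) ⟨i, by simp; omega⟩
  rw [this]
  simp [-List.ofFn_succ]

namespace IsGraph

variable {f g : ℕ → Part ℕ} {R T : ℕ → ℕ → ℕ → Prop}

theorem pair (hR : IsGraph f R) (hT : IsGraph g T) :
    IsGraph (fun x => Nat.pair <$> f x <*> g x)
      fun w x y => R w x y.unpair.1 ∧ T w x y.unpair.2 where
  defRel := (hR.defRel.app (Def.var 0) (Def.var 1) (Def.var 2).unpair_fst).and
    (hT.defRel.app (Def.var 0) (Def.var 1) (Def.var 2).unpair_snd)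
  mono w w' x y hw h := ⟨hR.mono _ _ _ _ hw h.1, hT.mono _ _ _ _ hw h.2⟩
  graph x y := by
    have : y ∈ (Nat.pair <$> f x <*> g x) ↔ y.unpair.1 ∈ f x ∧ y.unpair.2 ∈ g x := by
      simp only [Seq.seq, Part.map_eq_map, Part.mem_bind_iff, Part.mem_map_iff]
      constructor
      · rintro ⟨_, ⟨a, ha, rfl⟩, b, hb, rfl⟩
        simpa using ⟨ha, hb⟩
      · rintro ⟨ha, hb⟩
        exact ⟨_, ⟨_, ha, rfl⟩, _, hb, by simp⟩
    rw [this, hR.graph, hT.graph]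
    constructor
    · rintro ⟨⟨w, hw⟩, w', hw'⟩
      exact ⟨max w w', hR.mono _ _ _ _ (le_max_left _ _) hw, hT.mono _ _ _ _ (le_max_right _ _) hw'⟩
    · rintro ⟨w, h, h'⟩
      exact ⟨⟨w, h⟩, w, h'⟩

theorem comp (hR : IsGraph f R) (hT : IsGraph g T) :
    IsGraph (fun x => g x >>= f) fun w x y => ∃ z < w, T w x z ∧ R w z y where
  defRel := DefP.exists_lt (P := fun _ v z => T (v 0) (v 1) z ∧ R (v 0) z (v 2)) (Def.var 0)
    ((hT.defRel.app (Def.var 1) (Def.var 2) (Def.var 0)).and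
      (hR.defRel.app (Def.var 1) (Def.var 0) (Def.var 3)))
  mono := by
    rintro w w' x y hw ⟨z, hz, h₁, h₂⟩
    exact ⟨z, by omega, hT.mono _ _ _ _ hw h₁, hR.mono _ _ _ _ hw h₂⟩
  graph x y := by
    simp only [Part.bind_eq_bind, Part.mem_bind_iff, hR.graph, hT.graph]
    constructor
    · rintro ⟨z, ⟨w, hw⟩, w', hw'⟩
      exact ⟨w + w' + z + 1, z, by omega, hT.mono _ _ _ _ (by omega) hw,
        hR.mono _ _ _ _ (by omega) hw'⟩
    · rintro ⟨w, z, -, h, h'⟩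
      exact ⟨z, ⟨w, h⟩, w, h'⟩

theorem prec (hR : IsGraph f R) (hT : IsGraph g T) :
    IsGraph (Nat.unpaired fun a n => n.rec (f a) fun y IH => do
      let i ← IH
      g (Nat.pair a (Nat.pair y i)))
      fun w x y => ∃ s < w, R w x.unpair.1 (Nat.beta s 0) ∧
        (∀ i < x.unpair.2, T w (Nat.pair x.unpair.1 (Nat.pair i (Nat.beta s i)))
          (Nat.beta s (i + 1))) ∧ Nat.beta s x.unpair.2 = y where
  defRel := by
    refine DefP.exists_lt (P := fun _ v s => R (v 0) (v 1).unpair.1 (Nat.beta s 0) ∧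
        (∀ i < (v 1).unpair.2, T (v 0) (Nat.pair (v 1).unpair.1 (Nat.pair i (Nat.beta s i)))
          (Nat.beta s (i + 1))) ∧ Nat.beta s (v 1).unpair.2 = v 2) (Def.var 0) ?_
    refine (hR.defRel.app (Def.var 1) (Def.var 2).unpair_fst
      ((Def.var 0).beta (Def.const 0))).and (DefP.and ?_ ?_)
    · refine DefP.forall_lt (P := fun _ v i => T (v 1) (Nat.pair (v 2).unpair.1
        (Nat.pair i (Nat.beta (v 0) i))) (Nat.beta (v 0) (i + 1))) (Def.var 2).unpair_snd ?_
      exact hT.defRel.app (Def.var 2) ((Def.var 3).unpair_fst.pair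
        ((Def.var 0).pair ((Def.var 1).beta (Def.var 0))))
        ((Def.var 1).beta ((Def.var 0).add (Def.const 1)))
    · exact DefP.eq ((Def.var 0).beta (Def.var 2).unpair_snd) (Def.var 3)
  mono := by
    rintro w w' x y hw ⟨s, hs, h₁, h₂, h₃⟩
    exact ⟨s, by omega, hR.mono _ _ _ _ hw h₁, fun i hi => hT.mono _ _ _ _ hw (h₂ i hi), h₃⟩
  graph x y := by
    simp only [Nat.unpaired, Part.bind_eq_bind]
    rw [mem_rec_iff (g := fun y i => g (Nat.pair x.unpair.1 (Nat.pair y i)))]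
    constructor
    · rintro ⟨c, h0, h1, rfl⟩
      obtain ⟨s, hs⟩ := exists_beta c x.unpair.2
      obtain ⟨w, hw⟩ := (hR.graph _ _).1 h0
      obtain ⟨w', hw'⟩ := exists_forall_lt_of_mono
        (P := fun i w => T w (Nat.pair x.unpair.1 (Nat.pair i (c i))) (c (i + 1)))
        (fun i w w' h => hT.mono _ _ _ _ h) x.unpair.2 fun i hi => (hT.graph _ _).1 (h1 i hi)
      refine ⟨s + w + w' + 1, s, by omega, ?_, fun i hi => ?_, hs _ le_rfl⟩
      · rw [hs 0 (Nat.zero_le _)]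
        exact hR.mono _ _ _ _ (by omega) hw
      · rw [hs i hi.le, hs (i + 1) hi]
        exact hT.mono _ _ _ _ (by omega) (hw' i hi)
    · rintro ⟨w, s, -, h0, h1, h2⟩
      exact ⟨Nat.beta s, (hR.graph _ _).2 ⟨w, h0⟩, fun i hi => (hT.graph _ _).2 ⟨w, h1 i hi⟩, h2⟩

theorem rfind (hR : IsGraph f R) :
    IsGraph (fun a => Nat.rfind fun n => (fun m => decide (m = 0)) <$> f (Nat.pair a n))
      fun w x y => R w (Nat.pair x y) 0 ∧ ∀ i < y, ∃ z < w, 0 < z ∧ R w (Nat.pair x i) z where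
  defRel := by
    refine (hR.defRel.app (Def.var 0) ((Def.var 1).pair (Def.var 2)) (Def.const 0)).and ?_
    refine DefP.forall_lt (P := fun _ v i => ∃ z < v 0, 0 < z ∧ R (v 0) (Nat.pair (v 1) i) z)
      (Def.var 2) ?_
    refine DefP.exists_lt (P := fun _ v z => 0 < z ∧ R (v 1) (Nat.pair (v 2) (v 0)) z)
      (Def.var 1) ?_
    exact (DefP.pos (Def.var 0)).and
      (hR.defRel.app (Def.var 2) ((Def.var 3).pair (Def.var 1)) (Def.var 0))
  mono := by
    rintro w w' x y hw ⟨h₁, h₂⟩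
    refine ⟨hR.mono _ _ _ _ hw h₁, fun i hi => ?_⟩
    obtain ⟨z, hz, hz0, hz'⟩ := h₂ i hi
    exact ⟨z, by omega, hz0, hR.mono _ _ _ _ hw hz'⟩
  graph x y := by
    refine (Nat.mem_rfind (p := fun n => (fun m => decide (m = 0)) <$> f (Nat.pair x n))).trans ?_
    simp only [Part.map_eq_map, Part.mem_map_iff, decide_eq_true_eq,
      decide_eq_false_iff_not, exists_eq_right]
    constructor
    · rintro ⟨h0, h1⟩
      obtain ⟨w, hw⟩ := (hR.graph _ _).1 h0
      obtain ⟨w', hw'⟩ := exists_forall_lt_of_mono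
        (P := fun i w => ∃ z < w, 0 < z ∧ R w (Nat.pair x i) z) (by
          rintro i w w' hw ⟨z, hz, hz0, hz'⟩
          exact ⟨z, by omega, hz0, hR.mono _ _ _ _ hw hz'⟩) y (by
          intro i hi
          obtain ⟨z, hz, hz0⟩ := h1 hi
          obtain ⟨w, hw⟩ := (hR.graph _ _).1 hz
          exact ⟨w + z + 1, z, by omega, by omega, hR.mono _ _ _ _ (by omega) hw⟩)
      refine ⟨w + w', hR.mono _ _ _ _ (by omega) hw, fun i hi => ?_⟩
      obtain ⟨z, hz, hz0, hz'⟩ := hw' i hi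
      exact ⟨z, by omega, hz0, hR.mono _ _ _ _ (by omega) hz'⟩
    · rintro ⟨w, h0, h1⟩
      refine ⟨(hR.graph _ _).2 ⟨w, h0⟩, fun {i} hi => ?_⟩
      obtain ⟨z, -, hz0, hz⟩ := h1 i hi
      exact ⟨z, (hR.graph _ _).2 ⟨w, hz⟩, by omega⟩

end IsGraph

/-- The graph of a partial recursive function is the projection of a bounded arithmetic relation. -/
theorem exists_isGraph {f : ℕ →. ℕ} (hf : Nat.Partrec f) : ∃ R, IsGraph f R := by
  induction hf with
  | zero =>
    exact ⟨fun _ _ y => y = 0, DefP.eq (Def.var 2) (Def.const 0), fun _ _ _ _ _ h => h,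
      fun x y => by simp [pure, PFun.pure]⟩
  | succ =>
    exact ⟨fun _ x y => y = x + 1, DefP.eq (Def.var 2) ((Def.var 1).add (Def.const 1)),
      fun _ _ _ _ _ h => h, fun x y => by simp⟩
  | left =>
    exact ⟨fun _ x y => y = x.unpair.1, DefP.eq (Def.var 2) (Def.var 1).unpair_fst,
      fun _ _ _ _ _ h => h, fun x y => by simp⟩
  | right =>
    exact ⟨fun _ x y => y = x.unpair.2, DefP.eq (Def.var 2) (Def.var 1).unpair_snd,
      fun _ _ _ _ _ h => h, fun x y => by simp⟩
  | pair _ _ ihf ihg =>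
    obtain ⟨R, hR⟩ := ihf
    obtain ⟨T, hT⟩ := ihg
    exact ⟨_, hR.pair hT⟩
  | comp _ _ ihf ihg =>
    obtain ⟨R, hR⟩ := ihf
    obtain ⟨T, hT⟩ := ihg
    exact ⟨_, hR.comp hT⟩
  | prec _ _ ihf ihg =>
    obtain ⟨R, hR⟩ := ihf
    obtain ⟨T, hT⟩ := ihg
    exact ⟨_, hR.prec hT⟩
  | rfind _ ihf =>
    obtain ⟨R, hR⟩ := ihf
    exact ⟨_, hR.rfind⟩

/-- If `P` is downward closed, then its elements below `n` form an initial segment, so their number is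
one more than the last of them. -/
theorem pred_sum_ind {P : ℕ → Prop} (hP : ∀ k k', k' ≤ k → P k → P k') (n : ℕ)
    (hn : 0 < ∑ k ∈ Finset.range n, ind (P k)) : P ((∑ k ∈ Finset.range n, ind (P k)) - 1) := by
  by_contra h
  set c := ∑ k ∈ Finset.range n, ind (P k) with hc
  have h1 : c ≤ c - 1 := by
    calc c = ∑ k ∈ (Finset.range n).filter fun k => k < c - 1, ind (P k) := by
          rw [hc, ← hc, Finset.sum_filter_of_ne]
          intro k _ hk
          by_contra! h'
          exact h (hP k _ h' (ind_ne_zero.1 hk))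
      _ ≤ ((Finset.range n).filter fun k => k < c - 1).card • 1 :=
          Finset.sum_le_card_nsmul _ _ _ fun k _ => ind_le_one _
      _ ≤ (Finset.range (c - 1)).card := by
          rw [smul_eq_mul, mul_one]
          exact Finset.card_le_card fun k hk => by simp at hk ⊢; omega
      _ = c - 1 := Finset.card_range _
  omega

theorem lt_sum_ind {P : ℕ → Prop} (hP : ∀ k k', k' ≤ k → P k → P k') {n k : ℕ} (hk : P k)
    (hkn : k < n) : k < ∑ k ∈ Finset.range n, ind (P k) := by
  have h1 : ∑ j ∈ Finset.range (k + 1), ind (P j) = k + 1 := by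
    rw [Finset.sum_congr rfl fun j hj => ind_of_true (hP k j (by simp at hj; omega) hk)]
    simp
  have h2 := Finset.sum_le_sum_of_subset (f := fun j => ind (P j))
    (Finset.range_subset_range.2 (show k + 1 ≤ n by omega))
  omega

/-- For every computable function `f` there is an unbounded definable function `K` such that
`f (K n) < n` whenever `K n` is positive. -/
theorem exists_def_slow {f : ℕ → ℕ} (hf : Computable f) :
    ∃ K : ℕ → ℕ, (Def 1 fun _ v => K (v 0)) ∧ (∀ n, 0 < K n → f (K n) < n) ∧
      Filter.Tendsto K Filter.atTop Filter.atTop := by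
  obtain ⟨R, hR⟩ := exists_isGraph (f := fun n => Part.some (f n)) (Partrec.nat_iff.1 hf)
  have hR' : ∀ w x y, R w x y → y = f x := fun w x y h => by
    simpa using (hR.graph x y).2 ⟨w, h⟩
  -- witnesses below `n` show that `f 1, …, f (k + 1)` are less than `n`
  let P : ℕ → ℕ → Prop := fun n k => ∀ j < k + 1, ∃ y < n, ∃ w < n, R w (j + 1) y
  have hP : ∀ n k k', k' ≤ k → P n k → P n k' := fun n k k' h hk j hj => hk j (by omega)
  refine ⟨fun n => ∑ k ∈ Finset.range n, ind (P n k), ?_, fun n hn => ?_, ?_⟩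
  · refine Def.sum (b := fun _ v k => ind (P (v 0) k)) (Def.var 0) ?_
    refine DefP.forall_lt (P := fun _ v j => ∃ y < v 1, ∃ w < v 1, R w (j + 1) y)
      ((Def.var 0).add (Def.const 1)) ?_
    refine DefP.exists_lt (P := fun _ v y => ∃ w < v 2, R w (v 0 + 1) y) (Def.var 2) ?_
    refine DefP.exists_lt (P := fun _ v w => R w (v 1 + 1) (v 0)) (Def.var 3) ?_
    exact hR.defRel.app (Def.var 0) ((Def.var 2).add (Def.const 1)) (Def.var 1)
  · have h1 : P n ((∑ k ∈ Finset.range n, ind (P n k)) - 1) :=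
      pred_sum_ind (hP n) n hn
    obtain ⟨y, hy, w, -, hw⟩ := h1 _ (Nat.lt_succ_self _)
    rw [Nat.sub_add_cancel hn] at hw
    rwa [← hR' _ _ _ hw]
  · refine Filter.tendsto_atTop.2 fun k => ?_
    obtain ⟨N, hN⟩ := exists_forall_lt_of_mono
      (P := fun j n => ∃ y < n, ∃ w < n, R w (j + 1) y) (by
        rintro j n n' hn ⟨y, hy, w, hw, h⟩
        exact ⟨y, by omega, w, by omega, h⟩) (k + 1) (by
        intro j _
        obtain ⟨w, hw⟩ := (hR.graph (j + 1) (f (j + 1))).1 (by simp)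
        exact ⟨w + f (j + 1) + 1, _, by omega, w, by omega, hw⟩)
    refine Filter.eventually_atTop.2 ⟨N + k + 1, fun n hn => ?_⟩
    have h1 : P n k := fun j hj => by
      obtain ⟨y, hy, w, hw, h⟩ := hN j hj
      exact ⟨y, by omega, w, by omega, h⟩
    exact (lt_sum_ind (hP n) h1 (by omega)).le

/-! ### The machine of a program -/

/-- The machine that executes the program `P`, with input stack `inp` and output stack `out`. -/
noncomputable def Prog.toAlgorithm {M : Algorithm} (P : Prog M) : Algorithm where
  tm :=
    { K := Stk M
      kDecidableEq := inferInstance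
      kFin := @instFintypeSum _ _ inferInstance M.tm.kFin
      k₀ := Sum.inl .inp
      k₁ := Sum.inl .out
      Γ := Alph M
      Λ := Option P.Lab
      main := some P.entry
      ΛFin := Fintype.ofFinite _
      σ := Reg M
      initialState := (false, M.tm.initialState)
      σFin := @instFintypeProd _ _ inferInstance M.tm.σFin
      Γk₀Fin := inferInstanceAs (Fintype Bool)
      m := fun l => l.elim .halt (P.code some none) }
  inputAlphabet := Equiv.refl Bool
  outputAlphabet := Equiv.refl Bool
  finite_alphabet k := by
    rcases k with k | k
    · exact inferInstanceAs (Finite Bool)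
    · exact M.finite_alphabet k

theorem inStk_nil {M : Algorithm} (k : M.tm.K) : inStk M [] k = [] := by
  simp only [inStk, Algorithm.start, initList, List.map_nil]
  split_ifs with h
  · subst h; rfl
  · rfl

/-- The additional step is the final one, which halts. -/
theorem Prog.toAlgorithm_spec {M : Algorithm} {P : Prog M} {x y : List Bool} {t : ℕ}
    (h : Runs P t (store (own x [] [] [] [] []) (inStk M []))
      (store (own [] [] [] [] [] y) (inStk M []))) :
    P.toAlgorithm.Outputs x y ∧ P.toAlgorithm.runTime x ≤ (t + 1 : ℕ) := by
  obtain ⟨s, hs, h⟩ := h (Option P.Lab) some none (P.toAlgorithm.tm.m) fun l => rfl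
  have h1 : P.toAlgorithm.start x = ⟨some (some P.entry), (false, M.tm.initialState),
      store (own x [] [] [] [] []) (inStk M [])⟩ := by
    simp only [Algorithm.start, initList]
    refine congrArg (TM2.Cfg.mk _ _) (funext fun k => ?_)
    rcases k with k | k
    · cases k <;> simp [Prog.toAlgorithm]
      exact List.map_id _
    · simp [Prog.toAlgorithm, inStk_nil]
  have h2 : haltList P.toAlgorithm.tm (y.map P.toAlgorithm.outputAlphabet.symm) =
      ⟨none, (false, M.tm.initialState), store (own [] [] [] [] [] y) (inStk M [])⟩ := by
    simp only [haltList]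
    refine congrArg (TM2.Cfg.mk _ _) (funext fun k => ?_)
    rcases k with k | k
    · cases k <;> simp [Prog.toAlgorithm]
      exact List.map_id _
    · simp [Prog.toAlgorithm, inStk_nil]
  have h3 : (flip bind P.toAlgorithm.tm.step)^[s + 1] (some (P.toAlgorithm.start x)) =
      some (haltList P.toAlgorithm.tm (y.map P.toAlgorithm.outputAlphabet.symm)) := by
    rw [Function.iterate_succ_apply', h1, h2]
    exact (congrArg (flip bind P.toAlgorithm.tm.step) h).trans rfl
  refine ⟨⟨⟨s + 1, h3⟩⟩, ?_⟩
  rw [runTime_eq h3 rfl]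
  exact_mod_cast Nat.add_le_add_right hs 1

/-! ### The approximation program -/

/-- A definable function of the variables is computed by a program in polynomial time. -/
theorem Def.exists_prog {m : ℕ} {g : List Bool → (Fin m → ℕ) → ℕ} (h : Def m g) (M : Algorithm) :
    ∃ (p : Prog M) (b : ℕ → ℕ), PolyBdd b ∧ ∀ A v B w, (∀ i, v i ≤ B) →
      Runs p (b B) (vars M A (List.ofFn v) w) (vars M A (g A v :: List.ofFn v) w) := by
  obtain ⟨e, he⟩ := h
  obtain ⟨b, hb, hr⟩ := e.exists_runs (M := M) fun i => (i : ℕ)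
  refine ⟨e.compile M fun i => (i : ℕ), b, hb, fun A v B w hv => ?_⟩
  rw [← he]
  refine hr A B v _ w (fun x hx => ?_) (fun i => by simp)
  obtain ⟨i, rfl⟩ := (List.mem_ofFn' _ _).1 hx
  exact hv i

namespace Prog

variable {M : Algorithm}

/-- Push a bit on the input stack of `M`. -/
def pushM (b : Bool) : Prog M := .push (Sum.inr M.tm.k₀) (M.inputAlphabet.symm b)

/-- Move the top variable to the input stack of `M`, in unary. -/
def loadVar : Prog M := .seq (loopO .env top (.seq (popO .env) (pushM true))) (popO .env)

/-- Copy the matrix to the input stack of `M`. -/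
def loadMat : Prog M := .seq (loopO .inp Option.isSome (shift .inp .mat))
  (loopO .mat Option.isSome (iteO .mat top
    (.seq (popO .mat) (.seq (pushO .inp true) (pushM true)))
    (.seq (popO .mat) (.seq (pushO .inp false) (pushM false)))))

/-- Pop the answer of `M`, and add it to the second variable. -/
def addAnswer : Prog M := .seq
  (.ite (Sum.inr M.tm.k₁) (fun a => a.elim false M.outputAlphabet)
    (.seq (.pop (Sum.inr M.tm.k₁)) (.seq (pushO .env false) (pushO .env true)))
    (.seq (.pop (Sum.inr M.tm.k₁)) (pushO .env false))) addUnder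

/-- With the variables `k, s, L, n`: run `M` on the instance with parameter `k`, and add its answer
to `s`. -/
def query : Prog M := .seq (.seq (pick 0) (pick 4)) <| .seq loadMat <| .seq (pushM false) <|
  .seq loadVar <| .seq (pushM false) <| .seq loadVar <| .seq call addAnswer

/-- Query for all parameters from the value of the top variable down to `1`, and delete it. -/
def queries : Prog M := .seq (loopO .env top (.seq query (popO .env))) (popO .env)

/-- With the number of bits to be written at depth `d`: write the bits computed by `p`, from the last
one to the first one. -/
def write (d : ℕ) (p : Prog M) : Prog M := .seq (pick d) <| .seq
  (loopO .env top (.seq (popO .env) (.seq p (iteO .env top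
    (.seq (popO .env) (.seq (popO .env) (pushO .out true)))
    (.seq (popO .env) (pushO .out false)))))) (popO .env)

/-- Empty an own stack. -/
def clear (k : Own) : Prog M := loopO k Option.isSome (popO k)

end Prog

namespace Runs

variable {M : Algorithm} {s : ∀ k, List (M.tm.Γ k)} {a b e t u w x : List Bool} {l : List ℕ}
  {B : ℕ} {o : Own → List Bool}

theorem pushM (c : Bool) :
    Runs (.pushM c) 1 (store o (inStk M x)) (store o (inStk M (c :: x))) := by
  have := Runs.push (M := M) (Sum.inr M.tm.k₀) (M.inputAlphabet.symm c) (store o (inStk M x))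
  rwa [update_store_inr, store_inr, update_inStk] at this

theorem loadVar (n : ℕ) :
    Runs .loadVar (3 * n + 2) (store (own a b (enc (n :: l)) t u w) (inStk M x))
      (store (own a b (enc l) t u w) (inStk M (List.replicate n true ++ x))) := by
  have h : ∀ n x, Runs (M := M) (Prog.loopO .env top (.seq (Prog.popO .env) (Prog.pushM true)))
      (3 * n + 1) (store (own a b (enc (n :: l)) t u w) (inStk M x))
      (store (own a b (enc (0 :: l)) t u w) (inStk M (List.replicate n true ++ x))) := by
    intro n
    induction n with
    | zero => exact fun x => loopO_stop rfl
    | succ n ih =>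
      intro x
      have h1 : Runs (M := M) (.seq (Prog.popO .env) (Prog.pushM true)) 2
          (store (own a b (enc ((n + 1) :: l)) t u w) (inStk M x))
          (store (own a b (enc (n :: l)) t u w) (inStk M (true :: x))) :=
        ((popO _ _).seq (pushM true)).cast (by simp [enc_cons, List.replicate_succ]) le_rfl
      refine (loopO_step rfl h1 (ih (true :: x))).cast ?_ (by omega)
      rw [List.replicate_succ']; simp
  exact ((h n x).seq (popO _ _)).cast (by simp [enc_cons]) (by omega)

theorem loadMat :
    Runs .loadMat (11 * a.length + 2) (store (own a [] e t u w) (inStk M x))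
      (store (own a [] e t u w) (inStk M (a ++ x))) := by
  have h1 : ∀ a b, Runs (M := M) (Prog.loopO .inp Option.isSome (Prog.shift .inp .mat))
      (5 * a.length + 1) (store (own a b e t u w) (inStk M x))
      (store (own [] (a.reverse ++ b) e t u w) (inStk M x)) := by
    intro a
    induction a with
    | nil => exact fun b => loopO_stop rfl
    | cons y a ih =>
      intro b
      have h := shift (M := M) (s := inStk M x) (k := .inp) (j := .mat) (by decide)
        (own (y :: a) b e t u w) y a rfl
      simp only [update_own_inp, update_own_mat, own_mat] at h
      refine (loopO_step rfl h (ih (y :: b))).cast ?_ ?_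
      · simp
      · simp; omega
  have h2 : ∀ b a x, Runs (M := M) (Prog.loopO .mat Option.isSome (Prog.iteO .mat top
      (.seq (Prog.popO .mat) (.seq (Prog.pushO .inp true) (Prog.pushM true)))
      (.seq (Prog.popO .mat) (.seq (Prog.pushO .inp false) (Prog.pushM false)))))
      (5 * b.length + 1) (store (own a b e t u w) (inStk M x))
      (store (own (b.reverse ++ a) [] e t u w) (inStk M (b.reverse ++ x))) := by
    intro b
    induction b with
    | nil => exact fun a x => loopO_stop rfl
    | cons y b ih =>
      intro a x
      have h : ∀ c, Runs (M := M) (.seq (Prog.popO .mat) (.seq (Prog.pushO .inp c) (Prog.pushM c)))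
          3 (store (own a (y :: b) e t u w) (inStk M x))
          (store (own (c :: a) b e t u w) (inStk M (c :: x))) := fun c =>
        ((popO _ _).seq ((pushO _ _ _).seq (pushM _))).cast (by simp) le_rfl
      refine (loopO_step rfl (S := store (own (y :: a) b e t u w) (inStk M (y :: x))) (t₁ := 4)
        ?_ (ih (y :: a) (y :: x))).cast ?_ ?_
      · cases y with
        | true => exact iteO_true rfl (h true)
        | false => exact iteO_false rfl (h false)
      · simp
      · simp; omega
  refine ((h1 a []).seq (h2 _ [] x)).cast ?_ ?_
  · simp
  · simp; omega

theorem addAnswer (c : Bool) (k y : ℕ) :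
    Runs .addAnswer (6 * k + 17) (store (own a [] (enc (k :: y :: l)) [] [] w) (outStk M [c]))
      (vars M a (k :: (c.toNat + y) :: l) w) := by
  have h1 : Runs (M := M) (.pop (Sum.inr M.tm.k₁)) 1
      (store (own a [] (enc (k :: y :: l)) [] [] w) (outStk M [c]))
      (vars M a (k :: y :: l) w) := by
    have := Runs.pop (M := M) (Sum.inr M.tm.k₁)
      (store (own a [] (enc (k :: y :: l)) [] [] w) (outStk M [c]))
    rw [update_store_inr, store_inr, update_outStk, ← inStk_nil_eq] at this
    exact this
  have h2 : Runs (M := M) (.ite (Sum.inr M.tm.k₁) (fun a => a.elim false M.outputAlphabet)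
      (.seq (.pop (Sum.inr M.tm.k₁)) (.seq (Prog.pushO .env false) (Prog.pushO .env true)))
      (.seq (.pop (Sum.inr M.tm.k₁)) (Prog.pushO .env false))) 4
      (store (own a [] (enc (k :: y :: l)) [] [] w) (outStk M [c]))
      (vars M a (c.toNat :: k :: y :: l) w) := by
    cases c with
    | true =>
      refine (ite_true ?_ (h1.seq (pushZero.seq (incr 0)))).mono (by omega)
      simp [outStk_apply]
    | false =>
      refine (ite_false ?_ (h1.seq pushZero)).mono (by omega)
      simp [outStk_apply]
  refine (h2.seq (addUnder _ _ _)).mono ?_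
  have := c.toNat_le
  omega

/-- `T` is the running time of `M`; the rest is the cost of writing its input and reading its
answer. -/
theorem query {k y L n T : ℕ} {c : Bool}
    (h : M.Outputs (List.replicate k true ++ false :: (List.replicate n true ++ false :: a)) [c])
    (hT : M.runTime (List.replicate k true ++ false :: (List.replicate n true ++ false :: a)) ≤ T)
    (hB : ∀ z ∈ [k, y, L, n], z ≤ B) (ha : a.length ≤ B) :
    Runs .query (T + (100 * B + 100)) (vars M a [k, y, L, n] w)
      (vars M a [k, c.toNat + y, L, n] w) := by
  have h1 : Runs (M := M) (.seq (Prog.pick 0) (Prog.pick 4)) (56 * B + 64) _ _ :=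
    ((pick (a := a) (w := w) (l := [k, y, L, n]) 0 rfl hB).seq
      (pick (l := [k, k, y, L, n]) 4 (x := n) rfl (fun z hz => hB z (by simp at hz ⊢; tauto)))).mono
      (by omega)
  have h2 := (loadVar (M := M) (a := a) (b := []) (t := []) (u := []) (w := w)
    (l := [k, y, L, n]) (x := false :: (List.replicate n true ++ (false :: (a ++ [])))) k).seq
    ((call (by simpa using h) (by simpa using hT) _).seq (addAnswer c k y))
  refine (h1.seq (loadMat.seq ((pushM false).seq ((loadVar n).seq ((pushM false).seq
    h2))))).mono ?_
  have := hB k (by simp)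
  have := hB n (by simp)
  omega

theorem queries {y L n K : ℕ} {c : ℕ → Bool} {τ : ℕ → ℕ}
    (h : ∀ k ∈ Finset.Icc 1 K, M.Outputs
      (List.replicate k true ++ false :: (List.replicate n true ++ false :: a)) [c k])
    (hT : ∀ k ∈ Finset.Icc 1 K, M.runTime
      (List.replicate k true ++ false :: (List.replicate n true ++ false :: a)) ≤ τ k)
    (hK : K ≤ B) (hy : y + K ≤ B) (hL : L ≤ B) (hn : n ≤ B) (ha : a.length ≤ B) :
    Runs .queries (∑ k ∈ Finset.Icc 1 K, τ k + K * (100 * B + 102) + 2)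
      (vars M a [K, y, L, n] w)
      (vars M a [∑ k ∈ Finset.Icc 1 K, (c k).toNat + y, L, n] w) := by
  have loop : Runs (M := M) (Prog.loopO .env top (.seq Prog.query (Prog.popO .env)))
      (∑ k ∈ Finset.Icc 1 K, τ k + K * (100 * B + 102) + 1) (vars M a [K, y, L, n] w)
      (vars M a [0, ∑ k ∈ Finset.Icc 1 K, (c k).toNat + y, L, n] w) := by
    induction K generalizing y with
    | zero => exact (loopO_stop rfl).cast (by simp [vars]) (by simp)
    | succ K ih =>
      have h1 : (c (K + 1)).toNat ≤ 1 := Bool.toNat_le _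
      have h2 := ih (y := (c (K + 1)).toNat + y)
        (fun k hk => h k (by simp at hk ⊢; omega)) (fun k hk => hT k (by simp at hk ⊢; omega))
        (by omega) (by omega)
      have h3 := query (w := w) (h (K + 1) (by simp)) (hT (K + 1) (by simp)) (y := y) (L := L)
        (B := B) (by simp; omega) ha
      refine (loopO_step ?_ (h3.seq (decr K)) h2).cast ?_ ?_
      · rw [own_env, top_head_enc_cons]; rfl
      · rw [Finset.sum_Icc_succ_top (by omega), add_assoc]
      · rw [Finset.sum_Icc_succ_top (by omega)]; ring_nf; omega
  exact (loop.seq dropZero).mono (by omega)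

theorem write {d n T : ℕ} {p : Prog M} {P : ℕ → Prop} [DecidablePred P]
    (hn : l[d]? = some n) (hB : ∀ z ∈ l, z ≤ B)
    (hp : ∀ j w, j < n → Runs p T (vars M a (j :: l) w) (vars M a (ind (P j) :: j :: l) w)) :
    Runs (.write d p) ((d + 2) * (7 * B + 8) + n * (T + 6) + 2) (vars M a l w)
      (vars M a l ((List.range n).map (fun j => decide (P j)) ++ w)) := by
  have loop : ∀ k w, k ≤ n → Runs (M := M) (Prog.loopO .env top (.seq (Prog.popO .env)
      (.seq p (Prog.iteO .env top (.seq (Prog.popO .env) (.seq (Prog.popO .env)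
        (Prog.pushO .out true))) (.seq (Prog.popO .env) (Prog.pushO .out false))))))
      (k * (T + 6) + 1) (vars M a (k :: l) w)
      (vars M a (0 :: l) ((List.range k).map (fun j => decide (P j)) ++ w)) := by
    intro k
    induction k with
    | zero => exact fun w _ => (loopO_stop rfl).cast (by simp [vars]) (by simp)
    | succ k ih =>
      intro w hk
      have h1 : Runs (M := M) (Prog.iteO .env top (.seq (Prog.popO .env) (.seq (Prog.popO .env)
          (Prog.pushO .out true))) (.seq (Prog.popO .env) (Prog.pushO .out false))) 4
          (vars M a (ind (P k) :: k :: l) w) (vars M a (k :: l) (decide (P k) :: w)) := by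
        by_cases hP : P k
        · rw [ind_of_true hP]
          exact (iteO_true rfl ((decr 0).seq (dropZero.seq (pushO _ _ _)))).cast (by simp [hP, vars])
            (by omega)
        · rw [ind_of_false hP]
          exact (iteO_false rfl (dropZero.seq (pushO _ _ _))).cast (by simp [hP, vars]) (by omega)
      refine (loopO_step ?_ ((decr k).seq ((hp k w hk).seq h1))
        (ih (decide (P k) :: w) (by omega))).cast ?_ ?_
      · rw [own_env, top_head_enc_cons]; rfl
      · rw [List.range_succ]; simp
      · ring_nf; omega
  exact ((pick d hn hB).seq ((loop n w le_rfl).seq dropZero)).mono (by omega)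

theorem clear (k : Own) (o : Own → List Bool) :
    Runs (.clear k) (2 * (o k).length + 1) (store o s) (store (Function.update o k []) s) := by
  generalize hr : o k = r
  induction r generalizing o with
  | nil => exact (loopO_stop (by rw [hr]; rfl)).cast (by simp [← hr]) le_rfl
  | cons x r ih =>
    refine (loopO_step (by rw [hr]; rfl) (popO k o) (ih (Function.update o k (o k).tail)
      (by simp [hr]))).cast (by simp) ?_
    simp; omega

end Runs

namespace Prog

variable {M : Algorithm}

/-- With the variables `s, L, n`: find the least `k` for which the test `pc` of `k` and `n ^ k`
fails, then write the bits computed by `po`; `ps` computes `n ^ (k + 1) - n ^ k`. -/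
def search (ps pc po : Prog M) : Prog M :=
  .seq (.seq (pushO .env false) (.seq (pushO .env true) (.seq (pushO .env false)
    (.seq (pushO .env false) (pushO .env true))))) <|
  .seq (loopO .env top (.seq (.seq (popO .env) (popO .env)) (.seq ps (.seq addUnder
    (.seq (pushO .env true) pc))))) <|
  .seq (popO .env) (write 4 po)

/-- Split the input into the number of vertices, which becomes a variable, and the matrix. -/
def parse : Prog M := .seq (pushO .env false) (.seq (mv .inp .env) (popO .inp))

/-- The whole program: compute the number `L` and the number of queries, ask all queries, decide
between the two ways to write the output, and empty the stacks. -/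
def main (pL pK pb po q : Prog M) : Prog M :=
  .seq parse <| .seq pL <| .seq (pushO .env false) <| .seq pK <| .seq queries <| .seq pb <|
  .seq (iteO .env top (write 3 po) (.seq (popO .env) q)) <| .seq (clear .env) (clear .inp)

end Prog

open Classical in
/-- The program `search` finds the least `k = γ` that violates `Pc`, in time polynomial in any bound
`B` for `n ^ γ` and the variables. -/
theorem exists_search (M : Algorithm) {Pc : List Bool → ℕ → ℕ → ℕ → Prop}
    {Po : List Bool → ℕ → ℕ → ℕ → ℕ → Prop}
    (hc : DefP 5 fun A v => Pc A (v 4) (v 0) (v 1))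
    (ho : DefP 6 fun A v => Po A (v 5) (v 1) (v 2) (v 0)) :
    ∃ (p : Prog M) (b : ℕ → ℕ), PolyBdd b ∧ ∀ A B n s L γ, 1 ≤ n → n ≤ B → s ≤ B → L ≤ B →
      1 ≤ γ → γ ≤ B → n ^ γ ≤ B → (∀ k < γ, Pc A n k (n ^ k)) → ¬Pc A n γ (n ^ γ) →
      Runs p (b B) (vars M A [s, L, n] []) (vars M A [γ, n ^ γ, s, L, n]
        ((List.range n).map fun j => decide (Po A n γ (n ^ γ) j))) := by
  obtain ⟨pc, bc, hbc, hpc⟩ := Def.exists_prog hc M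
  obtain ⟨po, bo, hbo, hpo⟩ := Def.exists_prog ho M
  obtain ⟨ps, bs, hbs, hps⟩ := Def.exists_prog
    (((Def.var (m := 5) 1).mul (Def.var 4)).sub (Def.var 1)) M
  refine ⟨search ps pc po, _, ((PolyBdd.const 7).add (PolyBdd.id.mul (((PolyBdd.const 11).add
    ((PolyBdd.const 12).mul PolyBdd.id)).add (hbs.add hbc)))).add
    (((PolyBdd.const 50).add ((PolyBdd.const 42).mul PolyBdd.id)).add
      (PolyBdd.id.mul (hbo.add (PolyBdd.const 6)))),
    fun A B n s L γ hn1 hn hs hL hγ1 hγ hN hk hγ' => ?_⟩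
  have hpow : ∀ k ≤ γ, n ^ k ≤ B := fun k hk => (Nat.pow_le_pow_right hn1 hk).trans hN
  -- `d` rounds before the end, the variables are `1, γ - d, n ^ (γ - d)`
  have loop : ∀ d k, k + d = γ → Runs (M := M) (loopO .env top
      (.seq (.seq (popO .env) (popO .env)) (.seq ps (.seq addUnder (.seq (pushO .env true) pc)))))
      (d * (11 + 12 * B + (bs B + bc B)) + 1)
      (vars M A [ind (Pc A n k (n ^ k)), k, n ^ k, s, L, n] [])
      (vars M A [0, γ, n ^ γ, s, L, n] []) := by
    intro d
    induction d with
    | zero =>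
      intro k hkd
      obtain rfl : k = γ := by omega
      rw [ind_of_false hγ']
      exact (Runs.loopO_stop rfl).cast rfl (by simp)
    | succ d ih =>
      intro k hkd
      rw [ind_of_true (hk k (by omega))]
      have h1 := hps A ![k, n ^ k, s, L, n] B [] (by
        have := hpow k (by omega)
        intro i; fin_cases i <;> simp <;> omega)
      have h2 := hpc A ![k + 1, n ^ (k + 1), s, L, n] B [] (by
        have := hpow (k + 1) (by omega)
        intro i; fin_cases i <;> simp <;> omega)
      have h3 : n ^ k * n - n ^ k + n ^ k = n ^ (k + 1) := by
        rw [pow_succ, Nat.sub_add_cancel (Nat.le_mul_of_pos_right _ hn1)]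
      have h4 : Runs (M := M) addUnder (12 * B + 7)
          (vars M A ((n ^ k * n - n ^ k) :: k :: n ^ k :: [s, L, n]) [])
          (vars M A (k :: n ^ (k + 1) :: [s, L, n]) []) := by
        refine (Runs.addUnder _ _ _).cast (by rw [h3]) ?_
        have := hpow (k + 1) (by omega)
        omega
      refine (Runs.loopO_step rfl (((Runs.decr 0).seq Runs.dropZero).seq (h1.seq (h4.seq
        ((Runs.incr k).seq h2)))) (ih (k + 1) (by omega))).cast rfl ?_
      ring_nf; omega
  have h0 : Runs (M := M) (.seq (pushO .env false) (.seq (pushO .env true) (.seq (pushO .env false)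
      (.seq (pushO .env false) (pushO .env true))))) 5 (vars M A [s, L, n] [])
      (vars M A [1, 0, n ^ 0, s, L, n] []) :=
    (Runs.pushZero.seq ((Runs.incr 0).seq (Runs.pushZero.seq (Runs.pushZero.seq
      (Runs.incr 0))))).cast (by simp) le_rfl
  have h1 : Runs (M := M) (loopO .env top
      (.seq (.seq (popO .env) (popO .env)) (.seq ps (.seq addUnder (.seq (pushO .env true) pc)))))
      (γ * (11 + 12 * B + (bs B + bc B)) + 1)
      (vars M A [1, 0, n ^ 0, s, L, n] [])
      (vars M A [0, γ, n ^ γ, s, L, n] []) := by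
    have := loop γ 0 (by omega)
    rwa [ind_of_true (hk 0 hγ1)] at this
  have h2 := Runs.write (M := M) (a := A) (l := [γ, n ^ γ, s, L, n]) (d := 4) (n := n) (w := [])
    (B := B) (T := bo B) (p := po) (P := fun j => Po A n γ (n ^ γ) j) rfl
    (by simp; omega) (fun j w hj => hpo A ![j, γ, n ^ γ, s, L, n] B w (by
      intro i; fin_cases i <;> simp <;> omega))
  refine (h0.seq (h1.seq (Runs.dropZero.seq h2))).cast (by simp) ?_
  have h5 := Nat.mul_le_mul_right (11 + 12 * B + (bs B + bc B)) hγ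
  have h6 := Nat.mul_le_mul_right (bo B + 6) hn
  omega

theorem length_enc_le {l : List ℕ} {B : ℕ} (h : ∀ x ∈ l, x ≤ B) :
    (enc l).length ≤ l.length * (B + 1) := by
  induction l with
  | nil => simp
  | cons x l ih =>
    have := ih fun y hy => h y (by simp [hy])
    have := h x (by simp)
    simp only [enc_cons, List.length_append, List.length_replicate, List.length_cons, add_mul,
      one_mul]
    omega

theorem Runs.parse {M : Algorithm} (n : ℕ) (A : List Bool) :
    Runs .parse (3 * n + 3) (store (own (List.replicate n true ++ false :: A) [] [] [] [] [])
      (inStk M [])) (vars M A [n] []) := by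
  refine ((pushO _ _ _).seq ((Runs.mv (k := .inp) (j := .env) (by decide) n (r := false :: A) rfl
    (by simp)).seq (popO _ _))).cast ?_ (by omega)
  simp [vars, enc_cons]

theorem Runs.cleanup {M : Algorithm} {A w : List Bool} {l : List ℕ} {B : ℕ} (h : ∀ x ∈ l, x ≤ B)
    (hA : A.length ≤ B) : Runs (.seq (.clear .env) (.clear .inp))
      (2 * (l.length + 1) * (B + 1) + 2) (vars M A l w)
      (store (own [] [] [] [] [] w) (inStk M [])) := by
  refine ((clear .env _).seq (clear .inp _)).cast (by simp) ?_
  have := length_enc_le h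
  simp only [own_env, update_own_env, own_inp]
  nlinarith

open Classical in
/-- The machine that asks `M` the queries with parameters `1, …, K n`, counts the positive answers,
and then writes `Po₁` if `Pb` holds, and else searches for the least `k` that violates `Pc` and
writes `Po₂`. The time `b₂` for the latter does not depend on the function `gL`. -/
theorem exists_algorithm (M : Algorithm) {Pc : List Bool → ℕ → ℕ → ℕ → Prop}
    {Po₂ : List Bool → ℕ → ℕ → ℕ → ℕ → Prop}
    (hc : DefP 5 fun A v => Pc A (v 4) (v 0) (v 1))
    (ho₂ : DefP 6 fun A v => Po₂ A (v 5) (v 1) (v 2) (v 0)) :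
    ∃ b₂, PolyBdd b₂ ∧ ∀ {gL gK : ℕ → ℕ} {Pb : List Bool → ℕ → ℕ → ℕ → Prop}
      {Po₁ : List Bool → ℕ → ℕ → ℕ → Prop},
      (Def 1 fun _ v => gL (v 0)) → (Def 1 fun _ v => gK (v 0)) →
      (DefP 3 fun A v => Pb A (v 2) (v 1) (v 0)) → (DefP 5 fun A v => Po₁ A (v 4) (v 3) (v 0)) →
      ∃ (M' : Algorithm) (b₁ : ℕ → ℕ), PolyBdd b₁ ∧ ∀ (n : ℕ) (A : List Bool) (c : ℕ → Bool)
        (τ : ℕ → ℕ), 1 ≤ n → A.length ≤ n * n →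
        (∀ k ∈ Finset.Icc 1 (gK n), M.Outputs
          (List.replicate k true ++ false :: (List.replicate n true ++ false :: A)) [c k] ∧
          M.runTime (List.replicate k true ++ false :: (List.replicate n true ++ false :: A)) ≤
            τ k) →
        (Pb A n (gL n) (∑ k ∈ Finset.Icc 1 (gK n), (c k).toNat) →
          M'.Outputs (List.replicate n true ++ false :: A)
            ((List.range n).map fun j => decide (Po₁ A n (gL n) j)) ∧
          M'.runTime (List.replicate n true ++ false :: A) ≤
            (b₁ n + ∑ k ∈ Finset.Icc 1 (gK n), τ k : ℕ)) ∧
        (¬Pb A n (gL n) (∑ k ∈ Finset.Icc 1 (gK n), (c k).toNat) →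
          ∀ γ B, (∀ k < γ, Pc A n k (n ^ k)) → ¬Pc A n γ (n ^ γ) → n ≤ B → gK n ≤ B →
          gL n ≤ B → 1 ≤ γ → γ ≤ B → n ^ γ ≤ B →
          M'.Outputs (List.replicate n true ++ false :: A)
            ((List.range n).map fun j => decide (Po₂ A n γ (n ^ γ) j)) ∧
          M'.runTime (List.replicate n true ++ false :: A) ≤
            (b₁ n + ∑ k ∈ Finset.Icc 1 (gK n), τ k + b₂ B : ℕ)) := by
  obtain ⟨q, bq, hbq, hq⟩ := exists_search M hc ho₂
  refine ⟨_, (hbq.add ((PolyBdd.const 12).mul PolyBdd.id)).add (PolyBdd.const 20),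
    fun {gL gK Pb Po₁} hL hK hb ho₁ => ?_⟩
  obtain ⟨eL, heL⟩ := hL
  obtain ⟨uL, huL, huL'⟩ := eL.exists_eval_le
  obtain ⟨eK, heK⟩ := hK
  obtain ⟨uK, huK, huK'⟩ := eK.exists_eval_le
  obtain ⟨pL, bL, hbL, hpL⟩ := Def.exists_prog ⟨eL, heL⟩ M
  obtain ⟨pK, bK, hbK, hpK⟩ := Def.exists_prog (Def.rename ⟨eK, heK⟩ (fun _ => (2 : Fin 3))) M
  obtain ⟨pb, bb, hbb, hpb⟩ := Def.exists_prog hb M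
  obtain ⟨po, bo, hbo, hpo⟩ := Def.exists_prog ho₁ M
  -- a bound for all variables and the length of the matrix
  have hD : PolyBdd fun n => n + n * n + uL n + uK n + 1 :=
    (((PolyBdd.id.add (PolyBdd.id.mul PolyBdd.id)).add huL).add huK).add (PolyBdd.const 1)
  -- a generous bound for the time that is not spent in `M` or `q`, in terms of this bound
  have hB : PolyBdd fun B => bL B + bK B + bb B + B * bo B + 100 * B * B + 1000 * B + 1000 :=
    ((((((hbL.add hbK).add hbb).add (PolyBdd.id.mul hbo)).add
      (((PolyBdd.const 100).mul PolyBdd.id).mul PolyBdd.id)).add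
      ((PolyBdd.const 1000).mul PolyBdd.id)).add (PolyBdd.const 1000))
  refine ⟨(Prog.main pL pK pb po q).toAlgorithm, _, hB.comp hD, fun n A c τ hn hA h => ?_⟩
  have hL : gL n ≤ uL n := by
    have := huL' [] n (fun _ => n) fun _ => le_rfl
    rwa [heL] at this
  have hK : gK n ≤ uK n := by
    have := huK' [] n (fun _ => n) fun _ => le_rfl
    rwa [heK] at this
  generalize hDn : n + n * n + uL n + uK n + 1 = D
  generalize hs : ∑ k ∈ Finset.Icc 1 (gK n), (c k).toNat = s
  have hsK : s ≤ gK n := by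
    rw [← hs]
    refine (Finset.sum_le_card_nsmul _ _ 1 fun k _ => Bool.toNat_le _).trans ?_
    simp
  have h1 := hpL A ![n] D [] (by intro i; fin_cases i; simp; omega)
  have h2 := hpK A ![0, gL n, n] D [] (by intro i; fin_cases i <;> simp <;> omega)
  have h3 := Runs.queries (M := M) (w := []) (y := 0) (L := gL n) (B := D) (fun k hk => (h k hk).1)
    (fun k hk => (h k hk).2) (by omega) (by omega) (by omega) (by omega) (by omega)
  rw [hs] at h3
  have h4 := hpb A ![s, gL n, n] D [] (by intro i; fin_cases i <;> simp <;> omega)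
  have hKD : gK n * (100 * D + 102) ≤ D * (100 * D + 102) := Nat.mul_le_mul_right _ (by omega)
  constructor
  · intro hPb
    have h4' : Runs (M := M) pb (bb D) (vars M A [s, gL n, n] []) (vars M A [1, s, gL n, n] []) := by
      have : ind (Pb A n (gL n) s) = 1 := ind_of_true hPb
      simpa [this] using h4
    have h5 := Runs.write (M := M) (a := A) (l := [1, s, gL n, n]) (d := 3) (n := n) (w := [])
      (B := D) (T := bo D) (p := po) (P := fun j => Po₁ A n (gL n) j) rfl
      (by simp; omega) (fun j w hj => hpo A ![j, 1, s, gL n, n] D w (by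
        intro i; fin_cases i <;> simp <;> omega))
    have h6 := (Runs.parse (M := M) n A).seq (h1.seq (Runs.pushZero.seq (h2.seq (h3.seq
      (h4'.seq ((Runs.iteO_true (k := .env) (c := top) (q := .seq (popO .env) q) rfl h5).seq
        (Runs.cleanup (B := D) (by simp; omega) (by omega))))))))
    rw [List.append_nil] at h6
    have h7 := Prog.toAlgorithm_spec h6
    refine ⟨h7.1, h7.2.trans ?_⟩
    rw [Nat.cast_le]
    have : n * (bo D + 6) ≤ D * (bo D + 6) := Nat.mul_le_mul_right _ (by omega)
    simp only [List.length_cons, List.length_nil]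
    nlinarith
  · intro hPb γ B hγ hγ' hnB hKB hLB hγ1 hγB hNB
    have h4' : Runs (M := M) pb (bb D) (vars M A [s, gL n, n] []) (vars M A [0, s, gL n, n] []) := by
      have : ind (Pb A n (gL n) s) = 0 := ind_of_false hPb
      simpa [this] using h4
    have h5 := hq A B n s (gL n) γ hn hnB (by omega) hLB hγ1 hγB hNB hγ hγ'
    have h6 := (Runs.parse (M := M) n A).seq (h1.seq (Runs.pushZero.seq (h2.seq (h3.seq
      (h4'.seq ((Runs.iteO_false (k := .env) (c := top) (p := write 3 po) rfl (Runs.dropZero.seq h5)).seq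
        (Runs.cleanup (B := B + D) (by simp; omega) (by omega))))))))
    have h7 := Prog.toAlgorithm_spec h6
    refine ⟨h7.1, h7.2.trans ?_⟩
    rw [Nat.cast_le]
    simp only [List.length_cons, List.length_nil]
    nlinarith

/-! ### Bounded arithmetic descriptions of dominating sets -/

/-- The entry of the matrix with rows of length `n` at position `(u, v)`. -/
def Entry (A : List Bool) (n u v : ℕ) : Prop := (A.getD (u * n + v) false).toNat = 1

/-- The vertices `t / n ^ i % n`, `i < k`, dominate all vertices `v < n`. -/
def Tup (A : List Bool) (n k t : ℕ) : Prop :=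
  ∀ v < n, ∃ i < k, t / n ^ i % n = v ∨ Entry A n (t / n ^ i % n) v

/-- The vertex `v` is not dominated by the block of the vertices `u` with `u / L = i`. -/
def Undom (A : List Bool) (n L i v : ℕ) : Prop :=
  v / L ≠ i ∧ ∀ u < n, u / L = i → ¬Entry A n u v

/-- At most `L` vertices are not dominated by the block of the vertices `u` with `u / L = i`. -/
def Good (A : List Bool) (n L i : ℕ) : Prop :=
  ∑ v ∈ Finset.range n, ind (Undom A n L i v) ≤ L

section Definable

variable {m : ℕ} {n k t L i v : List Bool → (Fin m → ℕ) → ℕ}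

theorem defP_entry (hn : Def m n) (ht : Def m t) (hv : Def m v) :
    DefP m fun A x => Entry A (n A x) (t A x) (v A x) :=
  DefP.eq ((ht.mul hn).add hv).bit (Def.const 1)

theorem defP_tup (hn : Def m n) (hk : Def m k) (ht : Def m t) :
    DefP m fun A x => Tup A (n A x) (k A x) (t A x) := by
  refine DefP.forall_lt (P := fun A x v => ∃ i < k A x, t A x / n A x ^ i % n A x = v ∨
    Entry A (n A x) (t A x / n A x ^ i % n A x) v) hn ?_
  refine DefP.exists_lt (P := fun A x i => t A (fun i => x i.succ) / n A (fun i => x i.succ) ^ i %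
    n A (fun i => x i.succ) = x 0 ∨ Entry A (n A (fun i => x i.succ))
      (t A (fun i => x i.succ) / n A (fun i => x i.succ) ^ i % n A (fun i => x i.succ)) (x 0))
    hk.weaken ?_
  have hd := ((ht.weaken.weaken.div_pow hn.weaken.weaken (Def.var 0)).mod hn.weaken.weaken)
  exact (DefP.eq hd (Def.var 1)).or (defP_entry hn.weaken.weaken hd (Def.var 1))

theorem defP_undom (hn : Def m n) (hL : Def m L) (hi : Def m i) (hv : Def m v) :
    DefP m fun A x => Undom A (n A x) (L A x) (i A x) (v A x) := by
  refine (DefP.eq (hv.div hL) hi).not.and ?_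
  refine DefP.forall_lt (P := fun A x u => u / L A x = i A x → ¬Entry A (n A x) u (v A x)) hn ?_
  exact (DefP.eq ((Def.var 0).div hL.weaken) hi.weaken).imp
    (defP_entry hn.weaken (Def.var 0) hv.weaken).not

theorem defP_good (hn : Def m n) (hL : Def m L) (hi : Def m i) :
    DefP m fun A x => Good A (n A x) (L A x) (i A x) :=
  DefP.le (hn.sum (b := fun A x v => ind (Undom A (n A x) (L A x) (i A x) v))
    (defP_undom hn.weaken hL.weaken hi.weaken (Def.var 0))) hL

end Definable

/-- No tuple `t < N` dominates. -/
def NoTup (A : List Bool) (n k N : ℕ) : Prop := ¬∃ t < N, Tup A n k t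

/-- The vertex `j` belongs to the least dominating tuple. -/
def InTup (A : List Bool) (n k N j : ℕ) : Prop :=
  ∃ t < N, (Tup A n k t ∧ ∀ t' < t, ¬Tup A n k t') ∧ ∃ i < k, t / n ^ i % n = j

/-- The vertex `j` belongs to the first good block, or is not dominated by it. -/
def InBlock (A : List Bool) (n L j : ℕ) : Prop :=
  ∃ i < n / L, (Good A n L i ∧ ∀ i' < i, ¬Good A n L i') ∧ (j / L = i ∨ Undom A n L i j)

/-- There is a good block, and the number `s` of positive answers is zero. -/
def UseBlock (A : List Bool) (n L s : ℕ) : Prop := s = 0 ∧ ∃ i < n / L, Good A n L i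

theorem defP_noTup : DefP 5 fun A v => NoTup A (v 4) (v 0) (v 1) :=
  (DefP.exists_lt (P := fun A v t => Tup A (v 4) (v 0) t) (Def.var 1)
    (defP_tup (Def.var 5) (Def.var 1) (Def.var 0))).not

theorem defP_inTup : DefP 6 fun A v => InTup A (v 5) (v 1) (v 2) (v 0) := by
  refine DefP.exists_lt (P := fun A v t => (Tup A (v 5) (v 1) t ∧ ∀ t' < t, ¬Tup A (v 5) (v 1) t') ∧
    ∃ i < v 1, t / v 5 ^ i % v 5 = v 0) (Def.var 2) ?_
  refine ((defP_tup (Def.var 6) (Def.var 2) (Def.var 0)).and ?_).and ?_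
  · exact DefP.forall_lt (P := fun A v t' => ¬Tup A (v 6) (v 2) t') (Def.var 0)
      (defP_tup (Def.var 7) (Def.var 3) (Def.var 0)).not
  · exact DefP.exists_lt (P := fun A v i => v 0 / v 6 ^ i % v 6 = v 1) (Def.var 2)
      (DefP.eq (((Def.var 1).div_pow (Def.var 7) (Def.var 0)).mod (Def.var 7)) (Def.var 2))

theorem defP_useBlock : DefP 3 fun A v => UseBlock A (v 2) (v 1) (v 0) :=
  (DefP.eq (Def.var 0) (Def.const 0)).and
    (DefP.exists_lt (P := fun A v i => Good A (v 2) (v 1) i) ((Def.var 2).div (Def.var 1))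
      (defP_good (Def.var 3) (Def.var 2) (Def.var 0)))

theorem defP_inBlock : DefP 5 fun A v => InBlock A (v 4) (v 3) (v 0) := by
  refine DefP.exists_lt (P := fun A v i => (Good A (v 4) (v 3) i ∧ ∀ i' < i, ¬Good A (v 4) (v 3) i') ∧
    (v 0 / v 3 = i ∨ Undom A (v 4) (v 3) i (v 0))) ((Def.var 4).div (Def.var 3)) ?_
  refine ((defP_good (Def.var 5) (Def.var 4) (Def.var 0)).and ?_).and
    ((DefP.eq ((Def.var 1).div (Def.var 4)) (Def.var 0)).or
      (defP_undom (Def.var 5) (Def.var 4) (Def.var 0) (Def.var 1)))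
  exact DefP.forall_lt (P := fun A v i' => ¬Good A (v 5) (v 4) i') (Def.var 0)
    (defP_good (Def.var 6) (Def.var 5) (Def.var 0)).not

/-! ### Correctness of the approximation algorithm -/

section Graph

variable {n : ℕ} (G : SimpleGraph (Fin n))

open Classical in
/-- The adjacency matrix as a bit string, row by row. -/
noncomputable def matrix : List Bool :=
  (List.ofFn fun i => List.ofFn fun j => decide (G.Adj i j)).flatten

open Classical in
theorem matrix_eq_ofFn :
    matrix G = List.ofFn fun x : Fin (n * n) => decide (G.Adj x.divNat x.modNat) := by
  rw [List.ofFn_mul, matrix]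
  refine congrArg List.flatten (congrArg List.ofFn (funext fun i => congrArg List.ofFn
    (funext fun j => ?_)))
  have hn : 0 < n := i.pos
  have h1 : ((i * n + j : ℕ)) / n = i := by
    rw [mul_comm, Nat.mul_add_div hn, Nat.div_eq_of_lt j.2, add_zero]
  have h2 : ((i * n + j : ℕ)) % n = j := by
    rw [mul_comm, Nat.mul_add_mod, Nat.mod_eq_of_lt j.2]
  congr 2 <;> ext
  · simp [Fin.divNat, h1]
  · simp [Fin.modNat, h2]

theorem length_matrix : (matrix G).length = n * n := by
  rw [matrix_eq_ofFn, List.length_ofFn]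

theorem entry_matrix (u v : Fin n) : Entry (matrix G) n u v ↔ G.Adj u v := by
  have hn : 0 < n := u.pos
  have hlt : (u * n + v : ℕ) < n * n := by
    have := Nat.mul_le_mul_right n (Nat.succ_le_of_lt u.2)
    have := v.2
    rw [Nat.succ_mul] at *
    omega
  have h1 : ((u * n + v : ℕ)) / n = u := by
    rw [mul_comm, Nat.mul_add_div hn, Nat.div_eq_of_lt v.2, add_zero]
  have h2 : ((u * n + v : ℕ)) % n = v := by
    rw [mul_comm, Nat.mul_add_mod, Nat.mod_eq_of_lt v.2]
  have hu : (⟨u * n + v, hlt⟩ : Fin (n * n)).divNat = u := Fin.ext (by simp [Fin.divNat, h1])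
  have hv : (⟨u * n + v, hlt⟩ : Fin (n * n)).modNat = v := Fin.ext (by simp [Fin.modNat, h2])
  rw [Entry, matrix_eq_ofFn, List.getD_eq_getElem _ _ (by simpa using hlt), List.getElem_ofFn,
    hu, hv]
  by_cases h : G.Adj u v <;> simp [h]

theorem dominating_card_univ : IsDominating G Finset.univ := fun v hv => absurd (Finset.mem_univ v) hv

theorem exists_card_eq_dominationNumber :
    ∃ D : Finset (Fin n), D.card = dominationNumber G ∧ IsDominating G D :=
  Nat.sInf_mem (s := {m | ∃ D : Finset (Fin n), D.card = m ∧ IsDominating G D})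
    ⟨_, Finset.univ, rfl, dominating_card_univ G⟩

theorem dominationNumber_le {D : Finset (Fin n)} (h : IsDominating G D) :
    dominationNumber G ≤ D.card :=
  Nat.sInf_le ⟨D, rfl, h⟩

theorem dominationNumber_le_card : dominationNumber G ≤ n := by
  simpa using dominationNumber_le G (dominating_card_univ G)

theorem dominationNumber_pos (hn : 1 ≤ n) : 1 ≤ dominationNumber G := by
  obtain ⟨D, hD, h⟩ := exists_card_eq_dominationNumber G
  by_contra! h0
  obtain rfl : D = ∅ := by rw [← Finset.card_eq_zero]; omega
  obtain ⟨u, hu, -⟩ := h ⟨0, hn⟩ (by simp)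
  simp at hu

/-- The vertices that occur in the tuple `t`. -/
def tupSet (n k t : ℕ) : Finset (Fin n) :=
  Finset.univ.filter fun j => ∃ i < k, t / n ^ i % n = j

theorem card_tupSet_le (n k t : ℕ) : (tupSet n k t).card ≤ k := by
  have h : (tupSet n k t).image (fun j : Fin n => (j : ℕ)) ⊆
      (Finset.range k).image fun i => t / n ^ i % n := by
    intro x hx
    simp only [tupSet, Finset.mem_image, Finset.mem_filter, Finset.mem_univ, true_and] at hx
    obtain ⟨j, ⟨i, hi, hij⟩, rfl⟩ := hx
    exact Finset.mem_image.2 ⟨i, Finset.mem_range.2 hi, hij⟩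
  have h2 := (Finset.card_le_card h).trans Finset.card_image_le
  rwa [Finset.card_image_of_injective _ Fin.val_injective, Finset.card_range] at h2

theorem tup_matrix_iff (hn : 1 ≤ n) (k t : ℕ) :
    Tup (matrix G) n k t ↔ IsDominating G (tupSet n k t) := by
  constructor
  · intro h v hv
    obtain ⟨i, hi, h | h⟩ := h v v.2
    · exact absurd (by simpa [tupSet] using ⟨i, hi, h⟩) hv
    · refine ⟨⟨_, Nat.mod_lt (t / n ^ i) hn⟩, by simpa [tupSet] using ⟨i, hi, rfl⟩, ?_⟩
      exact (entry_matrix G ⟨_, Nat.mod_lt (t / n ^ i) hn⟩ v).1 h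
  · intro h v hv
    by_cases hv' : (⟨v, hv⟩ : Fin n) ∈ tupSet n k t
    · simp only [tupSet, Finset.mem_filter, Finset.mem_univ, true_and] at hv'
      obtain ⟨i, hi, h⟩ := hv'
      exact ⟨i, hi, Or.inl h⟩
    · obtain ⟨u, hu, huv⟩ := h _ hv'
      simp only [tupSet, Finset.mem_filter, Finset.mem_univ, true_and] at hu
      obtain ⟨i, hi, h⟩ := hu
      exact ⟨i, hi, Or.inr (by rw [h]; exact (entry_matrix G u ⟨v, hv⟩).2 huv)⟩

/-- Every nonempty set of at most `k` vertices is the set of some tuple. -/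
theorem exists_tupSet_eq {D : Finset (Fin n)} {k : ℕ} (hD : D.Nonempty) (hk : D.card ≤ k) :
    ∃ t < n ^ k, tupSet n k t = D := by
  obtain ⟨g, hg⟩ : ∃ g : Fin k → Fin n, Finset.univ.image g = D := by
    obtain ⟨d, hd⟩ := hD
    let e := D.equivFin
    refine ⟨fun i => if h : (i : ℕ) < D.card then e.symm ⟨i, h⟩ else d, ?_⟩
    ext x
    simp only [Finset.mem_image, Finset.mem_univ, true_and]
    constructor
    · rintro ⟨i, rfl⟩
      split_ifs
      · exact Subtype.coe_prop _
      · exact hd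
    · intro hx
      refine ⟨⟨e ⟨x, hx⟩, (e ⟨x, hx⟩).2.trans_le hk⟩, ?_⟩
      simp
  refine ⟨finFunctionFinEquiv g, (finFunctionFinEquiv g).2, ?_⟩
  have h : ∀ i : Fin k, (finFunctionFinEquiv g : ℕ) / n ^ (i : ℕ) % n = g i := fun i => by
    rw [← finFunctionFinEquiv_symm_apply_val, Equiv.symm_apply_apply]
  rw [← hg]
  ext j
  simp only [tupSet, Finset.mem_filter, Finset.mem_univ, true_and, Finset.mem_image]
  constructor
  · rintro ⟨i, hi, hij⟩
    exact ⟨⟨i, hi⟩, Fin.ext ((h ⟨i, hi⟩).symm.trans hij)⟩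
  · rintro ⟨i, rfl⟩
    exact ⟨i, i.2, h i⟩

theorem noTup_matrix_iff (hn : 1 ≤ n) (k : ℕ) :
    NoTup (matrix G) n k (n ^ k) ↔ k < dominationNumber G := by
  rw [← not_le, NoTup, not_iff_not]
  constructor
  · rintro ⟨t, -, ht⟩
    exact (dominationNumber_le G ((tup_matrix_iff G hn k t).1 ht)).trans (card_tupSet_le n k t)
  · intro hk
    obtain ⟨D, hD, h⟩ := exists_card_eq_dominationNumber G
    have := dominationNumber_pos G hn
    obtain ⟨t, ht, rfl⟩ := exists_tupSet_eq (Finset.card_pos.1 (by omega)) (hD.le.trans hk)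
    exact ⟨t, ht, (tup_matrix_iff G hn k t).2 h⟩

open Classical in
theorem map_range_eq_encodeSet (P : ℕ → Prop) :
    ((List.range n).map fun j => decide (P j)) =
      encodeSet (Finset.univ.filter fun j : Fin n => P j) := by
  simp [encodeSet, List.ofFn_eq_map, ← List.map_coe_finRange_eq_range]

open Classical in
/-- The least dominating tuple of length `γ` is a minimum dominating set. -/
theorem inTup_spec (hn : 1 ≤ n) : ∃ D : Finset (Fin n), D.card ≤ dominationNumber G ∧
    IsDominating G D ∧ encodeSet D = (List.range n).map fun j =>
      decide (InTup (matrix G) n (dominationNumber G) (n ^ dominationNumber G) j) := by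
  set γ := dominationNumber G
  obtain ⟨t, ht, hdom⟩ := not_not.1 (mt (noTup_matrix_iff G hn γ).1 (lt_irrefl _))
  have hex : ∃ t, Tup (matrix G) n γ t := ⟨t, hdom⟩
  refine ⟨tupSet n γ (Nat.find hex), card_tupSet_le _ _ _,
    (tup_matrix_iff G hn _ _).1 (Nat.find_spec hex), ?_⟩
  rw [map_range_eq_encodeSet]
  congr 1
  ext j
  simp only [tupSet, Finset.mem_filter, Finset.mem_univ, true_and]
  constructor
  · exact fun h => ⟨Nat.find hex, (Nat.find_min' hex hdom).trans_lt ht,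
      ⟨Nat.find_spec hex, fun t' ht' => Nat.find_min hex ht'⟩, h⟩
  · rintro ⟨t', -, ⟨h1, h2⟩, h3⟩
    have : Nat.find hex = t' := (Nat.find_eq_iff hex).2 ⟨h1, fun m hm => h2 m hm⟩
    rwa [this]

open Classical in
/-- The vertices outside the `i`-th block of `L` vertices without a neighbour in this block. -/
noncomputable def undominated (L i : ℕ) : Finset (Fin n) :=
  Finset.univ.filter fun v => (v : ℕ) / L ≠ i ∧ ∀ u : Fin n, (u : ℕ) / L = i → ¬G.Adj u v

theorem mem_undominated {L i : ℕ} {v : Fin n} :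
    v ∈ undominated G L i ↔ Undom (matrix G) n L i v := by
  simp only [undominated, Undom, Finset.mem_filter, Finset.mem_univ, true_and]
  refine and_congr_right fun _ => ⟨fun h u hu hui => ?_, fun h u hui => ?_⟩
  · exact (entry_matrix G ⟨u, hu⟩ v).not.2 (h ⟨u, hu⟩ hui)
  · exact (entry_matrix G u v).not.1 (h u u.2 hui)

theorem good_matrix_iff (L i : ℕ) :
    Good (matrix G) n L i ↔ (undominated G L i).card ≤ L := by
  classical
  have : ∑ v ∈ Finset.range n, ind (Undom (matrix G) n L i v) = (undominated G L i).card := by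
    rw [← Fin.sum_univ_eq_sum_range (fun v => ind (Undom (matrix G) n L i v)),
      Finset.card_eq_sum_ones, ← Finset.sum_filter_add_sum_filter_not Finset.univ
        (fun v => v ∈ undominated G L i)]
    rw [Finset.sum_congr rfl fun v hv => ind_of_true ((mem_undominated G).1
      (Finset.mem_filter.1 hv).2), Finset.sum_congr (s₁ := Finset.univ.filter fun v =>
        ¬v ∈ undominated G L i) rfl fun v hv => ind_of_false (fun h => (Finset.mem_filter.1 hv).2
          ((mem_undominated G).2 h))]
    simp
  rw [Good, this]

open Classical in
/-- A good block together with the vertices it does not dominate is a dominating set. -/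
theorem inBlock_spec {L : ℕ} (h : ∃ i < n / L, Good (matrix G) n L i) :
    ∃ D : Finset (Fin n), D.card ≤ 2 * L ∧ IsDominating G D ∧
      encodeSet D = (List.range n).map fun j => decide (InBlock (matrix G) n L j) := by
  have hi := Nat.find_spec h
  set i := Nat.find h with hi'
  refine ⟨(Finset.univ.filter fun j : Fin n => (j : ℕ) / L = i) ∪ undominated G L i, ?_, ?_, ?_⟩
  · refine (Finset.card_union_le _ _).trans ?_
    have h1 := (good_matrix_iff G L i).1 hi.2
    have hL : 0 < L := by
      rcases Nat.eq_zero_or_pos L with rfl | h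
      · simp at hi
      · exact h
    have h2 : (Finset.univ.filter fun j : Fin n => (j : ℕ) / L = i).card ≤ L := by
      rw [← Finset.card_image_of_injective _ Fin.val_injective]
      calc _ ≤ (Finset.Ico (i * L) (i * L + L)).card := Finset.card_le_card fun x hx => by
            simp only [Finset.mem_image, Finset.mem_filter, Finset.mem_univ, true_and] at hx
            obtain ⟨j, hj, rfl⟩ := hx
            rw [Finset.mem_Ico, ← hj]
            exact ⟨Nat.div_mul_le_self _ _, Nat.lt_div_mul_add hL⟩
        _ = L := by simp
    omega
  · intro v hv
    simp only [Finset.mem_union, Finset.mem_filter, Finset.mem_univ, true_and, undominated,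
      not_or, not_and, not_forall, not_not] at hv
    obtain ⟨u, hu, huv⟩ := hv.2 hv.1
    exact ⟨u, by simp [hu], huv⟩
  · rw [map_range_eq_encodeSet]
    congr 1
    ext j
    simp only [Finset.mem_union, Finset.mem_filter, Finset.mem_univ, true_and, mem_undominated]
    constructor
    · exact fun h' => ⟨i, hi.1, ⟨hi.2, fun i' hi' hg =>
        Nat.find_min h hi' ⟨hi'.trans hi.1, hg⟩⟩, h'⟩
    · rintro ⟨i', h0, ⟨h1, h2⟩, h3⟩
      have : i = i' := (Nat.find_eq_iff h).2 ⟨⟨h0, h1⟩, fun m hm h => h2 m hm h.2⟩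
      rwa [this]

/-- No block of `L` vertices dominates all but at most `L` vertices. -/
def NoGoodBlock (L : ℕ) : Prop := ∀ i < n / L, L < (undominated G L i).card

end Graph

open Classical in
/-- The approximation algorithm that is built from an algorithm for the dominating set problem, a
block length `gL` and a number `gK` of queries. -/
theorem exists_approximation {M : Algorithm} (hM : DecidesDomSet M) :
    ∃ b₂, PolyBdd b₂ ∧ ∀ {gL gK : ℕ → ℕ}, (Def 1 fun _ v => gL (v 0)) →
      (Def 1 fun _ v => gK (v 0)) → ∃ (M' : Algorithm) (b₁ : ℕ → ℕ), PolyBdd b₁ ∧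
        ∀ n ≥ 1, ∀ G : SimpleGraph (Fin n),
          (∃ D, M'.Outputs (encodeGraph G) (encodeSet D) ∧ IsDominating G D ∧
            (D.card ≤ dominationNumber G ∨
              gK n < dominationNumber G ∧ D.card ≤ 2 * gL n)) ∧
          M'.runTime (encodeGraph G) ≤
            (b₁ n : ℕ∞) + ∑ k ∈ Finset.Icc 1 (gK n), M.runTime (encodeInstance G k) +
            if dominationNumber G ≤ gK n ∨ NoGoodBlock G (gL n) then
              (b₂ (n ^ dominationNumber G + n + gK n + gL n) : ℕ∞) else 0 := by
  obtain ⟨b₂, hb₂, h⟩ := exists_algorithm M defP_noTup defP_inTup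
  refine ⟨b₂, hb₂, fun {gL gK} hL hK => ?_⟩
  obtain ⟨M', b₁, hb₁, h⟩ := h hL hK defP_useBlock defP_inBlock
  refine ⟨M', b₁, hb₁, fun n hn G => ?_⟩
  have hγ := dominationNumber_pos G hn
  have hγn := dominationNumber_le_card G
  set γ := dominationNumber G
  let c : ℕ → Bool := fun k => decide (∃ D : Finset (Fin n), D.card = k ∧ IsDominating G D)
  have hout : ∀ k ∈ Finset.Icc 1 (gK n), M.Outputs (encodeInstance G k) [c k] := fun k hk =>
    hM n hn k (Finset.mem_Icc.1 hk).1 G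
  have hτ : ∀ k ∈ Finset.Icc 1 (gK n), M.runTime (encodeInstance G k) =
      (M.runTime (encodeInstance G k)).toNat := fun k hk =>
    (ENat.natCast_toNat (runTime_ne_top (hout k hk))).symm
  have hs : ∑ k ∈ Finset.Icc 1 (gK n), (c k).toNat = 0 ↔ gK n < γ := by
    rw [Finset.sum_eq_zero_iff]
    constructor
    · intro h0
      by_contra! hle
      have := h0 γ (Finset.mem_Icc.2 ⟨hγ, hle⟩)
      simp [c, exists_card_eq_dominationNumber G, γ] at this
    · intro hlt k hk
      have : ¬∃ D : Finset (Fin n), D.card = k ∧ IsDominating G D := by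
        rintro ⟨D, rfl, hD⟩
        have := dominationNumber_le G hD
        have := (Finset.mem_Icc.1 hk).2
        omega
      simp [c, this]
  obtain ⟨h1, h2⟩ := h n (matrix G) c (fun k => (M.runTime (encodeInstance G k)).toNat) hn
    (length_matrix G).le fun k hk => ⟨hout k hk, (hτ k hk).le⟩
  rw [Finset.sum_congr rfl hτ]
  by_cases hu : UseBlock (matrix G) n (gL n) (∑ k ∈ Finset.Icc 1 (gK n), (c k).toNat)
  · obtain ⟨D, hD, hdom, henc⟩ := inBlock_spec G hu.2
    obtain ⟨h3, h4⟩ := h1 hu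
    refine ⟨⟨D, by rw [henc]; exact h3, hdom, Or.inr ⟨hs.1 hu.1, hD⟩⟩, ?_⟩
    refine h4.trans ((le_of_eq ?_).trans le_self_add)
    push_cast
    rfl
  · obtain ⟨D, hD, hdom, henc⟩ := inTup_spec G hn
    have hpow : γ ≤ n ^ γ + n + gK n + gL n := by omega
    obtain ⟨h3, h4⟩ := h2 hu γ (n ^ γ + n + gK n + gL n)
      (fun k hk => (noTup_matrix_iff G hn k).2 hk)
      (mt (noTup_matrix_iff G hn γ).1 (lt_irrefl _)) (by omega) (by omega) (by omega) hγ hpow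
      (by omega)
    refine ⟨⟨D, by rw [henc]; exact h3, hdom, Or.inl hD⟩, ?_⟩
    rw [if_pos]
    · refine h4.trans (le_of_eq ?_)
      push_cast
      rfl
    · by_contra! hcon
      refine hu ⟨hs.2 hcon.1, ?_⟩
      simpa [NoGoodBlock, good_matrix_iff] using hcon.2

/-! ### Tail bounds for the random graph -/

section Probability

open MeasureTheory Measure ProbabilityTheory

instance {n : ℕ} : DiscreteMeasurableSpace (SimpleGraph (Fin n)) where
  forall_measurableSet s :=
    ⟨SimpleGraph.Adj '' s, .of_discrete, Set.preimage_image_eq _ fun _ _ => SimpleGraph.ext⟩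

variable {n : ℕ} (p : unitInterval)

/-- The event that no element of `F` is an edge. -/
def absent (F : Finset (Sym2 (Fin n))) : Set (SimpleGraph (Fin n)) :=
  {G | ∀ e ∈ F, e ∉ G.edgeSet}

theorem measure_absent {F : Finset (Sym2 (Fin n))} (hF : ∀ e ∈ F, ¬e.IsDiag) :
    (SimpleGraph.binomialRandom (Fin n) p).real (absent F) = (1 - p : ℝ) ^ F.card := by
  have hpre : (SimpleGraph.fromEdgeSet ∘ fun ω : Sym2 (Fin n) → Prop => {e | ω e}) ⁻¹' absent F =
      Set.pi F fun _ => {False} := by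
    ext ω
    simp only [absent, Set.mem_preimage, Set.mem_ofPred_eq, Function.comp,
      SimpleGraph.edgeSet_fromEdgeSet, Set.mem_sdiff, Set.mem_pi, Finset.mem_coe,
      Set.mem_singleton_iff, eq_iff_iff, iff_false]
    refine forall₂_congr fun e he => ?_
    simp [hF e he]
  rw [measureReal_def, SimpleGraph.binomialRandom_eq_map, setBernoulli_eq_map,
    map_map (by fun_prop) (by fun_prop), map_apply (by fun_prop) .of_discrete, hpre,
    infinitePi_pi _ fun _ _ => .of_discrete, Finset.prod_congr rfl (g := fun _ =>
      ((unitInterval.toNNReal (unitInterval.symm p) : NNReal) : ℝ≥0∞))]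
  · simp
  · intro e he
    simp [hF e he]

/-- If the sets `S v` are disjoint, then the events that some element of `S v` is an edge are
independent; the set `T` makes an induction possible that uses `measure_absent` only. -/
theorem measure_forall_exists_edge {S : Fin n → Finset (Sym2 (Fin n))} {W : Finset (Fin n)}
    (hS : ∀ v ∈ W, ∀ e ∈ S v, ¬e.IsDiag) (hd : (W : Set (Fin n)).PairwiseDisjoint S) :
    ∀ T : Finset (Sym2 (Fin n)), (∀ e ∈ T, ¬e.IsDiag) → (∀ v ∈ W, Disjoint T (S v)) →
      (SimpleGraph.binomialRandom (Fin n) p).real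
        (absent T ∩ {G | ∀ v ∈ W, ∃ e ∈ S v, e ∈ G.edgeSet}) =
      (1 - p : ℝ) ^ T.card * ∏ v ∈ W, (1 - (1 - p : ℝ) ^ (S v).card) := by
  classical
  induction W using Finset.induction_on with
  | empty =>
    intro T hT _
    simp [measure_absent p hT]
  | insert w W hw ih =>
    intro T hT hTW
    have ih := ih (fun v hv => hS v (Finset.mem_insert_of_mem hv))
      (hd.subset (by simp))
    have hTw := hTW w (Finset.mem_insert_self _ _)
    have h1 := ih T hT fun v hv => hTW v (Finset.mem_insert_of_mem hv)
    have h2 := ih (T ∪ S w)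
      (fun e he => (Finset.mem_union.1 he).elim (hT e) (hS w (Finset.mem_insert_self _ _) e))
      fun v hv => Finset.disjoint_union_left.2 ⟨hTW v (Finset.mem_insert_of_mem hv),
        hd (by simp) (by simp [hv]) (by rintro rfl; exact hw hv)⟩
    have hsplit : absent T ∩ {G | ∀ v ∈ insert w W, ∃ e ∈ S v, e ∈ G.edgeSet} =
        (absent T ∩ {G | ∀ v ∈ W, ∃ e ∈ S v, e ∈ G.edgeSet}) \
          (absent (T ∪ S w) ∩ {G | ∀ v ∈ W, ∃ e ∈ S v, e ∈ G.edgeSet}) := by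
      ext G
      simp only [absent, Set.mem_inter_iff, Set.mem_ofPred_eq, Finset.forall_mem_insert,
        Set.mem_sdiff, Finset.mem_union]
      constructor
      · rintro ⟨h, ⟨e, he, heG⟩, h'⟩
        exact ⟨⟨h, h'⟩, fun h'' => h''.1 e (Or.inr he) heG⟩
      · rintro ⟨⟨h, h'⟩, h''⟩
        refine ⟨h, ?_, h'⟩
        by_contra! hcon
        exact h'' ⟨fun e he => he.elim (h e) (hcon e), h'⟩
    rw [hsplit, measureReal_sdiff ?_ .of_discrete, h1, h2, Finset.card_union_of_disjoint hTw,
      Finset.prod_insert hw, pow_add]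
    · ring
    · exact Set.inter_subset_inter_left _ fun G hG e he => hG e (Finset.mem_union_left _ he)

/-- The vertices outside `D` are dominated independently of each other, since the sets of pairs that
connect them to `D` are disjoint. -/
theorem measure_isDominating (D : Finset (Fin n)) :
    (SimpleGraph.binomialRandom (Fin n) p).real {G | IsDominating G D} =
      (1 - (1 - p : ℝ) ^ D.card) ^ (n - D.card) := by
  classical
  have h := measure_forall_exists_edge p (S := fun v => D.image fun u => s(u, v)) (W := Dᶜ)
    (fun v hv e he => by
      obtain ⟨u, hu, rfl⟩ := Finset.mem_image.1 he
      rintro (rfl : u = v)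
      exact Finset.mem_compl.1 hv hu)
    (fun v hv w hw hvw => by
      rw [Function.onFun, Finset.disjoint_left]
      intro e he he'
      obtain ⟨u, hu, rfl⟩ := Finset.mem_image.1 he
      obtain ⟨u', hu', h⟩ := Finset.mem_image.1 he'
      rcases Sym2.eq_iff.1 h with ⟨-, h⟩ | ⟨-, h⟩
      · exact hvw h.symm
      · exact Finset.mem_compl.1 (Finset.mem_coe.1 hw) (h ▸ hu)) ∅ (by simp) (by simp)
  have hcard : ∀ v, (D.image fun u => s(u, v)).card = D.card := fun v =>
    Finset.card_image_of_injective _ fun u u' h => Sym2.congr_left.1 h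
  simp only [hcard, Finset.prod_const, Finset.card_compl, Fintype.card_fin, Finset.card_empty,
    pow_zero, one_mul] at h
  rw [← h]
  congr 1
  ext G
  simp [absent, IsDominating]

/-- The union bound over all tuples of `K` vertices. -/
theorem measure_dominationNumber_le (hn : 1 ≤ n) (K : ℕ) :
    (SimpleGraph.binomialRandom (Fin n) p).real {G | dominationNumber G ≤ K} ≤
      n ^ K * (1 - (1 - p : ℝ) ^ K) ^ (n - K) := by
  have hp0 : 0 ≤ (1 - p : ℝ) := by linarith [p.2.2]
  have hp1 : (1 - p : ℝ) ≤ 1 := by linarith [p.2.1]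
  have hsub : {G : SimpleGraph (Fin n) | dominationNumber G ≤ K} ⊆
      ⋃ t ∈ Finset.range (n ^ K), {G | IsDominating G (tupSet n K t)} := by
    intro G (hG : dominationNumber G ≤ K)
    have := (noTup_matrix_iff G hn K).not.2 (not_lt.2 hG)
    obtain ⟨t, ht, h⟩ := not_not.1 this
    exact Set.mem_biUnion (by simpa using ht) ((tup_matrix_iff G hn K t).1 h)
  refine (measureReal_mono hsub (measure_ne_top _ _)).trans ((measureReal_biUnion_finset_le _ _).trans ?_)
  refine (Finset.sum_le_card_nsmul _ _ ((1 - (1 - p : ℝ) ^ K) ^ (n - K)) fun t _ => ?_).trans ?_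
  · rw [measure_isDominating]
    have hc := card_tupSet_le n K t
    have h1 := pow_le_pow_of_le_one hp0 hp1 hc
    have h2 : (1 - p : ℝ) ^ (tupSet n K t).card ≤ 1 := pow_le_one₀ hp0 hp1
    have h3 : 0 ≤ (1 - p : ℝ) ^ K := pow_nonneg hp0 _
    calc _ ≤ (1 - (1 - p : ℝ) ^ K) ^ (n - (tupSet n K t).card) :=
          pow_le_pow_left₀ (by linarith) (by linarith) _
      _ ≤ _ := pow_le_pow_of_le_one (by linarith) (by linarith) (by omega)
  · simp

/-- The union bound over all choices of `L` undominated vertices for every block. Every pair that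
is forced to be absent consists of a vertex of a block and an undominated vertex of this block;
it arises at most twice in this way. -/
theorem measure_noGoodBlock {s : ℝ} (hs0 : 0 ≤ s) (hs1 : s ≤ 1) (hs : s ^ 2 = 1 - p) (L : ℕ) :
    (SimpleGraph.binomialRandom (Fin n) p).real {G | NoGoodBlock G L} ≤
      (n * s ^ L) ^ (L * (n / L)) := by
  classical
  have hdm : n / L * L ≤ n := Nat.div_mul_le_self n L
  -- the pairs `(u, g (u / L) j)`
  let a : Fin (n / L) × Fin L × Fin L → Fin n := fun x => ⟨x.2.1 + L * x.1, by
    calc (x.2.1 + L * x.1 : ℕ) < L * (x.1 + 1) := by have := x.2.1.2; rw [mul_add]; omega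
      _ ≤ L * (n / L) := Nat.mul_le_mul_left _ x.1.2
      _ ≤ n := by rwa [mul_comm]⟩
  have ha : ∀ x, (a x : ℕ) / L = x.1 ∧ (a x : ℕ) % L = x.2.1 := fun x => by
    have := x.2.1.2
    simp only [a]
    rw [Nat.add_mul_div_left _ _ (by omega), Nat.div_eq_of_lt this, Nat.add_mul_mod_self_left,
      Nat.mod_eq_of_lt this]
    simp
  let F : (Fin (n / L) → Fin L → Fin n) → Finset (Sym2 (Fin n)) := fun g =>
    Finset.univ.image fun x : Fin (n / L) × Fin L × Fin L => s(a x, g x.1 x.2.2)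
  let Γ : Finset (Fin (n / L) → Fin L → Fin n) := Finset.univ.filter fun g =>
    ∀ i, Function.Injective (g i) ∧ ∀ j, (g i j : ℕ) / L ≠ i
  have hsub : {G : SimpleGraph (Fin n) | NoGoodBlock G L} ⊆ ⋃ g ∈ Γ, absent (F g) := by
    intro G (hG : NoGoodBlock G L)
    have hex : ∀ i : Fin (n / L), ∃ g : Fin L ↪ Fin n, ∀ j, g j ∈ undominated G L i := fun i => by
      obtain ⟨U, hU, hUL⟩ := Finset.exists_subset_card_eq (hG i i.2).le
      exact ⟨(finCongr hUL.symm).toEmbedding.trans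
        (U.equivFin.symm.toEmbedding.trans (Function.Embedding.subtype _)),
        fun j => hU (Subtype.coe_prop _)⟩
    choose g hg using hex
    simp only [undominated, Finset.mem_filter, Finset.mem_univ, true_and] at hg
    refine Set.mem_biUnion (x := fun i j => g i j) ?_ ?_
    · simpa [Γ] using fun i => ⟨(g i).injective, fun j => (hg i j).1⟩
    · intro e he
      obtain ⟨x, -, rfl⟩ := Finset.mem_image.1 he
      exact (hg x.1 x.2.2).2 (a x) (ha x).1
  refine (measureReal_mono hsub (measure_ne_top _ _)).trans ((measureReal_biUnion_finset_le _ _).trans ?_)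
  -- there are `n / L * L * L` pairs, hence at least half as many edges
  refine (Finset.sum_le_card_nsmul _ _ (s ^ (n / L * (L * L))) fun g hg => ?_).trans ?_
  · replace hg : ∀ i, Function.Injective (g i) ∧ ∀ j, (g i j : ℕ) / L ≠ i := by
      simpa [Γ] using hg
    rw [measure_absent, ← hs, ← pow_mul]
    · refine pow_le_pow_of_le_one hs0 hs1 ?_
      have hcard := Finset.card_le_mul_card_image (f := fun x : Fin (n / L) × Fin L × Fin L =>
        s(a x, g x.1 x.2.2)) Finset.univ 2 ?_
      · simpa [Fintype.card_prod] using hcard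
      · intro e _
        induction e using Sym2.ind with | _ u v =>
        -- a pair is determined by its element in the block
        have hinj : ∀ b c : Fin n, (Finset.univ.filter fun x : Fin (n / L) × Fin L × Fin L =>
            a x = b ∧ g x.1 x.2.2 = c).card ≤ 1 := by
          intro b c
          rw [Finset.card_le_one]
          intro x hx y hy
          simp only [Finset.mem_filter, Finset.mem_univ, true_and] at hx hy
          have h1 : x.1 = y.1 := Fin.ext (by rw [← (ha x).1, ← (ha y).1, hx.1, hy.1])
          have h2 : x.2.1 = y.2.1 := Fin.ext (by rw [← (ha x).2, ← (ha y).2, hx.1, hy.1])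
          have h3 : x.2.2 = y.2.2 := (hg x.1).1 (by rw [hx.2, h1, hy.2])
          exact Prod.ext h1 (Prod.ext h2 h3)
        refine (Finset.card_le_card (t := (Finset.univ.filter fun x => a x = u ∧ g x.1 x.2.2 = v) ∪
          Finset.univ.filter fun x => a x = v ∧ g x.1 x.2.2 = u) fun x hx => ?_).trans
          ((Finset.card_union_le _ _).trans (Nat.add_le_add (hinj u v) (hinj v u)))
        simpa [Sym2.eq_iff] using hx
    · intro e he
      obtain ⟨x, -, rfl⟩ := Finset.mem_image.1 he
      intro h
      exact (hg x.1).2 x.2.2 (by rw [← Sym2.mk_isDiag_iff.1 h]; exact (ha x).1)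
  · have hΓ : (Γ.card : ℝ) ≤ n ^ (L * (n / L)) := by
      have := Finset.card_le_univ Γ
      rw [Fintype.card_fun, Fintype.card_fun, Fintype.card_fin, Fintype.card_fin, Fintype.card_fin,
        ← pow_mul] at this
      exact_mod_cast this
    rw [nsmul_eq_mul, mul_pow, ← pow_mul]
    calc _ ≤ (n : ℝ) ^ (L * (n / L)) * s ^ (n / L * (L * L)) :=
          mul_le_mul_of_nonneg_right hΓ (pow_nonneg hs0 _)
      _ = _ := by congr 2; ring

end Probability

/-! ### The block length and the number of queries -/

section Parameters

open Filter Topology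

/-- The number of binary digits of `n` (for `n ≥ 1`): a definable function of order `log n`. -/
def lam (n : ℕ) : ℕ := Nat.log 2 n + 1

theorem lt_two_pow_lam (n : ℕ) : n < 2 ^ lam n := Nat.lt_pow_succ_log_self one_lt_two n

theorem two_pow_lam_le {n : ℕ} (hn : 1 ≤ n) : 2 ^ lam n ≤ 2 * n := by
  rw [lam, pow_succ']
  exact Nat.mul_le_mul_left _ (Nat.pow_log_le_self 2 (by omega))

theorem lam_le {n : ℕ} (hn : 1 ≤ n) : lam n ≤ n := Nat.log_lt_self 2 (Nat.ne_of_gt hn)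

theorem lam_le_logb (n : ℕ) : (lam n : ℝ) ≤ Real.logb 2 n + 1 := by
  have := Real.natLog_le_logb n 2
  simp only [lam, Nat.cast_add, Nat.cast_one]
  push_cast at this
  linarith

theorem lam_le_log (n : ℕ) : (lam n : ℝ) ≤ 2 * Real.log n + 1 := by
  have h := lam_le_logb n
  have h2 : Real.logb 2 n ≤ 2 * Real.log n := by
    have hl : 0 ≤ Real.log n := Real.log_natCast_nonneg n
    have := Real.log_two_gt_d9
    rw [Real.logb, div_le_iff₀ (by linarith)]
    nlinarith
  linarith

theorem def_lam : Def 1 fun _ v => lam (v 0) := by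
  have h : ∀ n, lam n = (∑ i ∈ Finset.range n, ind (0 < n / 2 ^ (i + 1))) + 1 := by
    intro n
    -- `Nat.log 2 n` is the number of `i` with `2 ^ (i + 1) ≤ n`
    rw [lam]
    congr 1
    have : ∀ i, ind (0 < n / 2 ^ (i + 1)) = if i < Nat.log 2 n then 1 else 0 := fun i => by
      rcases Nat.eq_zero_or_pos n with rfl | hn
      · simp [ind]
      · have h : 0 < n / 2 ^ (i + 1) ↔ i < Nat.log 2 n := by
          rw [Nat.div_pos_iff, Nat.lt_iff_add_one_le (m := i),
            Nat.le_log_iff_pow_le one_lt_two (by omega)]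
          simp
        by_cases hi : i < Nat.log 2 n
        · rw [if_pos hi, ind_of_true (h.2 hi)]
        · rw [if_neg hi, ind_of_false (mt h.1 hi)]
    rw [Finset.sum_congr rfl fun i _ => this i, ← Finset.sum_filter, Finset.sum_const,
      smul_eq_mul, mul_one]
    have hf : (Finset.range n).filter (fun i => i < Nat.log 2 n) = Finset.range (Nat.log 2 n) := by
      ext i
      have := Nat.log_le_self 2 n
      simp only [Finset.mem_filter, Finset.mem_range]
      omega
    rw [hf, Finset.card_range]
  simp only [h]
  refine Def.add (Def.sum (b := fun _ v i => ind (0 < v 0 / 2 ^ (i + 1))) (Def.var 0) ?_)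
    (Def.const 1)
  exact DefP.lt (Def.const 0)
    ((Def.var 1).div_pow (Def.const 2) (Def.add (Def.var 0) (Def.const 1)))

theorem tendsto_lam : Tendsto lam atTop atTop := by
  refine tendsto_atTop.2 fun b => eventually_atTop.2 ⟨2 ^ b, fun n hn => ?_⟩
  exact ((Nat.le_log_iff_pow_le one_lt_two (by have := Nat.two_pow_pos b; omega)).2
    hn).trans (Nat.le_succ _)

/-- With blocks of length `q * lam n`, the probability that all blocks are bad outweighs the
polynomially bounded time for the search among `n ^ n` tuples. -/
theorem exists_blockLength {s : ℝ} (hs0 : 0 ≤ s) (hs1 : s < 1) (c : ℕ) :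
    ∃ q, ∀ᶠ n : ℕ in atTop, q * lam n ≤ n ∧
      (n : ℝ) ^ (c * (n + 4)) *
        (n * s ^ (q * lam n)) ^ (q * lam n * (n / (q * lam n))) ≤ 1 := by
  obtain ⟨q, hq⟩ := exists_pow_lt_of_lt_one (show (0 : ℝ) < (1 / 2) ^ (10 * c + 1) by positivity) hs1
  have hq0 : 0 < q := by
    rcases Nat.eq_zero_or_pos q with rfl | h
    · have : (1 / 2 : ℝ) ^ (10 * c + 1) ≤ 1 := pow_le_one₀ (by norm_num) (by norm_num)
      rw [pow_zero] at hq
      linarith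
    · exact h
  have hlog : ∀ᶠ n : ℕ in atTop, Real.log n ≤ (1 / (4 * q)) * n := by
    have h := (Real.isLittleO_log_id_atTop.comp_tendsto tendsto_natCast_atTop_atTop).bound
      (show (0 : ℝ) < 1 / (4 * q) by positivity)
    filter_upwards [h] with n hn
    simp only [Function.comp, id, Real.norm_natCast] at hn
    exact (le_abs_self _).trans hn
  refine ⟨q, ?_⟩
  filter_upwards [hlog, eventually_ge_atTop (2 * q), eventually_ge_atTop 1] with n h1 h2 h3
  have hL : q * lam n ≤ n := by
    have h4 := lam_le_log n
    have h5 : (2 * q : ℝ) ≤ n := by exact_mod_cast h2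
    have hqr : (0 : ℝ) < q := by exact_mod_cast hq0
    have h6 : (q : ℝ) * lam n ≤ n := by
      calc (q : ℝ) * lam n ≤ q * (2 * (1 / (4 * q) * n) + 1) := by gcongr; linarith
        _ = n / 2 + q := by field_simp; ring
        _ ≤ n := by linarith
    exact_mod_cast h6
  refine ⟨hL, ?_⟩
  have hlam : 0 < lam n := Nat.succ_pos _
  set L := q * lam n with hLdef
  have hL0 : 0 < L := Nat.mul_pos hq0 hlam
  have hn1 : (1 : ℝ) ≤ n := by exact_mod_cast h3
  have hLm : n + 4 ≤ 10 * (L * (n / L)) := by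
    have h5 := Nat.div_add_mod n L
    have h6 := Nat.mod_lt n hL0
    have h7 : L * 1 ≤ L * (n / L) := Nat.mul_le_mul_left _ (Nat.div_pos hL hL0)
    omega
  -- `n ^ (10 c + 1) ≤ 2 ^ ((10 c + 1) lam n)`, and `s ^ q < 2 ^ -(10 c + 1)`
  have hbase : (n : ℝ) ^ (10 * c) * (n * s ^ L) ≤ 1 := by
    calc (n : ℝ) ^ (10 * c) * (n * s ^ L) = (n : ℝ) ^ (10 * c + 1) * (s ^ q) ^ lam n := by
          rw [← pow_mul, ← hLdef]; ring
      _ ≤ (2 ^ lam n) ^ (10 * c + 1) * ((1 / 2) ^ (10 * c + 1)) ^ lam n := by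
          have h8 : (n : ℝ) ≤ 2 ^ lam n := by exact_mod_cast (lt_two_pow_lam n).le
          gcongr
      _ = ((2 * (1 / 2)) ^ (10 * c + 1)) ^ lam n := by
          rw [mul_pow, mul_pow, ← pow_mul, ← pow_mul, ← pow_mul, mul_comm (lam n)]
      _ = 1 := by norm_num
  calc (n : ℝ) ^ (c * (n + 4)) * (n * s ^ L) ^ (L * (n / L))
      ≤ (n : ℝ) ^ (10 * c * (L * (n / L))) * (n * s ^ L) ^ (L * (n / L)) := by
        refine mul_le_mul_of_nonneg_right (pow_le_pow_right₀ hn1 ?_) (by positivity)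
        calc c * (n + 4) ≤ c * (10 * (L * (n / L))) := Nat.mul_le_mul_left _ hLm
          _ = _ := by ring
    _ = ((n : ℝ) ^ (10 * c) * (n * s ^ L)) ^ (L * (n / L)) := by
        rw [mul_pow (_ ^ _), ← pow_mul]
    _ ≤ 1 := pow_le_one₀ (by positivity) hbase

/-- If the number `K` of queries is at most a small multiple of `log n`, then the probability that
`K` vertices can dominate outweighs the polynomially bounded time for the search among `n ^ K`
tuples. -/
theorem exists_queryBound {q : ℝ} (hq0 : 0 < q) (hq1 : q ≤ 1) (c : ℕ) :
    ∃ a ≥ 1, ∀ᶠ n : ℕ in atTop, ∀ K, K ≤ lam n / (2 * a) →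
      (n : ℝ) ^ (c * (K + 4)) * (n ^ K * (1 - q ^ K) ^ (n - K)) ≤ 1 := by
  obtain ⟨a, ha⟩ := exists_pow_lt_of_lt_one hq0 (show (1 / 2 : ℝ) < 1 by norm_num)
  replace ha : (1 / 2 : ℝ) ^ (a + 1) ≤ q :=
    (pow_le_pow_of_le_one (by norm_num) (by norm_num) (Nat.le_succ a)).trans ha.le
  set D : ℝ := 7 * c + 3 with hD
  have hlog : ∀ᶠ n : ℕ in atTop, Real.log n ^ 4 ≤ (1 / (16 * D ^ 2)) * n := by
    have h := ((Real.isLittleO_pow_log_id_atTop (n := 4)).comp_tendsto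
      tendsto_natCast_atTop_atTop).bound (show (0 : ℝ) < 1 / (16 * D ^ 2) by positivity)
    filter_upwards [h] with n hn
    simp only [Function.comp, id, Real.norm_natCast] at hn
    exact (le_abs_self _).trans hn
  have hlog1 : ∀ᶠ n : ℕ in atTop, 1 ≤ Real.log n :=
    (Real.tendsto_log_atTop.comp tendsto_natCast_atTop_atTop).eventually_ge_atTop 1
  refine ⟨a + 1, by omega, ?_⟩
  filter_upwards [hlog, hlog1, eventually_ge_atTop 1] with n h1 h2 h3 K hK
  have hn0 : (0 : ℝ) < n := by exact_mod_cast h3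
  have hKlam : 2 * (a + 1) * K ≤ lam n := by
    calc 2 * (a + 1) * K ≤ 2 * (a + 1) * (lam n / (2 * (a + 1))) := Nat.mul_le_mul_left _ hK
      _ ≤ lam n := Nat.mul_div_le _ _
  have h2K : 2 * K ≤ lam n := by
    refine le_trans ?_ hKlam
    rw [mul_assoc]
    exact Nat.mul_le_mul_left _ (Nat.le_mul_of_pos_left _ (by omega))
  have hlamn := lam_le h3
  -- `q ^ K` is at least `1 / √(2 n)`
  set x : ℝ := 2 ^ ((a + 1) * K) with hx
  have hx0 : 0 < x := by positivity
  have hxsq : x ^ 2 ≤ 2 * n := by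
    rw [hx, ← pow_mul]
    have : 2 ^ ((a + 1) * K * 2) ≤ 2 * n :=
      (Nat.pow_le_pow_right two_pos (by linarith)).trans (two_pow_lam_le h3)
    exact_mod_cast this
  have hxq : 1 / x ≤ q ^ K := by
    calc 1 / x = ((1 / 2) ^ (a + 1)) ^ K := by rw [hx, ← pow_mul, one_div_pow]
      _ ≤ q ^ K := by gcongr
  have hexp : (1 - q ^ K) ^ (n - K) ≤ Real.exp (-(√n / 4)) := by
    have hqK : q ^ K ≤ 1 := pow_le_one₀ hq0.le hq1
    calc (1 - q ^ K) ^ (n - K) ≤ (Real.exp (-(1 / x))) ^ (n - K) := by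
          refine pow_le_pow_left₀ (by linarith) ?_ _
          have := Real.add_one_le_exp (-(1 / x))
          linarith
      _ = Real.exp (-((n - K : ℕ) / x)) := by
          rw [← Real.exp_nat_mul]; congr 1; ring
      _ ≤ Real.exp (-(√n / 4)) := by
          refine Real.exp_le_exp.2 (neg_le_neg ?_)
          rw [le_div_iff₀ hx0]
          have hnK : (n : ℝ) / 2 ≤ (n - K : ℕ) := by
            rw [Nat.cast_sub (by omega)]
            have : (2 * K : ℝ) ≤ n := by exact_mod_cast h2K.trans hlamn
            linarith
          have hsq : √(n : ℝ) ^ 2 = n := Real.sq_sqrt hn0.le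
          have hxs : x ≤ 2 * √(n : ℝ) := by
            refine abs_le_of_sq_le_sq' ?_ (by positivity) |>.2
            rw [mul_pow, hsq]; linarith
          calc √(n : ℝ) / 4 * x ≤ √(n : ℝ) / 4 * (2 * √(n : ℝ)) := by gcongr
            _ = √(n : ℝ) ^ 2 / 2 := by ring
            _ = n / 2 := by rw [hsq]
            _ ≤ _ := hnK
  have hpow : (n : ℝ) ^ (c * (K + 4) + K) ≤ Real.exp (√n / 4) := by
    rw [← Real.rpow_natCast, Real.rpow_def_of_pos hn0]
    refine Real.exp_le_exp.2 ?_
    have hKr : (K : ℝ) ≤ 3 * Real.log n := by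
      have h5 : (K : ℝ) ≤ lam n := by exact_mod_cast (by omega : K ≤ lam n)
      linarith [lam_le_log n]
    have h6 : ((c * (K + 4) + K : ℕ) : ℝ) ≤ D * Real.log n := by
      push_cast
      have hc : (0 : ℝ) ≤ c := Nat.cast_nonneg c
      have h7 : (K : ℝ) + 4 ≤ 7 * Real.log n := by linarith
      rw [hD]
      nlinarith [mul_le_mul_of_nonneg_left h7 hc]
    calc Real.log n * ((c * (K + 4) + K : ℕ) : ℝ) ≤ Real.log n * (D * Real.log n) := by gcongr
      _ = D * Real.log n ^ 2 := by ring
      _ ≤ √n / 4 := by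
        rw [le_div_iff₀ (by norm_num)]
        refine Real.le_sqrt_of_sq_le ?_
        have hD0 : 0 < D := by positivity
        calc (D * Real.log n ^ 2 * 4) ^ 2 = 16 * D ^ 2 * Real.log n ^ 4 := by ring
          _ ≤ 16 * D ^ 2 * (1 / (16 * D ^ 2) * n) := by gcongr
          _ = n := by field_simp
  calc (n : ℝ) ^ (c * (K + 4)) * (n ^ K * (1 - q ^ K) ^ (n - K))
      = (n : ℝ) ^ (c * (K + 4) + K) * (1 - q ^ K) ^ (n - K) := by rw [pow_add]; ring
    _ ≤ Real.exp (√n / 4) * Real.exp (-(√n / 4)) := by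
        gcongr
        exact pow_nonneg (by linarith [pow_le_one₀ (n := K) hq0.le hq1]) _
    _ = 1 := by rw [← Real.exp_add]; simp

/-- The approximation ratio for a number of queries that tends to infinity. -/
theorem isLittleO_ratio {K : ℕ → ℕ} (hK : Tendsto K atTop atTop) (q : ℕ) :
    (fun n : ℕ => 1 + 2 * (q * lam n : ℕ) / ((K n : ℝ) + 1)) =o[atTop]
      fun n : ℕ => Real.logb 2 n := by
  have hlog : Tendsto (fun n : ℕ => Real.logb 2 n) atTop atTop :=
    (Real.tendsto_logb_atTop one_lt_two).comp tendsto_natCast_atTop_atTop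
  refine Asymptotics.IsLittleO.add ?_ ?_
  · exact (Asymptotics.isLittleO_const_left.2 (Or.inr (tendsto_norm_atTop_atTop.comp hlog)))
  · have h1 : (fun n : ℕ => (2 * (q * lam n : ℕ) : ℝ)) =O[atTop] fun n : ℕ => Real.logb 2 n := by
      refine Asymptotics.IsBigO.of_bound (4 * q) ?_
      filter_upwards [hlog.eventually_ge_atTop 1] with n hn
      have h2 := lam_le_logb n
      rw [Real.norm_of_nonneg (by positivity), Real.norm_of_nonneg (by linarith)]
      push_cast
      have h3 : (lam n : ℝ) ≤ 2 * Real.logb 2 n := by linarith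
      calc (2 * (q * lam n) : ℝ) ≤ 2 * (q * (2 * Real.logb 2 n)) := by gcongr
        _ = _ := by ring
    have h2 : (fun n : ℕ => ((K n : ℝ) + 1)⁻¹) =o[atTop] fun _ => (1 : ℝ) := by
      rw [Asymptotics.isLittleO_one_iff]
      exact tendsto_inv_atTop_zero.comp
        (tendsto_atTop_add_const_right _ _ (tendsto_natCast_atTop_atTop.comp hK))
    simpa [div_eq_mul_inv] using h1.mul_isLittleO h2

end Parameters

/-! ### Expected running time -/

section ExpectedTime

open MeasureTheory Filter

/-- The time of the search among the tuples of `γ` vertices. -/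
theorem PolyBdd.search_le {b : ℕ → ℕ} {c : ℕ} (hb : ∀ B, b B ≤ (B + 2) ^ c) {n γ K L : ℕ}
    (hn : 2 ≤ n) (hK : K ≤ n) (hL : L ≤ n) : b (n ^ γ + n + K + L) ≤ n ^ (c * (γ + 4)) := by
  refine (hb _).trans ?_
  rw [mul_comm, pow_mul]
  refine Nat.pow_le_pow_left ?_ c
  have h1 : 1 ≤ n ^ γ := Nat.one_le_pow _ _ (by omega)
  have h2 : 8 * n ≤ n ^ 4 := by
    calc 8 * n = 2 ^ 3 * n := by norm_num
      _ ≤ n ^ 3 * n := Nat.mul_le_mul_right _ (Nat.pow_le_pow_left hn 3)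
      _ = n ^ 4 := by ring
  rw [pow_add]
  calc n ^ γ + n + K + L + 2 ≤ n ^ γ * (8 * n) := by nlinarith
    _ ≤ n ^ γ * n ^ 4 := Nat.mul_le_mul_left _ h2

/-- An upper bound `a` for a cost that is incurred on an event `S` of probability at most `1 / a`
contributes at most `1` to the expected cost. -/
theorem lintegral_indicator_le_one {Ω : Type*} [MeasurableSpace Ω] [DiscreteMeasurableSpace Ω]
    (μ : Measure Ω) [IsProbabilityMeasure μ] (S : Set Ω) {a : ℕ} {b : ℝ} (hb : μ.real S ≤ b)
    (h : (a : ℝ) * b ≤ 1) : ∫⁻ ω, S.indicator (fun _ => (a : ℝ≥0∞)) ω ∂μ ≤ 1 := by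
  rw [lintegral_indicator_const .of_discrete, ← ofReal_measureReal, ← ENNReal.ofReal_natCast,
    ← ENNReal.ofReal_mul (Nat.cast_nonneg a), ← ENNReal.ofReal_one]
  exact ENNReal.ofReal_le_ofReal ((mul_le_mul_of_nonneg_left hb (Nat.cast_nonneg a)).trans h)

open Classical in
/-- The expected cost of the search among tuples is bounded if the two events that make it
necessary are sufficiently improbable. -/
theorem lintegral_search_le (p : unitInterval) {n K L c : ℕ} {b : ℕ → ℕ}
    (hb : ∀ B, b B ≤ (B + 2) ^ c) (hn : 2 ≤ n) (hK : K ≤ n) (hL : L ≤ n)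
    (h1 : (n : ℝ) ^ (c * (K + 4)) * (n ^ K * (1 - (1 - p : ℝ) ^ K) ^ (n - K)) ≤ 1)
    {s : ℝ} (hs0 : 0 ≤ s) (hs1 : s ≤ 1) (hs : s ^ 2 = 1 - p)
    (h2 : (n : ℝ) ^ (c * (n + 4)) * (n * s ^ L) ^ (L * (n / L)) ≤ 1) :
    ∫⁻ G, ((if dominationNumber G ≤ K ∨ NoGoodBlock G L then
      (b (n ^ dominationNumber G + n + K + L) : ℕ∞) else 0 : ℕ∞) : ℝ≥0∞)
      ∂(SimpleGraph.binomialRandom (Fin n) p) ≤ 2 := by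
  refine (lintegral_mono (g := fun G =>
    {G : SimpleGraph (Fin n) | dominationNumber G ≤ K}.indicator
      (fun _ => ((n ^ (c * (K + 4)) : ℕ) : ℝ≥0∞)) G +
    {G : SimpleGraph (Fin n) | NoGoodBlock G L}.indicator
      (fun _ => ((n ^ (c * (n + 4)) : ℕ) : ℝ≥0∞)) G) fun G => ?_).trans ?_
  · have hmono : ∀ m, dominationNumber G ≤ m →
        b (n ^ dominationNumber G + n + K + L) ≤ n ^ (c * (m + 4)) := fun m hm =>
      (PolyBdd.search_le hb hn hK hL).trans (Nat.pow_le_pow_right (by omega)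
        (Nat.mul_le_mul_left _ (by omega)))
    dsimp only
    by_cases h3 : dominationNumber G ≤ K
    · rw [if_pos (Or.inl h3), Set.indicator_of_mem (show G ∈ {G | dominationNumber G ≤ K} from h3)]
      refine le_trans ?_ le_self_add
      rw [ENat.toENNReal_coe]
      exact_mod_cast hmono K h3
    · by_cases h4 : NoGoodBlock G L
      · rw [if_pos (Or.inr h4), Set.indicator_of_mem (show G ∈ {G | NoGoodBlock G L} from h4)]
        refine le_trans ?_ le_add_self
        rw [ENat.toENNReal_coe]
        exact_mod_cast hmono n (dominationNumber_le_card G)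
      · simp [h3, h4]
  · rw [lintegral_add_left .of_discrete, ← one_add_one_eq_two]
    refine add_le_add
      (lintegral_indicator_le_one _ _ (measure_dominationNumber_le p (by omega) K) ?_)
      (lintegral_indicator_le_one _ _ (measure_noGoodBlock p hs0 hs1 hs L) ?_)
    · push_cast
      exact h1
    · push_cast
      exact h2

theorem expectedTime_ne_top (M : Algorithm) (p : unitInterval) {n : ℕ}
    {input : SimpleGraph (Fin n) → List Bool} (h : ∀ G, M.runTime (input G) ≠ ⊤) :
    expectedTime M p n input ≠ ⊤ := by
  obtain ⟨C, hC⟩ : ∃ C : ℕ, ∀ G, (M.runTime (input G)).toNat ≤ C := by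
    obtain ⟨C, hC⟩ := (Set.finite_range fun G => (M.runTime (input G)).toNat).bddAbove
    exact ⟨C, fun G => hC ⟨G, rfl⟩⟩
  refine ne_top_of_le_ne_top (ENNReal.natCast_ne_top C) ?_
  refine (lintegral_mono (g := fun _ => (C : ℝ≥0∞)) fun G => ?_).trans (by simp)
  dsimp only
  rw [← ENat.natCast_toNat (h G), ENat.toENNReal_coe]
  exact_mod_cast hC G

/-- An eventual polynomial bound for the expected running time of an algorithm that always halts
yields a bound for all `n ≥ 1`. -/
theorem expectedPolyTime_of_eventually {M : Algorithm} {p : unitInterval} {C d : ℕ}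
    (h : ∀ n ≥ 1, ∀ G : SimpleGraph (Fin n), M.runTime (encodeGraph G) ≠ ⊤)
    (hev : ∀ᶠ n in atTop, expectedTime M p n encodeGraph ≤ (C * n ^ d : ℕ)) :
    ExpectedPolyTime M p := by
  obtain ⟨N, hN⟩ := eventually_atTop.1 hev
  have hfin : ∀ n : ℕ, ∃ A : ℕ, 1 ≤ n → expectedTime M p n encodeGraph ≤ A := fun n => by
    by_cases hn : 1 ≤ n
    · obtain ⟨A, hA⟩ := ENNReal.exists_nat_gt (expectedTime_ne_top M p (h n hn))
      exact ⟨A, fun _ => hA.le⟩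
    · exact ⟨0, fun h => absurd h hn⟩
  choose A hA using hfin
  refine ⟨C + ∑ n ∈ Finset.range N, A n, d, fun n hn => ?_⟩
  have hpow : 1 ≤ n ^ d := Nat.one_le_pow _ _ hn
  rcases le_or_gt N n with hNn | hNn
  · refine (hN n hNn).trans ?_
    exact_mod_cast Nat.mul_le_mul_right _ (Nat.le_add_right _ _)
  · refine (hA n hn).trans ?_
    have : A n ≤ ∑ n ∈ Finset.range N, A n :=
      Finset.single_le_sum (fun _ _ => Nat.zero_le _) (Finset.mem_range.2 hNn)
    exact_mod_cast (by nlinarith : A n ≤ (C + ∑ n ∈ Finset.range N, A n) * n ^ d)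

/-- The expected time of `K` queries, if `f K < n`. -/
theorem sum_expectedTime_le {M : Algorithm} {p : unitInterval} {f : ℕ → ℕ} {C c n K : ℕ}
    (hf : Monotone f) (hC : ∀ k ≥ 1, expectedTime M p n (fun G => encodeInstance G k) ≤
      (C * f k * n ^ c : ℕ)) (hK : K ≤ n) (hfK : 0 < K → f K ≤ n) :
    ∑ k ∈ Finset.Icc 1 K, expectedTime M p n (fun G => encodeInstance G k) ≤
      (C * n ^ (c + 2) : ℕ) := by
  have h : ∀ k ∈ Finset.Icc 1 K, expectedTime M p n (fun G => encodeInstance G k) ≤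
      ((C * n * n ^ c : ℕ) : ℝ≥0∞) := fun k hk => by
    have hk := Finset.mem_Icc.1 hk
    refine (hC k hk.1).trans ?_
    have := (hf hk.2).trans (hfK (by omega))
    exact_mod_cast Nat.mul_le_mul_right _ (Nat.mul_le_mul_left _ this)
  refine (Finset.sum_le_card_nsmul _ _ _ h).trans ?_
  rw [Nat.card_Icc, Nat.add_sub_cancel, nsmul_eq_mul]
  have : K * (C * n * n ^ c) ≤ C * n ^ (c + 2) := by
    calc K * (C * n * n ^ c) ≤ n * (C * n * n ^ c) := Nat.mul_le_mul_right _ hK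
      _ = _ := by ring
  exact_mod_cast this

end ExpectedTime

end RandomDomSet

/-! ### Analysis of the approximation algorithm -/

theorem mainTheorem3 (p : unitInterval) (hp0 : 0 < p) (hp1 : p < 1)
    (f : ℕ → ℕ) (hf : Monotone f) (hfc : Computable f) (c : ℕ)
    (hA : RandomDomSet.DomSetSolvable p f c) :
    ∃ (r : ℕ → ℝ) (M : RandomDomSet.Algorithm),
      r =o[Filter.atTop] (fun n : ℕ => Real.logb 2 n) ∧
      RandomDomSet.ApproximatesMinDomSet M r ∧
      RandomDomSet.ExpectedPolyTime M p := by
  open RandomDomSet Filter MeasureTheory in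
  classical
  obtain ⟨M, hM, C, n₀, hC⟩ := hA
  obtain ⟨b₂, ⟨c₂, hb₂⟩, happ⟩ := exists_approximation hM
  have hp0' : (0 : ℝ) < p := hp0
  have hp1' : (p : ℝ) < 1 := hp1
  -- every block-vertex pair is counted at most twice, hence the square root of `1 - p`
  set s : ℝ := √(1 - p) with hs
  have hs2 : s ^ 2 = 1 - p := Real.sq_sqrt (by linarith)
  have hs0 : 0 ≤ s := Real.sqrt_nonneg _
  have hs1 : s < 1 := by
    rw [hs, Real.sqrt_lt' one_pos]
    linarith
  obtain ⟨q, hq⟩ := exists_blockLength hs0 hs1 c₂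
  obtain ⟨a, ha1, ha⟩ := exists_queryBound (q := 1 - p) (by linarith) (by linarith) c₂
  obtain ⟨K₀, hK₀def, hK₀f, hK₀⟩ := exists_def_slow hfc
  set gL : ℕ → ℕ := fun n => q * lam n with hgL
  set gK : ℕ → ℕ := fun n => min (K₀ n) (lam n / (2 * a)) with hgK
  have hgKtop : Tendsto gK atTop atTop := by
    refine tendsto_atTop.2 fun b => ?_
    filter_upwards [hK₀.eventually_ge_atTop b, tendsto_lam.eventually_ge_atTop (b * (2 * a))]
      with n h1 h2
    exact le_min h1 ((Nat.le_div_iff_mul_le (by omega)).2 h2)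
  obtain ⟨M', b₁, ⟨c₁, hb₁⟩, h⟩ := happ (gL := gL) (gK := gK)
    ((Def.const q).mul def_lam) (hK₀def.min (def_lam.div (Def.const (2 * a))))
  refine ⟨fun n => 1 + 2 * (q * lam n : ℕ) / ((gK n : ℝ) + 1), M', isLittleO_ratio hgKtop q,
    fun n hn G => ?_, ?_⟩
  · obtain ⟨⟨D, hout, hdom, hD⟩, -⟩ := h n hn G
    refine ⟨D, hout, hdom, ?_⟩
    have hγ : (1 : ℝ) ≤ dominationNumber G := by exact_mod_cast dominationNumber_pos G hn
    have hK1 : (0 : ℝ) < (gK n : ℝ) + 1 := by positivity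
    have hr0 : 0 ≤ 2 * (q * lam n : ℕ) / ((gK n : ℝ) + 1) := by positivity
    rw [add_mul, one_mul]
    rcases hD with hD | ⟨hlt, hD⟩
    · have h1 : (D.card : ℝ) ≤ dominationNumber G := by exact_mod_cast hD
      exact h1.trans (le_add_of_nonneg_right (by positivity))
    · have h1 : (D.card : ℝ) ≤ 2 * (q * lam n : ℕ) := by exact_mod_cast hD
      have h2 : (gK n : ℝ) + 1 ≤ dominationNumber G := by exact_mod_cast hlt
      refine h1.trans (le_trans ?_ (le_add_of_nonneg_left (by positivity)))
      rw [div_mul_eq_mul_div, le_div_iff₀ hK1]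
      exact mul_le_mul_of_nonneg_left h2 (by positivity)
  · refine expectedPolyTime_of_eventually (C := 3 ^ c₁ + C + 2) (d := c₁ + (c + 2))
      (fun n hn G => runTime_ne_top (h n hn G).1.choose_spec.1) ?_
    filter_upwards [hq, ha, eventually_ge_atTop 2, eventually_ge_atTop n₀] with n h1 h2 h3 h4
    have hKn : gK n ≤ n :=
      (min_le_right _ _).trans ((Nat.div_le_self _ _).trans (lam_le (by omega)))
    have hsearch := lintegral_search_le p hb₂ h3 hKn h1.1 (h2 (gK n) (min_le_right _ _)) hs0 hs1.le
      hs2 h1.2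
    have hqueries := sum_expectedTime_le hf (hC n (by omega) h4) hKn fun hpos =>
      (hf (min_le_left _ _)).trans (hK₀f n (hpos.trans_le (min_le_left _ _))).le
    have hb : b₁ n ≤ 3 ^ c₁ * n ^ c₁ := by
      rw [← mul_pow]
      exact (hb₁ n).trans (Nat.pow_le_pow_left (by omega) _)
    have hle : expectedTime M' p n encodeGraph ≤ (b₁ n : ℝ≥0∞) +
        ∑ k ∈ Finset.Icc 1 (gK n), expectedTime M p n (fun G => encodeInstance G k) + 2 := by
      refine (lintegral_mono fun G => ENat.toENNReal_mono (h n (by omega) G).2).trans ?_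
      simp only [ENat.toENNReal_add, ENat.toENNReal_coe]
      rw [lintegral_add_left .of_discrete, lintegral_add_left .of_discrete]
      refine add_le_add (add_le_add (by simp) (le_of_eq ?_)) hsearch
      simp only [expectedTime]
      rw [← lintegral_finsetSum _ fun _ _ => .of_discrete]
      exact lintegral_congr fun G => map_sum ENat.toENNRealRingHom _ _
    refine hle.trans ((add_le_add_left (add_le_add_right hqueries _) _).trans ?_)
    have h5 : n ^ c₁ ≤ n ^ (c₁ + (c + 2)) := Nat.pow_le_pow_right (by omega) (by omega)
    have h6 : n ^ (c + 2) ≤ n ^ (c₁ + (c + 2)) := Nat.pow_le_pow_right (by omega) (by omega)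
    have h7 : 1 ≤ n ^ (c₁ + (c + 2)) := Nat.one_le_pow _ _ (by omega)
    have h8 : b₁ n + C * n ^ (c + 2) + 2 ≤ (3 ^ c₁ + C + 2) * n ^ (c₁ + (c + 2)) := by
      have := Nat.mul_le_mul_left (3 ^ c₁) h5
      have := Nat.mul_le_mul_left C h6
      rw [add_mul, add_mul]
      omega
    exact_mod_cast h8
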